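/- Let $p$ be a prime, $K$ a finite unramified extension of $\mathbb{Q}_p$ of degree $f$ with ring of integers $\mathcal{O}_K$ (so $p$ is a uniformizer) and residue field $\mathbb{F}_q$, $q=p^f$. Let $E$ be a finite extension of $K$ with ring of integers $\mathcal{O}_E$ and residue field $\mathbb{F}$, and fix ring homomorphisms $\sigma_0:\mathcal{O}_K\to W(\mathbb{F})$ and $W(\mathbb{F})\to\mathcal{O}_E$. Let $N_0=\begin{pmatrix}1&\mathcal{O}_K\\0&1\end{pmatrix}\cong\mathcal{O}_K$ and $\mathcal{O}_K[[N_0]]=\varprojlim_n\mathcal{O}_K[\mathcal{O}_K/p^n]$ its Iwasawa algebra. For $0\le i\le f-1$ put $T_i=\sum_{\lambda\in\mathbb{F}_q^\times}[\lambda]^{-p^i}\begin{pmatrix}1&[\lambda]\\0&1\end{pmatrix}$ if $q\neq2$ (with $[\lambda]$ the Teichmüller lift), and $T_0=\begin{pmatrix}1&1\\0&1\end{pmatrix}-1$ if $q=2$. Let $\mathfrak{p}=(T_0,\dots,T_{f-1})$, let $S$ be the set of powers of $\prod_iT_i$, and complete $S^{-1}\mathcal{O}_K[[N_0]]$ with respect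 to the valuation $P/(\prod_iT_i)^k\mapsto\sup\{m:P\in\mathfrak{p}^m\}-kf$. Let $A_{\mathrm{mv},K}$ be the $p$-adic completion of the resulting ring $B$, with the topology of $\varprojlim_nB/p^n$ (quotient topologies on the $B/p^n$). Put $A_{\mathrm{mv},E_0}=W(\mathbb{F})\otimes_{\sigma_0,\mathcal{O}_K}A_{\mathrm{mv},K}$, $T_{\sigma_i}=1\otimes T_i$ and $A_{\mathrm{mv},E}=\mathcal{O}_E\otimes_{W(\mathbb{F})}A_{\mathrm{mv},E_0}$. Let $A_\infty=\mathbb{F}((T_{\sigma_0}^{1/p^\infty}))\langle(T_{\sigma_i}/T_{\sigma_0})^{\pm1/p^\infty}:1\le i\le f-1\rangle$, that is, the $T_{\sigma_0}$-adic completion of $\mathbb{F}[T_{\sigma_0}^{\pm1/p^\infty},(T_{\sigma_i}/T_{\sigma_0})^{\pm1/p^\infty}]$, in which the elements of $\mathbb{F}[T_{\sigma_0}^{1/p^\infty},(T_{\sigma_i}/T_{\sigma_0})^{\pm1/p^\infty}]$ are taken as the integral ones. Let $\varphi_q$ be the continuous $\mathbb{F}$-linear endomorphism of $A_\infty$ that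 raises each monomial in the $T_{\sigma_i}$ (with exponents in $\mathbb{Z}[1/p]$) to the power $q$; it acts on $W(A_\infty)$ by functoriality. Put $W_E(A_\infty)=\mathcal{O}_E\otimes_{W(\mathbb{F})}W(A_\infty)$. Then there is a unique continuous $\mathcal{O}_K$-linear ring endomorphism $\varphi_q$ of $A_{\mathrm{mv},K}$ which extends the endomorphism of $\mathcal{O}_K[[N_0]]$ induced by multiplication by $q$ on $N_0\cong\mathcal{O}_K$; extend it $W(\mathbb{F})$-linearly to $A_{\mathrm{mv},E_0}$. There is a unique homomorphism of $W(\mathbb{F})$-algebras $\iota:A_{\mathrm{mv},E_0}\to W(A_\infty)$ which commutes with $\varphi_q$ and whose composite with $W(A_\infty)\to A_\infty$ sends $T_{\sigma_i}$ to $T_{\sigma_i}$ for all $i$ and is continuous on $A_{\mathrm{mv},K}$. The homomorphism $A_{\mathrm{mv},E}\to W_E(A_\infty)$ deduced from $\iota$ by extension of scalars to $\mathcal{O}_E$ is injective and faithfully flat. -/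

import Mathlib

open scoped TensorProduct

noncomputable section

namespace MvIwasawa

/-! ### Rings of integers of finite extensions of `ℚ_[p]` -/

section IntegerRing

variable (p : ℕ) [Fact p.Prime] (K : Type*) [Field K] [Algebra ℚ_[p] K]

/-- The ring of integers of an extension `K` of `ℚ_[p]`: the integral closure of `ℤ_[p]` in `K`. -/
def integerRing : Subring K :=
  letI : Algebra ℤ_[p] K := Algebra.compHom K (algebraMap ℤ_[p] ℚ_[p])
  (integralClosure ℤ_[p] K).toSubring

variable {p K}

theorem mem_integerRing_iff [FiniteDimensional ℚ_[p] K] (x : K) :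
    x ∈ integerRing p K ↔ spectralNorm ℚ_[p] K x ≤ 1 := by
  let : Algebra ℤ_[p] K := Algebra.compHom K (algebraMap ℤ_[p] ℚ_[p])
  have : IsScalarTower ℤ_[p] ℚ_[p] K := IsScalarTower.of_algebraMap_eq fun _ => rfl
  have hx : IsIntegral ℚ_[p] x := Algebra.IsIntegral.isIntegral x
  change IsIntegral ℤ_[p] x ↔ _
  rw [spectralNorm, spectralValue_le_one_iff (minpoly.monic hx)]
  constructor
  · intro h n
    rw [minpoly.isIntegrallyClosed_eq_field_fractions' ℚ_[p] h, Polynomial.coeff_map]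
    exact PadicInt.norm_le_one _
  · intro h
    have hl : minpoly ℚ_[p] x ∈ Polynomial.lifts (algebraMap ℤ_[p] ℚ_[p]) := by
      rw [Polynomial.lifts_iff_coeff_lifts]
      intro n
      exact ⟨⟨_, h n⟩, rfl⟩
    obtain ⟨P, hP, -, hm⟩ := Polynomial.lifts_and_natDegree_eq_and_monic hl (minpoly.monic hx)
    refine ⟨P, hm, ?_⟩
    have h2 := minpoly.aeval ℚ_[p] x
    rw [← hP, Polynomial.aeval_map_algebraMap] at h2
    exact h2

instance [FiniteDimensional ℚ_[p] K] : IsLocalRing (integerRing p K) := by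
  have key : ∀ x : integerRing p K, IsUnit x ↔ spectralNorm ℚ_[p] K x = 1 := by
    intro x
    have hx := (mem_integerRing_iff (x : K)).1 x.2
    constructor
    · rintro ⟨u, rfl⟩
      have h1 : spectralNorm ℚ_[p] K ((u : integerRing p K) : K) *
          spectralNorm ℚ_[p] K ((u⁻¹ : (integerRing p K)ˣ) : integerRing p K) = 1 := by
        rw [← spectralAlgNorm_def, ← spectralAlgNorm_def, ← spectralAlgNorm_mul,
          ← Subring.coe_mul, Units.mul_inv, Subring.coe_one, spectralAlgNorm_one]
      have h2 := (mem_integerRing_iff _).1 ((u⁻¹ : (integerRing p K)ˣ) : integerRing p K).2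
      have h3 := spectralNorm_nonneg (K := ℚ_[p]) ((u : integerRing p K) : K)
      nlinarith
    · intro h
      have h0 : (x : K) ≠ 0 := by
        intro h0
        rw [h0, spectralNorm_zero] at h
        exact zero_ne_one h
      have h1 : spectralNorm ℚ_[p] K (x : K) * spectralNorm ℚ_[p] K (x : K)⁻¹ = 1 := by
        rw [← spectralAlgNorm_def, ← spectralAlgNorm_def, ← spectralAlgNorm_mul,
          mul_inv_cancel₀ h0, spectralAlgNorm_one]
      rw [h, one_mul] at h1
      exact IsUnit.of_mul_eq_one ⟨(x : K)⁻¹, (mem_integerRing_iff _).2 h1.le⟩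
        (Subtype.ext (mul_inv_cancel₀ h0))
  refine IsLocalRing.of_nonunits_add fun a b ha hb => ?_
  rw [mem_nonunits_iff, key] at *
  have ha' := lt_of_le_of_ne ((mem_integerRing_iff (a : K)).1 a.2) ha
  have hb' := lt_of_le_of_ne ((mem_integerRing_iff (b : K)).1 b.2) hb
  refine (lt_of_le_of_lt ?_ (max_lt ha' hb')).ne
  exact isNonarchimedean_spectralNorm (K := ℚ_[p]) (L := K) (a : K) (b : K)

end IntegerRing

/-- The residue field of a finite extension `E` of `ℚ_[p]`. -/
abbrev resField (p : ℕ) [Fact p.Prime] (E : Type*) [Field E] [Algebra ℚ_[p] E]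
    [FiniteDimensional ℚ_[p] E] : Type _ :=
  IsLocalRing.ResidueField (integerRing p E)

/-! ### Filtered rings and their completions -/

/-- An exhaustive, decreasing filtration on a commutative ring
by additive subgroups, indexed by `ℤ`.
The filtration of a valuation `v` is `x ∈ sub n ↔ n ≤ v x`. -/
structure RingFiltration (R : Type*) [CommRing R] where
  sub : ℤ → AddSubgroup R
  anti : Antitone sub
  one_mem : 1 ∈ sub 0
  mul_mem : ∀ {m n : ℤ} {x y : R}, x ∈ sub m → y ∈ sub n → x * y ∈ sub (m + n)
  exhaustive : ∀ x : R, ∃ n, x ∈ sub n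

namespace RingFiltration

variable {R : Type*} [CommRing R] (F : RingFiltration R)

theorem basis : RingSubgroupsBasis F.sub := by
  refine RingSubgroupsBasis.of_comm _ (fun i j => ⟨max i j, ?_⟩) (fun i => ⟨max i 0, ?_⟩)
    fun x i => ?_
  · exact le_inf (F.anti (le_max_left _ _)) (F.anti (le_max_right _ _))
  · rintro _ ⟨x, hx, y, hy, rfl⟩
    exact F.anti (by omega) (F.mul_mem hx hy)
  · obtain ⟨n, hn⟩ := F.exhaustive x
    exact ⟨i - n, fun y hy => F.anti (by omega) (F.mul_mem hn hy)⟩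

/-- The ring `R`, carrying the topology for which the `F.sub n` form a basis of
neighbourhoods of `0`. -/
def Space (_ : RingFiltration R) : Type _ := R

instance : CommRing F.Space := inferInstanceAs (CommRing R)

instance : TopologicalSpace F.Space := F.basis.topology

instance : IsTopologicalRing F.Space :=
  RingFilterBasis.isTopologicalRing F.basis.toRingFilterBasis

instance : UniformSpace F.Space := IsTopologicalAddGroup.rightUniformSpace F.Space

instance : IsUniformAddGroup F.Space := isUniformAddGroup_of_addCommGroup

/-- The (Hausdorff) completion of `R` for the topology defined by the filtration. -/
abbrev Completion : Type _ := UniformSpace.Completion F.Space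

/-- The canonical map from a filtered ring to its completion. -/
def of : R →+* F.Completion :=
  UniformSpace.Completion.coeRingHom (α := F.Space)

/-- A ring homomorphism between filtered rings, seen between the associated topological rings. -/
def homSpace {S : Type*} [CommRing S] (G : RingFiltration S) (f : R →+* S) :
    F.Space →+* G.Space := f

/-- A ring homomorphism which maps `F.sub n` to `G.sub n` for all `n ≥ 0` is continuous. -/
theorem continuous_homSpace {S : Type*} [CommRing S] (G : RingFiltration S) (f : R →+* S)
    (hf : ∀ n : ℤ, 0 ≤ n → ∀ x ∈ F.sub n, f x ∈ G.sub n) :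
    Continuous (F.homSpace G f) := by
  refine continuous_of_continuousAt_zero (F.homSpace G f).toAddMonoidHom ?_
  have h1 : (nhds (0 : F.Space)).HasBasis (fun _ => True) fun i => (F.sub i : Set R) :=
    F.basis.hasBasis_nhds_zero
  have h2 : (nhds (0 : G.Space)).HasBasis (fun _ => True) fun i => (G.sub i : Set S) :=
    G.basis.hasBasis_nhds_zero
  have h3 : Filter.Tendsto (F.homSpace G f) (nhds 0) (nhds 0) := by
    refine (h1.tendsto_iff h2).2 fun i _ => ⟨max i 0, trivial, fun x hx => ?_⟩
    exact G.anti (le_max_left i 0) (hf _ (le_max_right i 0) x hx)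
  have h4 : F.homSpace G f 0 = 0 := map_zero _
  change Filter.Tendsto (F.homSpace G f) (nhds 0) (nhds (F.homSpace G f 0))
  rwa [h4]

/-- The extension by continuity to the completions of a ring homomorphism which maps `F.sub n`
to `G.sub n` for all `n ≥ 0`. -/
def map {S : Type*} [CommRing S] (G : RingFiltration S) (f : R →+* S)
    (hf : ∀ n : ℤ, 0 ≤ n → ∀ x ∈ F.sub n, f x ∈ G.sub n) :
    F.Completion →+* G.Completion :=
  UniformSpace.Completion.extensionHom
    ((UniformSpace.Completion.coeRingHom (α := G.Space)).comp (F.homSpace G f))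
    (UniformSpace.Completion.continuous_coeRingHom.comp (F.continuous_homSpace G f hf))

/-- For an ideal `I` of `R` and an element `t ∈ I ^ f`, the filtration of `R[1/t]` whose `n`-th
step consists of the fractions `P / t ^ k` with `P ∈ I ^ (n + k f)`
(where `I ^ m` is the unit ideal for `m ≤ 0`). -/
def fractions {R : Type*} [CommRing R] (I : Ideal R) (t : R) (f : ℕ) (ht : t ∈ I ^ f) :
    RingFiltration (Localization.Away t) where
  sub n :=
    { carrier := {x | ∃ (k : ℕ) (P : R), P ∈ I ^ (n + k * f).toNat ∧
        x * algebraMap R (Localization.Away t) t ^ k = algebraMap R (Localization.Away t) P}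
      zero_mem' := ⟨0, 0, zero_mem _, by simp⟩
      add_mem' := by
        rintro x y ⟨k, P, hP, hx⟩ ⟨l, Q, hQ, hy⟩
        refine ⟨k + l, P * t ^ l + Q * t ^ k, add_mem ?_ ?_, ?_⟩
        · have h := Ideal.mul_mem_mul hP (Ideal.pow_mem_pow ht l)
          rw [← pow_mul, ← pow_add] at h
          refine Ideal.pow_le_pow_right ?_ h
          rw [Int.toNat_le]; push_cast
          have := Int.self_le_toNat (n + k * f)
          linarith
        · have h := Ideal.mul_mem_mul hQ (Ideal.pow_mem_pow ht k)
          rw [← pow_mul, ← pow_add] at h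
          refine Ideal.pow_le_pow_right ?_ h
          rw [Int.toNat_le]; push_cast
          have := Int.self_le_toNat (n + l * f)
          linarith
        · rw [map_add, map_mul, map_mul, map_pow, map_pow, ← hx, ← hy]
          ring
      neg_mem' := by
        rintro x ⟨k, P, hP, hx⟩
        exact ⟨k, -P, neg_mem hP, by rw [map_neg, ← hx, neg_mul]⟩ }
  anti m n hmn := by
    rintro x ⟨k, P, hP, hx⟩
    exact ⟨k, P, Ideal.pow_le_pow_right (Int.toNat_le_toNat (by linarith)) hP, hx⟩
  one_mem := ⟨0, 1, by simp, by simp⟩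
  mul_mem := by
    rintro m n x y ⟨k, P, hP, hx⟩ ⟨l, Q, hQ, hy⟩
    refine ⟨k + l, P * Q, ?_, ?_⟩
    · have h := Ideal.mul_mem_mul hP hQ
      rw [← pow_add] at h
      refine Ideal.pow_le_pow_right ?_ h
      rw [Int.toNat_le]; push_cast
      have h1 := Int.self_le_toNat (m + k * f)
      have h2 := Int.self_le_toNat (n + l * f)
      linarith
    · rw [map_mul, ← hx, ← hy]
      ring
  exhaustive x := by
    obtain ⟨⟨P, s⟩, hs⟩ := IsLocalization.surj (Submonoid.powers t) x
    obtain ⟨k, hk⟩ := s.2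
    refine ⟨-(k * f), k, P, by simp, ?_⟩
    rw [← map_pow]
    simp only at hk hs
    rw [hk, hs]

/-- The filtration of a group algebra `k[G]` attached to a degree map `d : G → ℚ`: the `n`-th step
consists of the linear combinations of elements of `G` of degree at least `n`. -/
def degree (k : Type*) [CommRing k] {G : Type*} [AddCommGroup G] (d : G →+ ℚ) :
    RingFiltration (AddMonoidAlgebra k G) where
  sub n :=
    { carrier := {x | ∀ a, x.coeff a ≠ 0 → (n : ℚ) ≤ d a}
      zero_mem' := fun a ha => absurd rfl ha
      add_mem' := by
        intro x y hx hy a ha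
        by_cases h : x.coeff a = 0
        · refine hy a fun h' => ha ?_
          simp [h, h']
        · exact hx a h
      neg_mem' := by
        intro x hx a ha
        exact hx a fun h => ha (by simp [h]) }
  anti m n hmn := fun x hx a ha => (Int.cast_le.2 hmn).trans (hx a ha)
  one_mem a ha := by
    rw [AddMonoidAlgebra.one_def, AddMonoidAlgebra.coeff_single] at ha
    by_cases h : a = 0
    · simp [h]
    · exact absurd (Finsupp.single_eq_of_ne h) ha
  mul_mem := by
    classical
    intro m n x y hx hy a ha
    rw [AddMonoidAlgebra.coeff_mul] at ha
    obtain ⟨b, hb, h1⟩ := Finset.exists_ne_zero_of_sum_ne_zero ha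
    obtain ⟨c, hc, h2⟩ := Finset.exists_ne_zero_of_sum_ne_zero h1
    have h3 : b + c = a := by
      by_contra h
      exact h2 (if_neg h)
    rw [← h3, map_add, Int.cast_add]
    exact add_le_add (hx b (Finsupp.mem_support_iff.1 hb)) (hy c (Finsupp.mem_support_iff.1 hc))
  exhaustive x := by
    obtain ⟨r, hr⟩ := (x.coeff.support.image d).bddBelow
    refine ⟨⌊r⌋, fun a ha => (Int.floor_le r).trans (hr ?_)⟩
    exact Finset.mem_coe.2 (Finset.mem_image_of_mem d (Finsupp.mem_support_iff.2 ha))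

end RingFiltration

/-! ### The Iwasawa algebra -/

section Iwasawa

variable (p : ℕ) (O : Type*) [CommRing O]

/-- The additive group `O / p ^ n O`. -/
abbrev Layer (n : ℕ) : Type _ := O ⧸ Ideal.span {(p : O)} ^ n

/-- The group algebra `O[O / p ^ n O]` of the additive group `O / p ^ n O`. -/
abbrev LayerAlgebra (n : ℕ) : Type _ := AddMonoidAlgebra O (Layer p O n)

/-- The reduction `O / p ^ (n + 1) O → O / p ^ n O`. -/
def layerRed (n : ℕ) : Layer p O (n + 1) →+* Layer p O n :=
  Ideal.Quotient.factor (Ideal.pow_le_pow_right n.le_succ)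

/-- The transition map `O[O / p ^ (n + 1) O] → O[O / p ^ n O]`. -/
def layerTransition (n : ℕ) : LayerAlgebra p O (n + 1) →ₐ[O] LayerAlgebra p O n :=
  AddMonoidAlgebra.mapDomainAlgHom O O (layerRed p O n).toAddMonoidHom

/-- The Iwasawa algebra `O[[O]] = lim_n O[O / p ^ n O]` of the additive group `O`, as a
subalgebra of the product.
The group `N₀` of unipotent upper triangular matrices in `GL₂(O)` is isomorphic to `O`,
so that this is `O[[N₀]]`. -/
def iwasawaSubalgebra : Subalgebra O (∀ n, LayerAlgebra p O n) where
  carrier := {x | ∀ n, layerTransition p O n (x (n + 1)) = x n}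
  mul_mem' hx hy n := by simp only [Pi.mul_apply, map_mul, hx n, hy n]
  add_mem' hx hy n := by simp only [Pi.add_apply, map_add, hx n, hy n]
  algebraMap_mem' r n := by simp only [Pi.algebraMap_apply, AlgHom.commutes]

/-- The Iwasawa algebra `O[[N₀]]`. -/
def Iwasawa : Type _ := iwasawaSubalgebra p O

instance : CommRing (Iwasawa p O) := inferInstanceAs (CommRing (iwasawaSubalgebra p O))

instance : Algebra O (Iwasawa p O) := inferInstanceAs (Algebra O (iwasawaSubalgebra p O))

/-- The element of the Iwasawa algebra given by the group element `a ∈ O ≅ N₀`. -/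
def groupElt (a : O) : Iwasawa p O :=
  ⟨fun _ => AddMonoidAlgebra.single (Ideal.Quotient.mk _ a) 1, fun n => by
    simp [layerTransition, layerRed]⟩

/-- The `O`-linear endomorphism of `O[[N₀]]` induced by multiplication by `c` on `N₀ ≅ O`. -/
def iwasawaMul (c : O) : Iwasawa p O →ₐ[O] Iwasawa p O :=
  AlgHom.codRestrict
    ((AlgHom.pi fun n =>
      (AddMonoidAlgebra.mapDomainAlgHom O O
        (AddMonoidHom.mulLeft (Ideal.Quotient.mk (Ideal.span {(p : O)} ^ n) c))).comp
        (Pi.evalAlgHom O _ n)).comp (iwasawaSubalgebra p O).val)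
    (iwasawaSubalgebra p O) (by
      intro x n
      have hx := x.2 n
      simp only [AlgHom.comp_apply, AlgHom.pi_apply, Pi.evalAlgHom_apply, Subalgebra.coe_val]
      rw [← hx]
      simp only [layerTransition]
      rw [← AlgHom.comp_apply, ← AlgHom.comp_apply, ← AddMonoidAlgebra.mapDomainAlgHom_comp,
        ← AddMonoidAlgebra.mapDomainAlgHom_comp]
      congr 2
      ext y
      simp [layerRed])

/-- The variables `T_0, …, T_{f-1}` of `O[[N₀]]`, where `q = p ^ f`. For `q ≠ 2`, one has
`T_i = ∑_λ [λ]^{-p^i} ⬝ ([λ] as an element of the group N₀)`, the sum being over the Teichmüller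
lifts `[λ] ∈ O` of the nonzero elements of the residue field `𝔽_q`; these are the elements `ζ`
of `O` with `ζ ^ (q - 1) = 1`. For `q = 2`, one has `T_0 = (1 as an element of the group N₀) - 1`.
-/
def T (f : ℕ) (i : Fin f) : Iwasawa p O :=
  if p ^ f = 2 then groupElt p O 1 - 1
  else ∑ᶠ ζ : rootsOfUnity (p ^ f - 1) O,
    (((ζ : Oˣ)⁻¹ ^ p ^ (i : ℕ) : Oˣ) : O) • groupElt p O ((ζ : Oˣ) : O)

variable (f : ℕ)

/-- The product `T_0 ⋯ T_{f-1}`. -/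
def prodT : Iwasawa p O := ∏ i, T p O f i

/-- The ideal `𝔭 = (T_0, …, T_{f-1})` of `O[[N₀]]`. -/
def idealT : Ideal (Iwasawa p O) := Ideal.span (Set.range (T p O f))

theorem prodT_mem : prodT p O f ∈ idealT p O f ^ f := by
  have h := Ideal.prod_mem_prod (s := Finset.univ) (I := fun _ : Fin f => idealT p O f)
    (x := fun i => T p O f i) fun i _ => Ideal.subset_span ⟨i, rfl⟩
  simpa [prodT] using h

/-- The localization `S⁻¹ O[[N₀]]` at the powers of `T_0 ⋯ T_{f-1}`. -/
abbrev LocIwasawa : Type _ := Localization.Away (prodT p O f)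

/-- The filtration of `S⁻¹ O[[N₀]]` attached to the valuation
`v (P / (T_0 ⋯ T_{f-1}) ^ k) = ord_𝔭 P - k f`, where `ord_𝔭 P = sup {m | P ∈ 𝔭 ^ m}`:
the elements with `v ≥ n` are the `P / (T_0 ⋯ T_{f-1}) ^ k` with `P ∈ 𝔭 ^ (n + k f)`. -/
def locFiltration : RingFiltration (LocIwasawa p O f) :=
  RingFiltration.fractions (idealT p O f) (prodT p O f) f (prodT_mem p O f)

/-- The completion of `S⁻¹ O[[N₀]]` with respect to the valuation `v`. -/
abbrev LocCompletion : Type _ := (locFiltration p O f).Completion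

instance : Algebra O (LocCompletion p O f) :=
  ((locFiltration p O f).of.comp (algebraMap O (LocIwasawa p O f))).toAlgebra

/-- The ring `A_mv`: the `p`-adic completion of the completion of `S⁻¹ O[[N₀]]` with respect
to `v`. -/
def Amv : Type _ :=
  AdicCompletion (Ideal.span {(p : LocCompletion p O f)}) (LocCompletion p O f)

instance : CommRing (Amv p O f) := inferInstanceAs (CommRing (AdicCompletion _ _))

instance : Algebra O (Amv p O f) := inferInstanceAs (Algebra O (AdicCompletion _ _))

/-- The topology of `A_mv` as the limit of the quotients of the completed localization by the
powers of `p`, each with its quotient topology. A basis of neighbourhoods of `0` is given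
by the `p ^ m A_mv + {v ≥ n}`. -/
instance : TopologicalSpace (Amv p O f) :=
  ⨅ n : ℕ, TopologicalSpace.induced
    (AdicCompletion.eval (Ideal.span {(p : LocCompletion p O f)}) (LocCompletion p O f) n)
    inferInstance

/-- The canonical map `O[[N₀]] → A_mv`. -/
def toAmv : Iwasawa p O →+* Amv p O f :=
  (algebraMap (LocCompletion p O f)
    (AdicCompletion (Ideal.span {(p : LocCompletion p O f)}) (LocCompletion p O f))).comp
    ((locFiltration p O f).of.comp (algebraMap (Iwasawa p O) (LocIwasawa p O f)))

/-- The property that `φ` is the continuous `O`-linear endomorphism `φ_q` of `A_mv` which extends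
the endomorphism of `O[[N₀]]` induced by multiplication by `q = p ^ f` on `N₀`. -/
structure IsPhiQ (φ : Amv p O f →ₐ[O] Amv p O f) : Prop where
  continuous : Continuous φ
  extends_mul : ∀ x : Iwasawa p O, φ (toAmv p O f x) = toAmv p O f (iwasawaMul p O (p ^ f) x)

end Iwasawa

/-! ### The perfectoid algebra `A_∞` -/

section AInf

variable (p : ℕ)

/-- The additive group `ℤ[1/p]`. -/
def invPow : AddSubgroup ℚ where
  carrier := {x | ∃ (n : ℕ) (m : ℤ), (p : ℚ) ^ n * x = m}
  zero_mem' := ⟨0, 0, by simp⟩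
  add_mem' := by
    rintro x y ⟨n, m, h⟩ ⟨n', m', h'⟩
    refine ⟨n + n', p ^ n' * m + p ^ n * m', ?_⟩
    push_cast
    rw [← h, ← h']
    ring
  neg_mem' := by
    rintro x ⟨n, m, h⟩
    exact ⟨n, -m, by push_cast; rw [← h]; ring⟩

/-- The total degree of an exponent `a ∈ ℤ[1/p] ^ f`. -/
def totalDegree (f : ℕ) : (Fin f → invPow p) →+ ℚ :=
  ∑ i, (invPow p).subtype.comp (Pi.evalAddMonoidHom _ i)

variable (f : ℕ) (k : Type*) [CommRing k]

/-- The algebra `k[T_0^{±1/p^∞}, …, T_{f-1}^{±1/p^∞}]`. -/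
abbrev PerfLaurent : Type _ := AddMonoidAlgebra k (Fin f → invPow p)

/-- The filtration of `k[T_0^{±1/p^∞}, …, T_{f-1}^{±1/p^∞}]` by the total degree, for which each
`T_i` has degree `1`. It defines the `T_0`-adic topology with respect to the subring
`k[T_0^{1/p^∞}, (T_i/T_0)^{±1/p^∞} : 1 ≤ i ≤ f - 1]`. -/
def perfFiltration : RingFiltration (PerfLaurent p f k) :=
  RingFiltration.degree k (totalDegree p f)

/-- The ring `A_∞ = k((T_0^{1/p^∞}))⟨(T_i/T_0)^{±1/p^∞} : 1 ≤ i ≤ f - 1⟩`: the completion of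
`k[T_0^{±1/p^∞}, …, T_{f-1}^{±1/p^∞}] = k[T_0^{±1/p^∞}, (T_i/T_0)^{±1/p^∞} : 1 ≤ i ≤ f - 1]`
for the `T_0`-adic topology. -/
def AInf : Type _ := (perfFiltration p f k).Completion

instance : CommRing (AInf p f k) := inferInstanceAs (CommRing (perfFiltration p f k).Completion)

instance : TopologicalSpace (AInf p f k) :=
  inferInstanceAs (TopologicalSpace (perfFiltration p f k).Completion)

instance : IsTopologicalRing (AInf p f k) :=
  inferInstanceAs (IsTopologicalRing (perfFiltration p f k).Completion)

instance : Algebra k (AInf p f k) :=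
  ((perfFiltration p f k).of.comp (algebraMap k (PerfLaurent p f k))).toAlgebra

/-- The element `T_i` of `A_∞`. -/
def tInf (i : Fin f) : AInf p f k :=
  (perfFiltration p f k).of
    (AddMonoidAlgebra.single (Pi.single i ⟨1, 0, 1, by simp⟩) 1)

/-- The `k`-linear endomorphism `T^a ↦ T^{q a}`, `q = p ^ f`, of
`k[T_0^{±1/p^∞}, …, T_{f-1}^{±1/p^∞}]`. -/
def perfPhi : PerfLaurent p f k →ₐ[k] PerfLaurent p f k :=
  AddMonoidAlgebra.mapDomainAlgHom k k (nsmulAddMonoidHom (p ^ f))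

theorem perfPhi_mem [Fact p.Prime] (n : ℤ) (hn : 0 ≤ n) (x : PerfLaurent p f k)
    (hx : x ∈ (perfFiltration p f k).sub n) :
    (perfPhi p f k).toRingHom x ∈ (perfFiltration p f k).sub n := by
  classical
  intro a ha
  have h1 : a ∈ (x.coeff.mapDomain (nsmulAddMonoidHom (p ^ f))).support :=
    Finsupp.mem_support_iff.2 ha
  obtain ⟨b, hb, rfl⟩ := Finset.mem_image.1 (Finsupp.mapDomain_support h1)
  have h2 : (n : ℚ) ≤ totalDegree p f b := hx b (Finsupp.mem_support_iff.1 hb)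
  have h3 : (0 : ℚ) ≤ n := Int.cast_nonneg hn
  have h4 : (1 : ℚ) ≤ ((p ^ f : ℕ) : ℚ) :=
    Nat.one_le_cast.2 (Nat.one_le_pow _ _ (Fact.out : p.Prime).pos)
  change (n : ℚ) ≤ totalDegree p f ((p ^ f) • b)
  rw [map_nsmul, nsmul_eq_mul]
  nlinarith

/-- The continuous `k`-linear endomorphism `φ_q` of `A_∞` with `φ_q(T_i) = T_i^q`, `q = p ^ f`. -/
def phiInf [Fact p.Prime] : AInf p f k →+* AInf p f k :=
  (perfFiltration p f k).map (perfFiltration p f k) (perfPhi p f k).toRingHom (perfPhi_mem p f k)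

instance [Fact p.Prime] : Algebra (WittVector p k) (WittVector p (AInf p f k)) :=
  (WittVector.map (algebraMap k (AInf p f k))).toAlgebra

end AInf

/-! ### The comparison map -/

section Comparison

variable (p : ℕ) [Fact p.Prime] (O : Type*) [CommRing O] (f : ℕ) (k : Type*) [CommRing k]
  [Algebra O (WittVector p k)]

/-- `A_{mv,E₀} = W(k) ⊗_{O} A_mv`. -/
abbrev AmvE0 : Type _ := WittVector p k ⊗[O] Amv p O f

/-- The canonical map `A_mv → A_{mv,E₀}`. The image of `T_i` is denoted `T_{σ_i}`. -/
def toAmvE0 : Amv p O f →ₐ[O] AmvE0 p O f k := Algebra.TensorProduct.includeRight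

/-- The endomorphism `id ⊗ φ` of `A_{mv,E₀}`. -/
def phiE0 (φ : Amv p O f →ₐ[O] Amv p O f) : AmvE0 p O f k →ₐ[WittVector p k] AmvE0 p O f k :=
  Algebra.TensorProduct.map (AlgHom.id (WittVector p k) (WittVector p k)) φ

/-- The property that `ι : A_{mv,E₀} → W(A_∞)` is the canonical map: it commutes with `φ_q`
and its reduction `A_{mv,E₀} → A_∞` modulo `p` is continuous and maps `T_{σ_i}` to `T_i`. -/
structure IsCanonicalMap (φ : Amv p O f →ₐ[O] Amv p O f)
    (ι : AmvE0 p O f k →ₐ[WittVector p k] WittVector p (AInf p f k)) : Prop where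
  map_phi : ∀ x, ι (phiE0 p O f k φ x) = WittVector.map (phiInf p f k) (ι x)
  continuous_red : Continuous fun x : Amv p O f => (ι (toAmvE0 p O f k x)).coeff 0
  red_T : ∀ i, (ι (toAmvE0 p O f k (toAmv p O f (T p O f i)))).coeff 0 = tInf p f k i

variable (OE : Type*) [CommRing OE] [Algebra (WittVector p k) OE]

/-- `A_{mv,E} = 𝒪_E ⊗_{W(k)} A_{mv,E₀}`. -/
abbrev AmvE : Type _ := OE ⊗[WittVector p k] AmvE0 p O f k

/-- `W_E(A_∞) = 𝒪_E ⊗_{W(k)} W(A_∞)`. -/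
abbrev WEInf : Type _ := OE ⊗[WittVector p k] WittVector p (AInf p f k)

variable {p O f k}

/-- The map `A_{mv,E} → W_E(A_∞)` deduced from `ι : A_{mv,E₀} → W(A_∞)` by base change
to `𝒪_E`. -/
def extendScalars (ι : AmvE0 p O f k →ₐ[WittVector p k] WittVector p (AInf p f k)) :
    AmvE p O f k OE →ₐ[OE] WEInf p f k OE :=
  Algebra.TensorProduct.map (AlgHom.id OE OE) ι

end Comparison

end MvIwasawa

end

/-!
Write `Λ` for the Iwasawa algebra `O[[N_0]]`, where `O` is the ring of integers of `K`, and
`q = p ^ f`. All arguments on `O` use only an abstract reduction map `O → 𝔽_q` with kernel `(p)`,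
for `O` complete and `p`-torsion free (`IsUnramifiedReduction`, supplied by
`exists_isUnramifiedReduction`).

*Structure of `A_mv`.* The `T_i` are coordinates: `Λ` is the ring of power series over `O` in the
`T_i` (`IsUnramifiedReduction.exists_powerSeries_equiv`). Indeed, modulo `p`, their images in the
group algebra of `O / p ^ n` generate the augmentation ideal (`augIdeal_eq_span`: an additive
function on `𝔽_q` is the sum of its components under the characters `ζ ↦ ζ ^ p ^ i`), their
`p ^ n`-th powers vanish, and there are as many monomials with exponents below `p ^ n` as elements
of `O / p ^ n`, so that these form a basis. Power series in the `T_i` can be reduced modulo `p`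
and expanded in `A_∞`. This passes to the localization, its completion `B` and the `p`-adic
completion (`IsUnramifiedReduction.exists_red`, `exists_complRed`, `Amv.exists_isRed`): `A_mv` is
`p`-adically complete without `p`-torsion, and `A_mv / p` is the closed subring of `A_∞` of series
with integral exponents and coefficients in `𝔽_q` (`intSubring`).

*The endomorphism `φ_q`.* On `Λ` one has `φ_q(T_i) = T_i ^ q + p y_i` with `y_i ∈ 𝔭`
(`exists_iwasawaMul_T_eq`). Hence `φ_q(T_i)` becomes invertible once `p` is nilpotent. If `p` is
given the weight `q - 1`, then `φ_q` multiplies degrees by at least `q` (`slopeSub`), which gives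
the continuity needed for extending `φ_q` to `B / p ^ n` (`exists_locMul`) and to `A_mv`
(`Amv.exists_isPhiQ`). Density of the localization gives uniqueness (`Amv.isPhiQ_unique`), and the
extension lifts the `q`-power map of `A_mv / p` (`Amv.exists_phi_eq`).

*The map `ι`.* On `W(A_∞)` the map `φ_q` is bijective. The condition `ι ∘ φ_q = φ_q ∘ ι` says
that `ι` is fixed by `g ↦ (x ↦ φ_q⁻¹ (g x ^ q + p g (δ x)))`, where `φ_q x = x ^ q + p δ x`. This
operation is `p`-adically contracting on the lifts to `W(A_∞)` of the reduction `A_mv → A_∞`, and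
its fixed point is the unique equivariant lift
(`exists_equivariant_lift`, `eq_of_equivariant`).

*Faithful flatness.* The ring `A_{mv,E₀}` is Noetherian, being finite over `A_mv`, which is
complete with Noetherian quotient modulo `p` (`IsPowComplete.isNoetherianRing`). Since `W(A_∞)` is
`p`-adically complete and torsion free, flatness may be tested on linear relations modulo `p`
(`IsPowComplete.flat_of_relations`). There `ι` becomes the inclusion in `A_∞` of the subring of
series with integral exponents and coefficients in the residue field of `E`. Sorting the exponents
by their classes modulo integral ones shows that linear relations over this subring are trivial
(`trivial_relation`; first up to the topologically nilpotent `T_0`, by the same completeness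
criterion). The class of `0` yields a linear retraction `proj` of the inclusion, so no maximal
ideal, all of which contain `p`, generates the unit ideal of `W(A_∞)`
(`faithfullyFlat_canonicalMap`). Faithful flatness is stable under extension of scalars to `O_E`
(`faithfullyFlat_tensorMap`) and implies injectivity.
-/

set_option linter.unusedSectionVars false

noncomputable section
namespace MvIwasawa

/-! ### Complete modules: Noetherianity and flatness -/

section Complete

/-- The module `M` is separated and complete for the `t`-adic topology, stated in terms of
series `∑ t ^ n • m n`. -/
structure IsPowComplete {R : Type*} [CommRing R] (t : R) (M : Type*) [AddCommGroup M]
    [Module R M] : Prop where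
  haus : ∀ x : M, (∀ n : ℕ, ∃ z : M, x = t ^ n • z) → x = 0
  prec : ∀ m : ℕ → M, ∃ s : M, ∀ n : ℕ, ∃ z : M,
    s = ∑ k ∈ Finset.range n, t ^ k • m k + t ^ n • z

theorem isPowComplete_of_isAdicComplete {R : Type*} [CommRing R] (t : R) (M : Type*)
    [AddCommGroup M] [Module R M] [h : IsAdicComplete (Ideal.span {t}) M] :
    IsPowComplete t M := by
  have key : ∀ (n : ℕ) (x : M), x ∈ (Ideal.span {t} ^ n • ⊤ : Submodule R M) ↔
      ∃ z, x = t ^ n • z := by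
    intro n x
    rw [Ideal.span_singleton_pow, Submodule.ideal_span_singleton_smul,
      Submodule.mem_smul_pointwise_iff_exists]
    simp only [eq_comm, Submodule.mem_top, true_and]
  refine ⟨fun x hx => ?_, fun m => ?_⟩
  · refine IsHausdorff.haus h.toIsHausdorff x fun n => ?_
    rw [SModEq.zero, key]
    exact hx n
  · obtain ⟨s, hs⟩ := IsPrecomplete.prec h.toIsPrecomplete
      (f := fun n => ∑ k ∈ Finset.range n, t ^ k • m k) (fun {a b} hab => by
        rw [SModEq.sub_mem, ← neg_mem_iff, neg_sub, ← Finset.sum_Ico_eq_sub _ hab]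
        refine Submodule.sum_mem _ fun k hk => ?_
        rw [key]
        refine ⟨t ^ (k - a) • m k, ?_⟩
        rw [smul_smul, ← pow_add, Nat.add_sub_cancel' (Finset.mem_Ico.1 hk).1])
    refine ⟨s, fun n => ?_⟩
    have h1 := hs n
    rw [SModEq.sub_mem, ← neg_mem_iff, neg_sub, key] at h1
    obtain ⟨z, hz⟩ := h1
    exact ⟨z, by rw [← hz]; abel⟩

variable {R : Type*} [CommRing R] {t : R}

/-- A ring which is complete for the `t`-adic topology is Noetherian when its quotient by `t`
is: every prime ideal is finitely generated. -/
theorem IsPowComplete.isNoetherianRing (hc : IsPowComplete t R)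
    [hN : IsNoetherianRing (R ⧸ Ideal.span {t})] : IsNoetherianRing R := by
  classical
  refine IsNoetherianRing.of_prime fun P hP => ?_
  set π := Ideal.Quotient.mk (Ideal.span {t})
  have hfg : (P.map π).FG := hN.noetherian _
  obtain ⟨s, hsP, hs⟩ := Submodule.fg_span_iff_fg_span_finset_subset (R := R ⧸ Ideal.span {t})
    (π '' (P : Set R)) |>.1 hfg
  -- finitely many elements `g i` of `P` generate `P` modulo `t`
  have hg : ∀ x : s, ∃ y ∈ P, π y = x := fun x => hsP x.2
  choose g hgP hgx using hg
  have step : ∀ x ∈ P, ∃ (a : s → R) (z : R), x = ∑ i, a i * g i + t * z := by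
    intro x hx
    have h1 : π x ∈ Submodule.span (R ⧸ Ideal.span {t}) (s : Set (R ⧸ Ideal.span {t})) := by
      rw [← hs]
      exact Ideal.mem_map_of_mem π hx
    rw [Submodule.mem_span_finset'] at h1
    obtain ⟨c, hc⟩ := h1
    choose a ha using fun i => Ideal.Quotient.mk_surjective (c i)
    refine ⟨a, ?_⟩
    have h2 : π (x - ∑ i, a i * g i) = 0 := by
      rw [map_sub, map_sum, ← hc, sub_eq_zero]
      exact Finset.sum_congr rfl fun i _ => by rw [map_mul, hgx, ← ha i]; rfl
    rw [Ideal.Quotient.eq_zero_iff_mem, Ideal.mem_span_singleton] at h2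
    obtain ⟨z, hz⟩ := h2
    exact ⟨z, by rw [← hz]; ring⟩
  by_cases ht : t ∈ P
  · refine ⟨insert t (Finset.univ.image g), le_antisymm ?_ fun x hx => ?_⟩
    · rw [Submodule.span_le]
      intro x hx
      simp only [Finset.coe_insert, Finset.coe_image, Finset.coe_univ, Set.image_univ] at hx
      rcases hx with rfl | ⟨i, rfl⟩
      · exact ht
      · exact hgP i
    · obtain ⟨a, z, rfl⟩ := step x hx
      refine add_mem (sum_mem fun i _ => ?_) ?_
      · exact Submodule.smul_mem _ (a i) (Submodule.subset_span (by simp))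
      · rw [mul_comm]
        exact Submodule.smul_mem _ z (Submodule.subset_span (by simp))
  · refine ⟨Finset.univ.image g, le_antisymm ?_ fun x hx => ?_⟩
    · rw [Submodule.span_le]
      intro x hx
      simp only [Finset.coe_image, Finset.coe_univ, Set.image_univ] at hx
      obtain ⟨i, rfl⟩ := hx
      exact hgP i
    · have step' : ∀ x : P, ∃ (a : s → R) (z : P), (x : R) = ∑ i, a i * g i + t * z := by
        intro x
        obtain ⟨a, z, h⟩ := step x x.2
        have : t * z ∈ P := by
          rw [show t * z = x - ∑ i, a i * g i by rw [h]; ring]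
          exact sub_mem x.2 (sum_mem fun i _ => P.mul_mem_left _ (hgP i))
        exact ⟨a, ⟨z, (hP.mem_or_mem this).resolve_left ht⟩, h⟩
      choose a z haz using step'
      let y : ℕ → P := fun n => z^[n] ⟨x, hx⟩
      have hy : ∀ n, x = ∑ i, (∑ k ∈ Finset.range n, t ^ k * a (y k) i) * g i + t ^ n * y n := by
        intro n
        induction n with
        | zero => simp [y]
        | succ n ih =>
          have h1 : y (n + 1) = z (y n) := Function.iterate_succ_apply' _ _ _
          rw [ih, haz (y n), h1]
          simp only [Finset.sum_range_succ, add_mul, Finset.sum_add_distrib, mul_add, pow_succ,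
            Finset.mul_sum]
          rw [add_assoc]
          congr 1
          congr 1
          · exact Finset.sum_congr rfl fun i _ => by ring
          · ring
      choose b hb using fun i => hc.prec fun k => a (y k) i
      have : x = ∑ i, b i * g i := by
        rw [← sub_eq_zero]
        refine hc.haus _ fun n => ?_
        choose w hw using fun i => hb i n
        refine ⟨(y n : R) - ∑ i, w i * g i, ?_⟩
        have h3 : ∑ i, b i * g i = ∑ i, (∑ k ∈ Finset.range n, t ^ k * a (y k) i) * g i +
            t ^ n * ∑ i, w i * g i := by
          rw [Finset.mul_sum, ← Finset.sum_add_distrib]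
          refine Finset.sum_congr rfl fun i _ => ?_
          rw [hw i]
          simp only [smul_eq_mul]
          ring
        rw [h3, smul_eq_mul]
        nth_rw 1 [hy n]
        ring
      rw [this]
      exact sum_mem fun i _ => Submodule.smul_mem _ (b i) (Submodule.subset_span (by simp))

variable {M : Type*} [AddCommGroup M] [Module R M]

/-- Relations in `M` which hold modulo `t ^ n` come from relations in `R` modulo `t ^ n`,
provided that this is so for `n = 1` and `t` acts injectively on `M`. -/
theorem relation_pow (htor : ∀ x : M, t • x = 0 → x = 0)
    (h1 : ∀ (l : ℕ) (g : Fin l → R) (y : Fin l → M) (z : M), ∑ i, g i • y i = t • z →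
      ∃ (k : ℕ) (a : Fin l → Fin k → R) (w : Fin k → M), (∀ i, y i = ∑ j, a i j • w j) ∧
        ∀ j, ∃ c, ∑ i, g i * a i j = t * c) (n : ℕ) :
    ∀ (l : ℕ) (g : Fin l → R) (y : Fin l → M) (z : M), ∑ i, g i • y i = t ^ n • z →
      ∃ (k : ℕ) (a : Fin l → Fin k → R) (w : Fin k → M), (∀ i, y i = ∑ j, a i j • w j) ∧
        ∀ j, ∃ c, ∑ i, g i * a i j = t ^ n * c := by
  induction n with
  | zero =>
    intro l g y z _
    refine ⟨l, fun i j => if i = j then 1 else 0, y, fun i => by simp, fun j => ⟨g j, by simp⟩⟩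
  | succ n ih =>
    intro l g y z hz
    rw [pow_succ', mul_smul] at hz
    obtain ⟨k, a, w, hy, hc⟩ := h1 l g y _ hz
    choose c hc using hc
    have h2 : ∑ j, c j • w j = t ^ n • z := by
      rw [← sub_eq_zero]
      refine htor _ ?_
      rw [smul_sub, ← hz, Finset.smul_sum, sub_eq_zero]
      simp_rw [smul_smul, ← hc, Finset.sum_smul, hy, Finset.smul_sum, smul_smul]
      exact Finset.sum_comm
    obtain ⟨k', b, v, hw, hd⟩ := ih k c w z h2
    choose d hd using hd
    refine ⟨k', fun i m => ∑ j, a i j * b j m, v, fun i => ?_, fun m => ⟨d m, ?_⟩⟩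
    · simp_rw [hy, hw, Finset.smul_sum, Finset.sum_smul, smul_smul]
      exact Finset.sum_comm
    · rw [pow_succ', mul_assoc, ← hd, Finset.mul_sum]
      simp_rw [← mul_assoc, ← hc, Finset.sum_mul, Finset.mul_sum]
      rw [Finset.sum_comm]
      exact Finset.sum_congr rfl fun _ _ => Finset.sum_congr rfl fun _ _ => by ring

/-- Flatness can be checked modulo `t` for a `t`-torsion free, `t`-adically complete module over
a Noetherian ring. -/
theorem IsPowComplete.flat [IsNoetherianRing R] (hM : IsPowComplete t M)
    (htor : ∀ x : M, t • x = 0 → x = 0)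
    (h1 : ∀ (l : ℕ) (g : Fin l → R) (y : Fin l → M) (z : M), ∑ i, g i • y i = t • z →
      ∃ (k : ℕ) (a : Fin l → Fin k → R) (w : Fin k → M), (∀ i, y i = ∑ j, a i j • w j) ∧
        ∀ j, ∃ c, ∑ i, g i * a i j = t * c) :
    Module.Flat R M := by
  refine Module.Flat.of_forall_isTrivialRelation fun {l g x} hx => ?_
  -- the ideals `{v | t ^ n v ∈ (g)}` become stationary
  let V : ℕ →o Ideal R :=
    { toFun := fun n => Submodule.comap (LinearMap.lsmul R R (t ^ n)) (Ideal.span (Set.range g))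
      monotone' := monotone_nat_of_le_succ fun n v hv => by
        rw [Submodule.mem_comap] at hv ⊢
        have := Ideal.mul_mem_left _ t hv
        simpa [pow_succ', mul_assoc] using this }
  obtain ⟨N, hN⟩ := monotone_stabilizes_iff_noetherian.2 ‹IsNoetherianRing R› V
  have hV : ∀ c, (∃ u : Fin l → R, ∑ i, g i * u i = t ^ (N + 1) * c) →
      ∃ u : Fin l → R, ∑ i, g i * u i = t ^ N * c := by
    rintro c ⟨u, hu⟩
    have h2 : c ∈ V (N + 1) := by
      change t ^ (N + 1) * c ∈ Ideal.span (Set.range g)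
      rw [← hu]
      exact sum_mem fun i _ => Ideal.mul_mem_right _ _ (Ideal.subset_span ⟨i, rfl⟩)
    rw [← hN (N + 1) (Nat.le_succ N)] at h2
    change t ^ N * c ∈ Ideal.span (Set.range g) at h2
    rw [Ideal.mem_span_range_iff_exists_fun] at h2
    obtain ⟨u', hu'⟩ := h2
    exact ⟨u', by rw [← hu']; exact Finset.sum_congr rfl fun _ _ => mul_comm _ _⟩
  let Z : Submodule R (Fin l → R) := LinearMap.ker (Fintype.linearCombination R g)
  have hZ : ∀ u, u ∈ Z ↔ ∑ i, g i * u i = 0 := by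
    intro u
    simp only [Z, LinearMap.mem_ker, Fintype.linearCombination_apply, smul_eq_mul, mul_comm]
  obtain ⟨K, ρ, hρ⟩ := Submodule.fg_iff_exists_fin_generating_family.1 (IsNoetherian.noetherian Z)
  have step : ∀ y : {y : Fin l → M // ∑ i, g i • y i = 0},
      ∃ (w : Fin K → M) (y' : {y : Fin l → M // ∑ i, g i • y i = 0}),
        ∀ i, y.1 i = ∑ m, ρ m i • w m + t • y'.1 i := by
    rintro ⟨y, hy⟩
    obtain ⟨k, a, w, hyw, hc⟩ := relation_pow htor h1 (N + 1) l g y 0 (by rw [hy, smul_zero])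
    choose c hc using hc
    choose u hu using fun j => hV (c j) ⟨fun i => a i j, hc j⟩
    have hr : ∀ j, (fun i => a i j - t * u j i) ∈ Z := by
      intro j
      rw [hZ]
      simp_rw [mul_sub, Finset.sum_sub_distrib, hc, pow_succ', mul_assoc, ← hu, Finset.mul_sum]
      rw [sub_eq_zero]
      exact Finset.sum_congr rfl fun _ _ => by ring
    have hr' : ∀ j, ∃ b : Fin K → R, ∀ i, a i j = ∑ m, b m * ρ m i + t * u j i := by
      intro j
      have h3 := hr j
      rw [← hρ, Submodule.mem_span_range_iff_exists_fun] at h3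
      obtain ⟨b, hb⟩ := h3
      refine ⟨b, fun i => ?_⟩
      have := congrFun hb i
      simp only [Finset.sum_apply, Pi.smul_apply, smul_eq_mul] at this
      rw [this]
      ring
    choose b hb using hr'
    have hdec : ∀ i, y i = ∑ m, ρ m i • (∑ j, b j m • w j) + t • ∑ j, u j i • w j := by
      intro i
      rw [hyw i]
      simp_rw [hb, add_smul, Finset.sum_add_distrib, Finset.sum_smul, Finset.smul_sum, smul_smul]
      congr 1
      rw [Finset.sum_comm]
      exact Finset.sum_congr rfl fun _ _ => Finset.sum_congr rfl fun _ _ => by rw [mul_comm]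
    refine ⟨fun m => ∑ j, b j m • w j, ⟨fun i => ∑ j, u j i • w j, htor _ ?_⟩, hdec⟩
    have h4 : ∑ i, g i • ∑ m, ρ m i • (∑ j, b j m • w j) = 0 := by
      simp_rw [Finset.smul_sum (s := (Finset.univ : Finset (Fin K))), smul_smul]
      rw [Finset.sum_comm]
      simp_rw [← Finset.sum_smul]
      refine Finset.sum_eq_zero fun m _ => ?_
      have : ρ m ∈ Z := by rw [← hρ]; exact Submodule.subset_span ⟨m, rfl⟩
      rw [(hZ _).1 this, zero_smul]
    have h5 := hy
    simp_rw [hdec, smul_add, Finset.sum_add_distrib] at h5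
    rw [h4, zero_add] at h5
    rw [Finset.smul_sum, ← h5]
    exact Finset.sum_congr rfl fun _ _ => smul_comm _ _ _
  choose w y' hwy using step
  let y : ℕ → {y : Fin l → M // ∑ i, g i • y i = 0} := fun n => y'^[n] ⟨x, hx⟩
  have hy : ∀ n i, x i = ∑ m, ρ m i • (∑ k ∈ Finset.range n, t ^ k • w (y k) m) +
      t ^ n • (y n).1 i := by
    intro n i
    induction n with
    | zero => simp [y]
    | succ n ih =>
      have h6 : y (n + 1) = y' (y n) := Function.iterate_succ_apply' _ _ _
      rw [ih, hwy (y n) i, h6]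
      simp only [Finset.sum_range_succ, smul_add, Finset.sum_add_distrib, pow_succ, mul_smul,
        Finset.smul_sum]
      rw [add_assoc]
      congr 2
      exact Finset.sum_congr rfl fun m _ => smul_comm _ _ _
  choose s hs using fun m => hM.prec fun k => w (y k) m
  refine ⟨K, fun i m => ρ m i, s, fun i => ?_, fun m => ?_⟩
  · rw [← sub_eq_zero]
    refine hM.haus _ fun n => ?_
    choose v hv using fun m => hs m n
    refine ⟨(y n).1 i - ∑ m, ρ m i • v m, ?_⟩
    have h7 : ∑ m, ρ m i • s m = ∑ m, ρ m i • (∑ k ∈ Finset.range n, t ^ k • w (y k) m) +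
        t ^ n • ∑ m, ρ m i • v m := by
      rw [Finset.smul_sum, ← Finset.sum_add_distrib]
      refine Finset.sum_congr rfl fun m _ => ?_
      rw [hv m, smul_add, smul_comm (t ^ n)]
    rw [h7, smul_sub]
    nth_rw 1 [hy n i]
    abel
  · have : ρ m ∈ Z := by rw [← hρ]; exact Submodule.subset_span ⟨m, rfl⟩
    exact (hZ _).1 this

end Complete
end MvIwasawa
end

noncomputable section
namespace MvIwasawa

/-! ### Lifting homomorphisms along a lift of the `q`-power map -/

section FrobeniusLift

theorem pow_dvd_pow_sub_pow {W : Type*} [CommRing W] (p : ℕ) {n f : ℕ} (hn : n ≠ 0) (hf : f ≠ 0)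
    {a b : W} (h : (p : W) ^ n ∣ a - b) : (p : W) ^ (n + 1) ∣ a ^ p ^ f - b ^ p ^ f := by
  obtain ⟨f, rfl⟩ := Nat.exists_eq_succ_of_ne_zero hf
  have h1 : (p : W) ∣ ∑ i ∈ Finset.range p, a ^ i * b ^ (p - 1 - i) := by
    have h2 : (p : W) ∣ a - b := (dvd_pow_self _ hn).trans h
    rw [← Ideal.mem_span_singleton, ← Ideal.Quotient.eq_zero_iff_mem] at h2 ⊢
    rw [map_sub, sub_eq_zero] at h2
    simp only [map_sum, map_mul, map_pow, h2, ← pow_add]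
    rw [Finset.sum_congr rfl fun i hi => by
      rw [show i + (p - 1 - i) = p - 1 by have := Finset.mem_range.1 hi; omega]]
    rw [Finset.sum_const, Finset.card_range, nsmul_eq_mul, ← map_natCast (Ideal.Quotient.mk _),
      Ideal.Quotient.eq_zero_iff_mem.2 (Ideal.mem_span_singleton_self _), zero_mul]
  have h3 : (p : W) ^ (n + 1) ∣ a ^ p - b ^ p := by
    rw [← geom_sum₂_mul, pow_succ']
    exact mul_dvd_mul h1 h
  rw [pow_succ' p f, pow_mul, pow_mul]
  exact h3.trans (sub_dvd_pow_sub_pow _ _ _)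

variable {A W S : Type*} [CommRing A] [CommRing W] [CommRing S] {p : ℕ} {f : ℕ}
  {φ : A →+* A} {Φ : W ≃+* W}

/-- Two ring homomorphisms into a `p`-adically separated ring which are equivariant for a lift `φ`
of the `q`-power map and an automorphism `Φ` are equal as soon as they agree modulo `p`. -/
theorem eq_of_equivariant (hf : f ≠ 0) (hW : IsPowComplete (p : W) W)
    (hφ : ∀ x, ∃ y, φ x = x ^ p ^ f + p * y) {g g' : A →+* W}
    (hg : ∀ x, g (φ x) = Φ (g x)) (hg' : ∀ x, g' (φ x) = Φ (g' x))
    (h : ∀ x, (p : W) ∣ g x - g' x) : g = g' := by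
  have key : ∀ n x, (p : W) ^ (n + 1) ∣ g x - g' x := by
    intro n
    induction n with
    | zero => simpa using h
    | succ n ih =>
      intro x
      obtain ⟨y, hy⟩ := hφ x
      have h1 : Φ (g x - g' x) = (g x ^ p ^ f - g' x ^ p ^ f) + p * (g y - g' y) := by
        rw [map_sub, ← hg, ← hg', hy]
        simp only [map_add, map_pow, map_mul, map_natCast]
        ring
      have h2 : (p : W) ^ (n + 1 + 1) ∣ Φ (g x - g' x) := by
        rw [h1]
        refine dvd_add (pow_dvd_pow_sub_pow p n.succ_ne_zero hf (ih x)) ?_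
        rw [pow_succ' _ (n + 1)]
        exact mul_dvd_mul_left _ (ih y)
      simpa using map_dvd Φ.symm h2
  ext x
  rw [← sub_eq_zero]
  refine hW.haus _ fun n => ?_
  obtain ⟨z, hz⟩ := key n x
  exact ⟨p * z, by rw [hz, smul_eq_mul]; ring⟩

/-- Let `φ` lift the `q`-power map of `A / p`, where `A` is `p`-torsion free. A ring homomorphism
`A → W / p = S` which is equivariant lifts to an equivariant ring homomorphism `A → W`: this is
the limit of the maps `x ↦ Φ⁻¹ (g x ^ q + p * g ((φ x - x ^ q) / p))`. -/
theorem exists_equivariant_lift [Fact p.Prime] (hf : f ≠ 0) (hW : IsPowComplete (p : W) W)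
    (hφ : ∀ x, ∃ y, φ x = x ^ p ^ f + p * y) (hA : ∀ x : A, (p : A) * x = 0 → x = 0)
    (π : W →+* S) (hπ : Function.Surjective π) (hker : ∀ x, π x = 0 ↔ (p : W) ∣ x)
    (r : A →+* S) (hr : ∀ x w, π w = r x → π (Φ w) = r (φ x)) :
    ∃ g : A →+* W, (∀ x, π (g x) = r x) ∧ ∀ x, g (φ x) = Φ (g x) := by
  have hp : p.Prime := Fact.out
  choose δ hδ using hφ
  have hpS : (p : S) = 0 := by rw [← map_natCast π, hker]
  let G : ℕ → A → W := fun n => Nat.rec (fun x => (hπ (r x)).choose)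
    (fun _ g x => Φ.symm (g x ^ p ^ f + p * g (δ x))) n
  have hG : ∀ n x, Φ (G (n + 1) x) = G n x ^ p ^ f + p * G n (δ x) := fun n x =>
    Φ.apply_symm_apply _
  have hGr : ∀ n x, π (G n x) = r x := by
    intro n
    induction n with
    | zero => exact fun x => (hπ (r x)).choose_spec
    | succ n ih =>
      intro x
      obtain ⟨v, hv⟩ := hπ (r x)
      have h1 : π (Φ v - Φ (G (n + 1) x)) = 0 := by
        rw [map_sub, hr x v hv, hG, hδ]
        simp [ih, hpS]
      rw [← map_sub, hker] at h1
      have h2 : (p : W) ∣ v - G (n + 1) x := by simpa using map_dvd Φ.symm h1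
      rw [← hker, map_sub, sub_eq_zero, hv] at h2
      exact h2.symm
  have hGd : ∀ n x, (p : W) ^ (n + 1) ∣ G (n + 1) x - G n x := by
    intro n
    induction n with
    | zero =>
      intro x
      rw [zero_add, pow_one, ← hker, map_sub, hGr, hGr, sub_self]
    | succ n ih =>
      intro x
      have h2 : (p : W) ^ (n + 1 + 1) ∣ Φ (G (n + 1 + 1) x - G (n + 1) x) := by
        rw [map_sub, hG (n + 1), hG n, show ∀ a b c d : W, a + p * b - (c + p * d) =
          (a - c) + p * (b - d) by intros; ring]
        refine dvd_add (pow_dvd_pow_sub_pow p n.succ_ne_zero hf (ih x)) ?_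
        rw [pow_succ' _ (n + 1)]
        exact mul_dvd_mul_left _ (ih _)
      simpa using map_dvd Φ.symm h2
  have hlim : ∀ x, ∃ l, ∀ n, (p : W) ^ n ∣ l - G n x := by
    intro x
    choose d hd using fun n => hGd n x
    obtain ⟨s, hs⟩ := hW.prec fun n => p * d n
    refine ⟨G 0 x + s, fun n => ?_⟩
    have h1 : ∀ n, G n x = G 0 x + ∑ k ∈ Finset.range n, (p : W) ^ k • (p * d k) := by
      intro n
      induction n with
      | zero => simp
      | succ n ih =>
        rw [Finset.sum_range_succ, ← add_assoc, ← ih, ← sub_eq_iff_eq_add', hd, smul_eq_mul]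
        ring
    obtain ⟨z, hz⟩ := hs n
    exact ⟨z, by rw [h1 n, hz, smul_eq_mul]; ring⟩
  choose g hg using hlim
  have hcl : ∀ a : W, (∀ n, (p : W) ^ n ∣ a) → a = 0 := fun a ha => hW.haus a fun n => by
    obtain ⟨z, hz⟩ := ha n
    exact ⟨z, hz⟩
  have hgΦ : ∀ x, Φ (g x) = g x ^ p ^ f + p * g (δ x) := by
    intro x
    rw [← sub_eq_zero]
    refine hcl _ fun n => ?_
    have h1 : (p : W) ^ n ∣ Φ (g x - G (n + 1) x) := by
      have := map_dvd Φ (((pow_dvd_pow (p : W) n.le_succ).trans (hg x (n + 1))))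
      simpa using this
    have h2 : (p : W) ^ n ∣ g x ^ p ^ f - G n x ^ p ^ f :=
      (hg x n).trans (sub_dvd_pow_sub_pow _ _ _)
    have h3 := (hg (δ x) n).mul_left (p : W)
    rw [map_sub, hG] at h1
    have h4 := dvd_sub h1 (dvd_add h2 h3)
    convert h4 using 1
    ring
  have hgr : ∀ x, π (g x) = r x := by
    intro x
    have := hg x 1
    rw [pow_one, ← hker, map_sub, hGr, sub_eq_zero] at this
    exact this
  -- `g` is a ring homomorphism modulo `p ^ n` for all `n`
  have hδadd : ∀ x y, δ (x + y) = δ x + δ y - x * y * ∑ k ∈ Finset.Ioo 0 (p ^ f),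
      x ^ (k - 1) * y ^ (p ^ f - k - 1) * ↑((p ^ f).choose k / p) := by
    intro x y
    rw [← sub_eq_zero]
    refine hA _ ?_
    have h1 := hδ (x + y)
    rw [map_add, hδ x, hδ y, add_pow_prime_pow_eq hp] at h1
    linear_combination -h1
  have hδmul : ∀ x y, δ (x * y) = x ^ p ^ f * δ y + y ^ p ^ f * δ x + p * (δ x * δ y) := by
    intro x y
    rw [← sub_eq_zero]
    refine hA _ ?_
    have h1 := hδ (x * y)
    rw [map_mul, hδ x, hδ y] at h1
    linear_combination -h1
  have hδ1 : δ 1 = 0 := by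
    refine hA _ ?_
    have h1 := hδ 1
    rw [map_one, one_pow] at h1
    linear_combination -h1
  have hΦd : ∀ (n : ℕ) (a : W), (p : W) ^ n ∣ Φ a → (p : W) ^ n ∣ a := fun n a h => by
    simpa using map_dvd Φ.symm h
  have key : ∀ n : ℕ, (∀ x y, (p : W) ^ (n + 1) ∣ g (x + y) - (g x + g y)) ∧
      (∀ x y, (p : W) ^ (n + 1) ∣ g (x * y) - g x * g y) ∧ (p : W) ^ (n + 1) ∣ g 1 - 1 := by
    intro n
    induction n with
    | zero => simp [← hker, hgr]
    | succ n ih =>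
      obtain ⟨iha, ihm, ih1⟩ := ih
      let mk := Ideal.Quotient.mk (Ideal.span {(p : W) ^ (n + 1)})
      have hmk : ∀ a b : W, mk a = mk b ↔ (p : W) ^ (n + 1) ∣ a - b := fun a b => by
        rw [Ideal.Quotient.eq, Ideal.mem_span_singleton]
      have ih0 : mk (g 0) = 0 := by
        have := iha 0 0
        rw [← hmk, map_add, add_zero] at this
        simpa using this
      let g' : A →+* W ⧸ Ideal.span {(p : W) ^ (n + 1)} :=
        { toFun := fun x => mk (g x)
          map_one' := by rw [(hmk _ _).2 ih1, map_one]
          map_mul' := fun x y => by rw [(hmk _ _).2 (ihm x y), map_mul]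
          map_zero' := ih0
          map_add' := fun x y => by rw [(hmk _ _).2 (iha x y), map_add] }
      have hg' : ∀ x, mk (g x) = g' x := fun _ => rfl
      refine ⟨fun x y => hΦd _ _ ?_, fun x y => hΦd _ _ ?_, hΦd _ _ ?_⟩
      · have h1 := pow_dvd_pow_sub_pow p n.succ_ne_zero hf (iha x y)
        rw [add_pow_prime_pow_eq hp] at h1
        have h2 : (p : W) ^ (n + 1) ∣ g (δ (x + y)) - (g (δ x) + g (δ y) -
            g x * g y * ∑ k ∈ Finset.Ioo 0 (p ^ f), g x ^ (k - 1) * g y ^ (p ^ f - k - 1) *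
              ↑((p ^ f).choose k / p)) := by
          rw [← hmk, hδadd]
          simp only [map_sub, map_add, map_sum, map_mul, map_pow, map_natCast, hg']
        have h3 := mul_dvd_mul_left (p : W) h2
        rw [← pow_succ' _ (n + 1)] at h3
        have h4 := dvd_add h1 h3
        rw [map_sub, map_add, hgΦ, hgΦ, hgΦ]
        convert h4 using 1
        ring
      · have h1 := pow_dvd_pow_sub_pow p n.succ_ne_zero hf (ihm x y)
        have h2 : (p : W) ^ (n + 1) ∣ g (δ (x * y)) - (g x ^ p ^ f * g (δ y) +
            g y ^ p ^ f * g (δ x) + p * (g (δ x) * g (δ y))) := by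
          rw [← hmk, hδmul]
          simp only [map_add, map_mul, map_pow, map_natCast, hg']
        have h3 := mul_dvd_mul_left (p : W) h2
        rw [← pow_succ' _ (n + 1)] at h3
        have h4 := dvd_add h1 h3
        rw [map_sub, map_mul, hgΦ, hgΦ, hgΦ]
        convert h4 using 1
        ring
      · have h1 := pow_dvd_pow_sub_pow p n.succ_ne_zero hf ih1
        have h2 : (p : W) ^ (n + 1) ∣ g (δ 1) := by
          rw [hδ1]
          have := (hmk (g 0) 0).1 (by rw [ih0, map_zero])
          rwa [sub_zero] at this
        have h3 := mul_dvd_mul_left (p : W) h2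
        rw [← pow_succ' _ (n + 1)] at h3
        have h4 := dvd_add h1 h3
        rw [map_sub, map_one, hgΦ]
        convert h4 using 1
        ring
  have hcl' : ∀ a : W, (∀ n : ℕ, (p : W) ^ (n + 1) ∣ a) → a = 0 := fun a ha =>
    hcl a fun n => (pow_dvd_pow _ n.le_succ).trans (ha n)
  have hadd : ∀ x y, g (x + y) = g x + g y := fun x y =>
    sub_eq_zero.1 (hcl' _ fun n => (key n).1 x y)
  have hmul : ∀ x y, g (x * y) = g x * g y := fun x y =>
    sub_eq_zero.1 (hcl' _ fun n => (key n).2.1 x y)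
  have hone : g 1 = 1 := sub_eq_zero.1 (hcl' _ fun n => (key n).2.2)
  let g'' : A →+* W :=
    { toFun := g
      map_one' := hone
      map_mul' := hmul
      map_zero' := by simpa using hadd 0 0
      map_add' := hadd }
  refine ⟨g'', hgr, fun x => ?_⟩
  change g'' (φ x) = Φ (g x)
  rw [hδ, hgΦ, map_add, map_mul, map_pow, map_natCast]
  rfl

end FrobeniusLift

/-! ### Expansions along finitely many elements -/

section Expansion

variable {A R σ : Type*} [CommRing A] [CommRing R] [Algebra A R] {t : σ → R}

/-- If `R = A + (t)`, then `R` is the sum of `A[t]` and any power of the ideal `(t)`. -/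
theorem exists_mem_adjoin_sub_mem_pow
    (h : ∀ x : R, ∃ a : A, x - algebraMap A R a ∈ Ideal.span (Set.range t)) (m : ℕ) (x : R) :
    ∃ y ∈ Algebra.adjoin A (Set.range t), x - y ∈ Ideal.span (Set.range t) ^ m := by
  induction m generalizing x with
  | zero => exact ⟨0, zero_mem _, by simp⟩
  | succ m ih =>
    obtain ⟨a, ha⟩ := h x
    have key : ∀ z ∈ Ideal.span (Set.range t), ∃ y ∈ Algebra.adjoin A (Set.range t),
        z - y ∈ Ideal.span (Set.range t) ^ (m + 1) := by
      intro z hz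
      induction hz using Submodule.span_induction with
      | mem z hz => exact ⟨z, Algebra.subset_adjoin hz, by simp⟩
      | zero => exact ⟨0, zero_mem _, by simp⟩
      | add z z' _ _ h1 h2 =>
        obtain ⟨y, hy, h1⟩ := h1
        obtain ⟨y', hy', h2⟩ := h2
        exact ⟨y + y', add_mem hy hy', by rw [add_sub_add_comm]; exact add_mem h1 h2⟩
      | smul b z hzt h1 =>
        obtain ⟨y, hy, h1⟩ := h1
        obtain ⟨y', hy', h2⟩ := ih b
        refine ⟨y' * y, mul_mem hy' hy, ?_⟩
        rw [smul_eq_mul, show b * z - y' * y = (b - y') * z + y' * (z - y) by ring]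
        refine add_mem ?_ (Ideal.mul_mem_left _ _ h1)
        rw [pow_succ]
        exact Ideal.mul_mem_mul h2 hzt
    obtain ⟨y, hy, h1⟩ := key _ ha
    exact ⟨algebraMap A R a + y, add_mem (Subalgebra.algebraMap_mem _ a) hy, by
      rwa [← sub_sub]⟩

/-- Evaluation of power series at elements `t` of a ring `R` which is separated and complete for
a sequence of ideals `J`, each containing a power of the ideal `(t)`. -/
theorem exists_powerSeries_eval [Finite σ] (t : σ → R) (J : ℕ → Ideal R)
    (haus : ∀ x, (∀ n, x ∈ J n) → x = 0)
    (prec : ∀ s : ℕ → R, (∀ n, s (n + 1) - s n ∈ J n) → ∃ l, ∀ n, l - s n ∈ J n)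
    (M : ℕ → ℕ) (hM : ∀ n, Ideal.span (Set.range t) ^ M n ≤ J n) :
    ∃ ψ : MvPowerSeries σ A →ₐ[A] R, ∀ c n m, M n ≤ m →
      ψ c - MvPolynomial.aeval t (MvPowerSeries.truncTotal m c) ∈ J n := by
  -- polynomials without terms of small degree have small values
  have hev : ∀ (n : ℕ) (P : MvPolynomial σ A), P ∈ MvPolynomial.idealOfVars σ A ^ M n →
      MvPolynomial.aeval t P ∈ J n := by
    intro n P hP
    refine hM n ?_
    have h1 := Ideal.mem_map_of_mem (MvPolynomial.aeval (R := A) t).toRingHom hP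
    rw [Ideal.map_pow, MvPolynomial.idealOfVars, Ideal.map_span, ← Set.range_comp] at h1
    have h2 : (MvPolynomial.aeval (R := A) t).toRingHom ∘ MvPolynomial.X = t := by
      ext x
      simp
    rw [h2] at h1
    exact h1
  have hle : ∀ (c : MvPowerSeries σ A) (n m m' : ℕ), M n ≤ m → M n ≤ m' →
      MvPolynomial.aeval t (MvPowerSeries.truncTotal m c) -
        MvPolynomial.aeval t (MvPowerSeries.truncTotal m' c) ∈ J n := by
    intro c n m m' hm hm'
    rw [← map_sub]
    exact hev n _ (MvPowerSeries.truncTotal_sub_truncTotal_mem_pow_idealOfVars hm hm' c)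
  let M' : ℕ → ℕ := fun n => ∑ k ∈ Finset.range (n + 1), M k
  have hM' : ∀ k n, k ≤ n → M k ≤ M' n := fun k n h =>
    Finset.single_le_sum (f := M) (fun _ _ => Nat.zero_le _) (Finset.mem_range.2 (by omega))
  have hex : ∀ c : MvPowerSeries σ A, ∃ l, ∀ n m, M n ≤ m →
      l - MvPolynomial.aeval t (MvPowerSeries.truncTotal m c) ∈ J n := by
    intro c
    obtain ⟨l, hl⟩ := prec (fun n => MvPolynomial.aeval t (MvPowerSeries.truncTotal (M' n) c))
      fun n => hle c n _ _ (hM' n (n + 1) n.le_succ) (hM' n n le_rfl)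
    refine ⟨l, fun n m hm => ?_⟩
    have := add_mem (hl n) (hle c n (M' n) m (hM' n n le_rfl) hm)
    rwa [sub_add_sub_cancel] at this
  choose ψ hψ using hex
  have huniq : ∀ c l, (∀ n, ∃ m ≥ M n,
      l - MvPolynomial.aeval t (MvPowerSeries.truncTotal m c) ∈ J n) → ψ c = l := by
    intro c l h
    rw [← sub_eq_zero]
    refine haus _ fun n => ?_
    obtain ⟨m, hm, h⟩ := h n
    have := sub_mem (hψ c n m hm) h
    rwa [sub_sub_sub_cancel_right] at this
  have hpol : ∀ (P : MvPolynomial σ A), ψ P = MvPolynomial.aeval t P := by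
    intro P
    refine huniq _ _ fun n => ⟨M n, le_rfl, ?_⟩
    rw [← map_sub]
    refine hev n _ ((MvPolynomial.mem_pow_idealOfVars_iff' ..).mpr fun x hx => ?_)
    rw [MvPolynomial.coeff_sub, MvPowerSeries.coeff_truncTotal _ hx, MvPolynomial.coeff_coe,
      sub_self]
  refine ⟨{ toFun := ψ, map_one' := ?_, map_mul' := ?_, map_zero' := ?_, map_add' := ?_,
            commutes' := ?_ }, hψ⟩
  · have := hpol 1
    simpa using this
  · intro c d
    refine huniq _ _ fun n => ⟨M n, le_rfl, ?_⟩
    have h1 := hψ c n _ le_rfl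
    have h2 := hψ d n _ le_rfl
    have h3 := hev n _
      (MvPowerSeries.truncTotal_mul_sub_mul_truncTotal_mem_pow_idealOfVars (n := M n) c d)
    rw [map_sub, map_mul (MvPolynomial.aeval t)] at h3
    have h4 := sub_mem (add_mem (Ideal.mul_mem_right (ψ d) _ h1) (Ideal.mul_mem_left _
      (MvPolynomial.aeval t (MvPowerSeries.truncTotal (M n) c)) h2)) h3
    convert h4 using 1
    ring
  · have := hpol 0
    simpa using this
  · intro c d
    refine huniq _ _ fun n => ⟨M n, le_rfl, ?_⟩
    rw [map_add, map_add, add_sub_add_comm]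
    exact add_mem (hψ c n _ le_rfl) (hψ d n _ le_rfl)
  · intro a
    have := hpol (MvPolynomial.C a)
    rw [MvPolynomial.aeval_C] at this
    rw [← this]
    simp [MvPowerSeries.algebraMap_apply]

end Expansion
end MvIwasawa
end

noncomputable section
namespace MvIwasawa

/-! ### Completions of filtered rings -/

namespace RingFiltration

open Filter Topology

variable {R : Type*} [CommRing R] (F : RingFiltration R)

/-- The closure of the `n`-th step of the filtration in the completion. -/
def hat (n : ℤ) : AddSubgroup F.Completion :=
  ((F.sub n).map F.of.toAddMonoidHom).topologicalClosure

theorem hasBasis_nhds_zero_space :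
    (𝓝 (0 : F.Space)).HasBasis (fun _ => True) fun n => (F.sub n : Set R) :=
  F.basis.hasBasis_nhds_zero

theorem hasBasis_hat : (𝓝 (0 : F.Completion)).HasBasis (fun _ : ℤ => True)
    fun n => (F.hat n : Set F.Completion) := by
  have h := F.hasBasis_nhds_zero_space.hasBasis_of_isDenseInducing
    (UniformSpace.Completion.isDenseInducing_coe (α := F.Space))
  rwa [UniformSpace.Completion.coe_zero] at h

theorem hat_mem_nhds (n : ℤ) : (F.hat n : Set F.Completion) ∈ 𝓝 (0 : F.Completion) :=
  F.hasBasis_hat.mem_of_mem trivial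

theorem isOpen_hat (n : ℤ) : IsOpen (F.hat n : Set F.Completion) :=
  AddSubgroup.isOpen_of_mem_nhds _ (F.hat_mem_nhds n)

theorem isClosed_hat (n : ℤ) : IsClosed (F.hat n : Set F.Completion) :=
  AddSubgroup.isClosed_topologicalClosure _

instance : NonarchimedeanAddGroup F.Completion where
  is_nonarchimedean U hU := by
    obtain ⟨n, -, hn⟩ := F.hasBasis_hat.mem_iff.1 hU
    exact ⟨⟨F.hat n, F.isOpen_hat n⟩, hn⟩

theorem hat_anti : Antitone F.hat := fun _ _ h =>
  AddSubgroup.topologicalClosure_mono (AddSubgroup.map_mono (F.anti h))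

theorem of_mem_hat {n : ℤ} {x : R} : F.of x ∈ F.hat n ↔ x ∈ F.sub n := by
  constructor
  · intro h
    let H : AddSubgroup F.Space := F.sub n
    have ho : IsOpen (H : Set F.Space) :=
      AddSubgroup.isOpen_of_mem_nhds H (g := 0) (F.hasBasis_nhds_zero_space.mem_of_mem trivial)
    have hc : IsClosed (H : Set F.Space) := AddSubgroup.isClosed_of_isOpen H ho
    have h1 := (UniformSpace.Completion.isDenseInducing_coe
      (α := F.Space)).isInducing.closure_eq_preimage_closure_image (H : Set F.Space)
    rw [hc.closure_eq] at h1
    have : x ∈ (H : Set F.Space) := by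
      rw [h1]
      exact h
    exact this
  · intro h
    exact AddSubgroup.le_topologicalClosure _ ⟨x, h, rfl⟩

theorem denseRange_of : DenseRange F.of :=
  UniformSpace.Completion.denseRange_coe (α := F.Space)

theorem exists_sub_of_mem_hat (x : F.Completion) (n : ℤ) : ∃ y : R, x - F.of y ∈ F.hat n := by
  have h : {z : F.Completion | x - z ∈ F.hat n} ∈ 𝓝 x := by
    have : Continuous fun z : F.Completion => x - z := continuous_const.sub continuous_id
    refine this.continuousAt.preimage_mem_nhds ?_
    rw [sub_self]
    exact F.hat_mem_nhds n
  obtain ⟨y, hy⟩ := F.denseRange_of.mem_nhds h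
  exact ⟨y, hy⟩

theorem eq_zero_of_forall_mem_hat {x : F.Completion} (h : ∀ n, x ∈ F.hat n) : x = 0 := by
  by_contra hx
  have : {(x : F.Completion)}ᶜ ∈ 𝓝 (0 : F.Completion) :=
    isOpen_compl_singleton.mem_nhds (fun h => hx (by simpa using h.symm))
  obtain ⟨n, -, hn⟩ := F.hasBasis_hat.mem_iff.1 this
  exact hn (h n) rfl

theorem exists_mem_hat (x : F.Completion) : ∃ n, x ∈ F.hat n := by
  obtain ⟨y, hy⟩ := F.exists_sub_of_mem_hat x 0
  obtain ⟨n, hn⟩ := F.exhaustive y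
  refine ⟨min n 0, ?_⟩
  rw [← sub_add_cancel x (F.of y)]
  exact add_mem (F.hat_anti (min_le_right _ _) hy)
    (F.hat_anti (min_le_left _ _) (F.of_mem_hat.2 hn))

theorem mul_mem_hat {m n : ℤ} {x y : F.Completion} (hx : x ∈ F.hat m) (hy : y ∈ F.hat n) :
    x * y ∈ F.hat (m + n) := by
  refine map_mem_closure₂ (f := fun a b : F.Completion => a * b) continuous_mul hx hy ?_
  rintro _ ⟨a, ha, rfl⟩ _ ⟨b, hb, rfl⟩
  exact ⟨a * b, F.mul_mem ha hb, map_mul F.of a b⟩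

theorem one_mem_hat : (1 : F.Completion) ∈ F.hat 0 := by
  rw [← map_one F.of]
  exact F.of_mem_hat.2 F.one_mem

/-- Series whose terms tend to zero converge in the completion. -/
theorem exists_series (c : ℤ) (x : ℕ → F.Completion) (hx : ∀ j : ℕ, x j ∈ F.hat (c + j)) :
    ∃ s, ∀ n : ℕ, s - ∑ j ∈ Finset.range n, x j ∈ F.hat (c + n) := by
  let u : ℕ → F.Completion := fun n => ∑ j ∈ Finset.range n, x j
  have hu : ∀ m n : ℕ, n ≤ m → u m - u n ∈ F.hat (c + n) := by
    intro m n hm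
    rw [← Finset.sum_Ico_eq_sub _ hm]
    refine sum_mem fun j hj => F.hat_anti ?_ (hx j)
    have := (Finset.mem_Ico.1 hj).1
    omega
  have h1 : Tendsto (fun n => u (n + 1) - u n) atTop (𝓝 0) := by
    rw [F.hasBasis_hat.tendsto_right_iff]
    intro i _
    filter_upwards [eventually_ge_atTop (i - c).toNat] with n hn
    exact F.hat_anti (by omega) (hu (n + 1) n n.le_succ)
  have h2 : CauchySeq u := NonarchimedeanAddGroup.cauchySeq_of_tendsto_sub_nhds_zero h1
  obtain ⟨s, hs⟩ := cauchySeq_tendsto_of_complete h2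
  refine ⟨s, fun n => ?_⟩
  refine (F.isClosed_hat (c + n)).mem_of_tendsto (hs.sub_const (u n)) ?_
  filter_upwards [eventually_ge_atTop n] with m hm
  exact hu m n hm

theorem exists_forall_mem_hat_of_continuous {S : Type*} [CommRing S] (G : RingFiltration S)
    (g : F.Completion →+ G.Completion) (hg : Continuous g) (n : ℤ) :
    ∃ m, ∀ x ∈ F.hat m, g x ∈ G.hat n := by
  have h := hg.tendsto 0
  rw [map_zero, F.hasBasis_hat.tendsto_iff G.hasBasis_hat] at h
  obtain ⟨m, -, hm⟩ := h n trivial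
  exact ⟨m, hm⟩

/-- A continuous additive map into a separated group which vanishes on `R` vanishes on the
completion of `R`. -/
theorem eq_of_eq_of {T : Type*} [TopologicalSpace T] [T2Space T] {g g' : F.Completion → T}
    (hg : Continuous g) (hg' : Continuous g') (h : ∀ x, g (F.of x) = g' (F.of x)) : g = g' :=
  F.denseRange_of.equalizer hg hg' (funext h)

/-- Extension by continuity of a ring homomorphism to the completion. -/
theorem exists_extension {T : Type*} [CommRing T] [TopologicalSpace T] [IsTopologicalRing T]
    [T2Space T] (hT : @CompleteSpace T (IsTopologicalAddGroup.rightUniformSpace T)) (f : R →+* T)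
    (hf : ∀ U ∈ 𝓝 (0 : T), ∃ n, ∀ x ∈ F.sub n, f x ∈ U) :
    ∃ g : F.Completion →+* T, Continuous g ∧ ∀ x, g (F.of x) = f x := by
  let : UniformSpace T := IsTopologicalAddGroup.rightUniformSpace T
  have : IsUniformAddGroup T := isUniformAddGroup_of_addCommGroup
  let f' : F.Space →+* T := f
  have hc : Continuous f' := by
    refine continuous_of_continuousAt_zero f'.toAddMonoidHom ?_
    change Tendsto f' (𝓝 0) (𝓝 (f' 0))
    rw [map_zero, F.hasBasis_nhds_zero_space.tendsto_left_iff]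
    intro U hU
    obtain ⟨n, hn⟩ := hf U hU
    exact ⟨n, trivial, hn⟩
  exact ⟨UniformSpace.Completion.extensionHom f' hc, UniformSpace.Completion.continuous_extension,
    fun x => UniformSpace.Completion.extensionHom_coe f' hc x⟩

theorem completeSpace_right : @CompleteSpace F.Completion
    (IsTopologicalAddGroup.rightUniformSpace F.Completion) := by
  rw [IsUniformAddGroup.rightUniformSpace_eq]
  infer_instance

theorem exists_extension_completion {S : Type*} [CommRing S] (G : RingFiltration S)
    (f : R →+* S) (hf : ∀ n, ∃ m, ∀ x ∈ F.sub m, f x ∈ G.sub n) :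
    ∃ g : F.Completion →+* G.Completion, Continuous g ∧ ∀ x, g (F.of x) = G.of (f x) := by
  refine F.exists_extension G.completeSpace_right (G.of.comp f) fun U hU => ?_
  obtain ⟨n, -, hn⟩ := G.hasBasis_hat.mem_iff.1 hU
  obtain ⟨m, hm⟩ := hf n
  exact ⟨m, fun x hx => hn (G.of_mem_hat.2 (hm x hx))⟩

instance : FirstCountableTopology F.Completion := by
  have h : (𝓝 (0 : F.Completion)).IsCountablyGenerated := F.hasBasis_hat.isCountablyGenerated
  have : (uniformity F.Completion).IsCountablyGenerated :=
    IsUniformAddGroup.uniformity_countably_generated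
  exact UniformSpace.firstCountableTopology _

end RingFiltration
end MvIwasawa
end

noncomputable section
namespace MvIwasawa

/-! ### Coefficients of elements of `A_∞` -/

namespace PerfCompletion

open Filter Topology

variable {p f : ℕ} {k : Type*} [CommRing k]

/-- The coefficient of an element of `A_∞` at an exponent `a`: it is the coefficient of any
element of `k[T_0^{±1/p^∞}, …]` which approximates the element beyond the degree of `a`. -/
def cf (x : (perfFiltration p f k).Completion) (a : Fin f → invPow p) : k :=
  ((perfFiltration p f k).exists_sub_of_mem_hat x (⌊totalDegree p f a⌋ + 1)).choose.coeff a

theorem coeff_eq_zero_of_mem_sub {n : ℤ} {y : PerfLaurent p f k}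
    (hy : y ∈ (perfFiltration p f k).sub n) {a : Fin f → invPow p} (ha : totalDegree p f a < n) :
    y.coeff a = 0 := by
  by_contra h
  exact absurd (hy a h) (not_le.2 ha)

theorem mem_sub_iff {n : ℤ} {y : PerfLaurent p f k} :
    y ∈ (perfFiltration p f k).sub n ↔ ∀ a, totalDegree p f a < n → y.coeff a = 0 :=
  ⟨fun h _ ha => coeff_eq_zero_of_mem_sub h ha, fun h a ha => not_lt.1 fun h' => ha (h a h')⟩

theorem cf_eq {x : (perfFiltration p f k).Completion} {y : PerfLaurent p f k} {n : ℤ}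
    (h : x - (perfFiltration p f k).of y ∈ (perfFiltration p f k).hat n) {a : Fin f → invPow p}
    (ha : totalDegree p f a < n) : cf x a = y.coeff a := by
  have h1 := ((perfFiltration p f k).exists_sub_of_mem_hat x
    (⌊totalDegree p f a⌋ + 1)).choose_spec
  rw [cf]
  set z := ((perfFiltration p f k).exists_sub_of_mem_hat x (⌊totalDegree p f a⌋ + 1)).choose
  have h2 : z - y ∈ (perfFiltration p f k).sub (min n (⌊totalDegree p f a⌋ + 1)) := by
    rw [← (perfFiltration p f k).of_mem_hat, map_sub]
    have := sub_mem ((perfFiltration p f k).hat_anti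
      (min_le_left n (⌊totalDegree p f a⌋ + 1)) h)
      ((perfFiltration p f k).hat_anti (min_le_right n (⌊totalDegree p f a⌋ + 1)) h1)
    rwa [sub_sub_sub_cancel_left] at this
  have h3 := coeff_eq_zero_of_mem_sub h2 (a := a) (by
    rw [Int.cast_min, lt_min_iff]
    exact ⟨ha, by push_cast; exact Int.lt_floor_add_one _⟩)
  rw [AddMonoidAlgebra.coeff_sub, Finsupp.sub_apply, sub_eq_zero] at h3
  exact h3

@[simp]
theorem cf_of (y : PerfLaurent p f k) (a : Fin f → invPow p) :
    cf ((perfFiltration p f k).of y) a = y.coeff a :=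
  cf_eq (n := ⌊totalDegree p f a⌋ + 1) (by rw [sub_self]; exact zero_mem _)
    (by push_cast; exact Int.lt_floor_add_one _)

theorem exists_approx (x : (perfFiltration p f k).Completion) (n : ℤ) :
    ∃ y : PerfLaurent p f k, x - (perfFiltration p f k).of y ∈ (perfFiltration p f k).hat n ∧
      ∀ a, totalDegree p f a < n → cf x a = y.coeff a := by
  obtain ⟨y, hy⟩ := (perfFiltration p f k).exists_sub_of_mem_hat x n
  exact ⟨y, hy, fun a ha => cf_eq hy ha⟩

/-- An element of `A_∞` lies in the `n`-th step of the filtration if and only if all its exponents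
have degree at least `n`. -/
theorem mem_hat_iff {n : ℤ} {x : (perfFiltration p f k).Completion} :
    x ∈ (perfFiltration p f k).hat n ↔ ∀ a, totalDegree p f a < n → cf x a = 0 := by
  obtain ⟨y, hy, hc⟩ := exists_approx x n
  have h1 : x ∈ (perfFiltration p f k).hat n ↔ y ∈ (perfFiltration p f k).sub n := by
    rw [← (perfFiltration p f k).of_mem_hat]
    refine ⟨fun h => ?_, fun h => ?_⟩
    · have := sub_mem h hy
      rwa [sub_sub_cancel] at this
    · have := add_mem hy h
      rwa [sub_add_cancel] at this
  rw [h1, mem_sub_iff]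
  exact forall₂_congr fun a ha => by rw [hc a ha]

@[simp]
theorem cf_sub (x y : (perfFiltration p f k).Completion) (a : Fin f → invPow p) :
    cf (x - y) a = cf x a - cf y a := by
  obtain ⟨x', hx, hx'⟩ := exists_approx x (⌊totalDegree p f a⌋ + 1)
  obtain ⟨y', hy, hy'⟩ := exists_approx y (⌊totalDegree p f a⌋ + 1)
  have ha : totalDegree p f a < ((⌊totalDegree p f a⌋ + 1 : ℤ) : ℚ) := by
    push_cast; exact Int.lt_floor_add_one _
  rw [hx' a ha, hy' a ha, ← Finsupp.sub_apply, ← AddMonoidAlgebra.coeff_sub]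
  refine cf_eq (n := ⌊totalDegree p f a⌋ + 1) ?_ ha
  rw [map_sub, sub_sub_sub_comm]
  exact sub_mem hx hy

@[simp]
theorem cf_zero (a : Fin f → invPow p) : cf (0 : (perfFiltration p f k).Completion) a = 0 := by
  simpa using cf_sub (0 : (perfFiltration p f k).Completion) 0 a

@[simp]
theorem cf_add (x y : (perfFiltration p f k).Completion) (a : Fin f → invPow p) :
    cf (x + y) a = cf x a + cf y a := by
  have := cf_sub (x + y) y a
  rw [add_sub_cancel_right] at this
  rw [this, sub_add_cancel]

@[simp]
theorem cf_sum {ι : Type*} (s : Finset ι) (x : ι → (perfFiltration p f k).Completion)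
    (a : Fin f → invPow p) : cf (∑ i ∈ s, x i) a = ∑ i ∈ s, cf (x i) a := by
  classical
  induction s using Finset.induction_on with
  | empty => simp
  | insert i s hi ih => rw [Finset.sum_insert hi, Finset.sum_insert hi, cf_add, ih]

theorem ext_cf {x y : (perfFiltration p f k).Completion} (h : ∀ a, cf x a = cf y a) : x = y := by
  rw [← sub_eq_zero]
  exact (perfFiltration p f k).eq_zero_of_forall_mem_hat fun n => mem_hat_iff.2 fun a _ => by
    rw [cf_sub, h, sub_self]

theorem finite_cf (x : (perfFiltration p f k).Completion) (n : ℤ) :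
    {a | totalDegree p f a < n ∧ cf x a ≠ 0}.Finite := by
  obtain ⟨y, -, hc⟩ := exists_approx x n
  refine y.coeff.support.finite_toSet.subset fun a ha => ?_
  rw [Finset.mem_coe, Finsupp.mem_support_iff, ← hc a ha.1]
  exact ha.2

/-- The element of `A_∞` with given coefficients. -/
theorem exists_cf_eq (c : (Fin f → invPow p) → k)
    (hc : ∀ n : ℤ, {a | totalDegree p f a < n ∧ c a ≠ 0}.Finite) :
    ∃ x : (perfFiltration p f k).Completion, ∀ a, cf x a = c a := by
  classical
  obtain ⟨r, hr⟩ := ((hc 0).toFinset.image (totalDegree p f)).bddBelow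
  let m : ℤ := min ⌊r⌋ 0
  have hm : ∀ a, totalDegree p f a < m → c a = 0 := by
    intro a ha
    by_contra h
    have h0 : totalDegree p f a < (0 : ℤ) := lt_of_lt_of_le ha (by
      exact_mod_cast min_le_right _ _)
    have h1 : r ≤ totalDegree p f a := hr (Finset.mem_coe.2 (Finset.mem_image_of_mem _
      ((hc 0).mem_toFinset.2 ⟨h0, h⟩)))
    have h2 : (m : ℚ) ≤ ⌊r⌋ := by exact_mod_cast min_le_left _ _
    have h3 := Int.floor_le r
    linarith
  -- the part of degree in `[m + j, m + j + 1)`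
  let P : ℕ → PerfLaurent p f k := fun j =>
    ∑ a ∈ (hc (m + j + 1)).toFinset with ¬ totalDegree p f a < ((m + j : ℤ) : ℚ),
      AddMonoidAlgebra.single a (c a)
  have hP : ∀ j a, (P j).coeff a = if (¬ totalDegree p f a < ((m + j : ℤ) : ℚ)) ∧
      totalDegree p f a < ((m + j + 1 : ℤ) : ℚ) then c a else 0 := by
    intro j a
    simp only [P, AddMonoidAlgebra.coeff_sum, Finsupp.finsetSum_apply,
      AddMonoidAlgebra.coeff_single, Finsupp.single_apply]
    rw [Finset.sum_ite_eq']
    simp only [Finset.mem_filter, Set.Finite.mem_toFinset, Set.mem_ofPred_eq]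
    by_cases h : c a = 0
    · simp [h]
    · simp [h, and_comm]
  have hPs : ∀ j : ℕ, (perfFiltration p f k).of (P j) ∈ (perfFiltration p f k).hat (m + j) := by
    intro j
    rw [(perfFiltration p f k).of_mem_hat, mem_sub_iff]
    intro a ha
    rw [hP, if_neg]
    exact fun h => h.1 ha
  obtain ⟨s, hs⟩ := (perfFiltration p f k).exists_series m _ hPs
  refine ⟨s, fun a => ?_⟩
  obtain ⟨n, hn⟩ : ∃ n : ℕ, totalDegree p f a < ((m + n : ℤ) : ℚ) := by
    refine ⟨(⌊totalDegree p f a⌋ + 1 - m).toNat, ?_⟩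
    have h1 := Int.self_le_toNat (⌊totalDegree p f a⌋ + 1 - m)
    have h2 : ((⌊totalDegree p f a⌋ + 1 : ℤ) : ℚ) ≤
      ((m + (⌊totalDegree p f a⌋ + 1 - m).toNat : ℤ) : ℚ) := Int.cast_le.2 (by linarith)
    refine lt_of_lt_of_le ?_ h2
    push_cast
    exact Int.lt_floor_add_one _
  have h1 := hs n
  rw [← map_sum] at h1
  rw [cf_eq h1 hn]
  have key : ∀ n : ℕ, (∑ j ∈ Finset.range n, P j).coeff a =
      if totalDegree p f a < ((m + n : ℤ) : ℚ) then c a else 0 := by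
    intro n
    induction n with
    | zero =>
      split_ifs with h
      · simp only [Nat.cast_zero, add_zero] at h
        simp [hm a h]
      · simp
    | succ n ih =>
      rw [Finset.sum_range_succ, AddMonoidAlgebra.coeff_add, Finsupp.add_apply, ih, hP]
      have h3 : ((m + n : ℤ) : ℚ) ≤ ((m + n + 1 : ℤ) : ℚ) := Int.cast_le.2 (by omega)
      by_cases h4 : totalDegree p f a < ((m + n : ℤ) : ℚ)
      · rw [if_pos h4, if_neg (fun h => h.1 h4), if_pos, add_zero]
        push_cast at h4 ⊢
        linarith
      · rw [if_neg h4, zero_add]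
        congr 1
        simp only [h4, not_false_eq_true, true_and, Nat.cast_succ, add_assoc]
  rw [key, if_pos hn]

/-- The monomial with exponent `a` as an element of `A_∞`. -/
def mon (p f : ℕ) (k : Type*) [CommRing k] (a : Fin f → invPow p) :
    (perfFiltration p f k).Completion :=
  (perfFiltration p f k).of (AddMonoidAlgebra.single a 1)

theorem mon_add (a b : Fin f → invPow p) : mon p f k (a + b) = mon p f k a * mon p f k b := by
  rw [mon, mon, mon, ← map_mul, AddMonoidAlgebra.single_mul_single, one_mul]

theorem mon_zero : mon p f k 0 = 1 := by
  rw [mon, ← AddMonoidAlgebra.one_def, map_one]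

theorem mon_neg_mul_mon (a : Fin f → invPow p) : mon p f k (-a) * mon p f k a = 1 := by
  rw [← mon_add, neg_add_cancel, mon_zero]

theorem mon_nsmul (n : ℕ) (a : Fin f → invPow p) : mon p f k (n • a) = mon p f k a ^ n := by
  rw [mon, mon, ← map_pow, AddMonoidAlgebra.single_pow, one_pow]

theorem cf_of_single_mul (b : Fin f → invPow p) (u : k) (x : (perfFiltration p f k).Completion)
    (a : Fin f → invPow p) :
    cf ((perfFiltration p f k).of (AddMonoidAlgebra.single b u) * x) a = u * cf x (a - b) := by
  set n := max (⌊totalDegree p f a⌋ + 1) (⌊totalDegree p f (a - b)⌋ + 1)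
  obtain ⟨l, hl⟩ := (perfFiltration p f k).exhaustive (AddMonoidAlgebra.single b u)
  obtain ⟨y, hy, hc⟩ := exists_approx x (n - min l 0)
  have h1 : (perfFiltration p f k).of (AddMonoidAlgebra.single b u) * x -
      (perfFiltration p f k).of (AddMonoidAlgebra.single b u * y) ∈
        (perfFiltration p f k).hat n := by
    rw [map_mul, ← mul_sub]
    refine (perfFiltration p f k).hat_anti ?_ ((perfFiltration p f k).mul_mem_hat
      ((perfFiltration p f k).of_mem_hat.2 hl) hy)
    have := min_le_left l 0
    omega
  rw [cf_eq h1, hc, AddMonoidAlgebra.coeff_single_mul_apply, neg_add_eq_sub]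
  · refine lt_of_lt_of_le (Int.lt_floor_add_one _) ?_
    have h2 : ⌊totalDegree p f (a - b)⌋ + 1 ≤ n - min l 0 := by
      have h3 := min_le_right l 0
      have h4 : ⌊totalDegree p f (a - b)⌋ + 1 ≤ n := le_max_right _ _
      omega
    exact_mod_cast h2
  · refine lt_of_lt_of_le (Int.lt_floor_add_one _) ?_
    have h4 : ⌊totalDegree p f a⌋ + 1 ≤ n := le_max_left _ _
    exact_mod_cast h4

theorem cf_mon_mul (b : Fin f → invPow p) (x : (perfFiltration p f k).Completion)
    (a : Fin f → invPow p) : cf (mon p f k b * x) a = cf x (a - b) := by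
  rw [mon, cf_of_single_mul, one_mul]

theorem mon_mul_mem_hat {b : Fin f → invPow p} {m : ℤ} (hb : totalDegree p f b = m) {n : ℤ}
    {x : (perfFiltration p f k).Completion} (hx : x ∈ (perfFiltration p f k).hat n) :
    mon p f k b * x ∈ (perfFiltration p f k).hat (m + n) := by
  rw [mem_hat_iff] at hx ⊢
  intro a ha
  rw [cf_mon_mul]
  refine hx _ ?_
  rw [map_sub, hb, sub_lt_iff_lt_add']
  exact_mod_cast ha

theorem mon_mem_hat {b : Fin f → invPow p} {m : ℤ} (hb : (m : ℚ) ≤ totalDegree p f b) :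
    mon p f k b ∈ (perfFiltration p f k).hat m := by
  rw [mon, (perfFiltration p f k).of_mem_hat, mem_sub_iff]
  intro a ha
  rw [AddMonoidAlgebra.coeff_single, Finsupp.single_apply, if_neg]
  rintro rfl
  exact absurd hb (not_le.2 ha)

end PerfCompletion
end MvIwasawa
end

noncomputable section
namespace MvIwasawa

namespace PerfCompletion

open Filter Topology

variable {p f : ℕ}

/-! ### Frobenius and `φ_q` on `A_∞` -/

section Frobenius

variable {k : Type*}

theorem of_injective [CommRing k] : Function.Injective (perfFiltration p f k).of := by
  intro x y h
  refine AddMonoidAlgebra.coeff_injective (Finsupp.ext fun a => ?_)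
  rw [← cf_of, ← cf_of, h]

/-- Continuous homomorphisms on `A_∞` which agree on the terms `u T^a` are equal. -/
theorem eq_of_single [CommRing k] {T : Type*} [CommRing T] [TopologicalSpace T] [T2Space T]
    {g g' : (perfFiltration p f k).Completion →+* T} (hg : Continuous g) (hg' : Continuous g')
    (h : ∀ a u, g ((perfFiltration p f k).of (AddMonoidAlgebra.single a u)) =
      g' ((perfFiltration p f k).of (AddMonoidAlgebra.single a u))) (x) : g x = g' x := by
  have h1 : g.comp (perfFiltration p f k).of = g'.comp (perfFiltration p f k).of := by
    refine AddMonoidAlgebra.ringHom_ext (fun r => ?_) fun a => ?_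
    · exact h 0 r
    · exact h a 1
  exact congrFun ((perfFiltration p f k).eq_of_eq_of hg hg' fun y => congrArg (· y) h1) x

/-- Division by `p ^ n` on `ℤ[1/p] ^ f`. -/
def divPow (p f n : ℕ) [Fact p.Prime] : (Fin f → invPow p) →+ (Fin f → invPow p) where
  toFun a i := ⟨(a i : ℚ) / (p : ℚ) ^ n, by
    obtain ⟨m, z, h⟩ := (a i).2
    refine ⟨m + n, z, ?_⟩
    have : (p : ℚ) ≠ 0 := Nat.cast_ne_zero.2 (Fact.out : p.Prime).ne_zero
    rw [← h, pow_add]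
    field_simp⟩
  map_zero' := by
    ext i
    simp
  map_add' a b := by
    ext i
    simp [add_div]

variable [Fact p.Prime]

theorem nsmul_divPow (n : ℕ) (a : Fin f → invPow p) : p ^ n • divPow p f n a = a := by
  have : (p : ℚ) ≠ 0 := Nat.cast_ne_zero.2 (Fact.out : p.Prime).ne_zero
  ext i
  simp only [divPow, AddMonoidHom.coe_mk, ZeroHom.coe_mk, Pi.smul_apply, AddSubgroup.coe_nsmul,
    nsmul_eq_mul]
  push_cast
  field_simp

theorem divPow_nsmul (n : ℕ) (a : Fin f → invPow p) : divPow p f n (p ^ n • a) = a := by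
  rw [map_nsmul, nsmul_divPow]

theorem totalDegree_divPow (n : ℕ) (a : Fin f → invPow p) :
    (p : ℚ) ^ n * totalDegree p f (divPow p f n a) = totalDegree p f a := by
  conv_rhs => rw [← nsmul_divPow n a, map_nsmul, nsmul_eq_mul]
  push_cast
  rfl

/-- The endomorphism of `k[T_0^{±1/p^∞}, …]` given by an endomorphism of `k` and division of
exponents by `p ^ n` extends to `A_∞`. -/
theorem exists_root_hom [CommRing k] (n : ℕ) (σ : k →+* k) :
    ∃ g : (perfFiltration p f k).Completion →+* (perfFiltration p f k).Completion,
      Continuous g ∧ ∀ a u, g ((perfFiltration p f k).of (AddMonoidAlgebra.single a u)) =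
        (perfFiltration p f k).of (AddMonoidAlgebra.single (divPow p f n a) (σ u)) := by
  classical
  obtain ⟨g, hg, hg'⟩ := (perfFiltration p f k).exists_extension_completion (perfFiltration p f k)
    ((AddMonoidAlgebra.mapDomainRingHom k (divPow p f n)).comp
      (AddMonoidAlgebra.mapRingHom (Fin f → invPow p) σ)) (by
      intro m
      refine ⟨p ^ n * m, fun x hx => ?_⟩
      rw [mem_sub_iff]
      intro a ha
      by_contra h
      have h1 : a ∈ ((AddMonoidAlgebra.mapRingHom (Fin f → invPow p) σ x).coeff.mapDomain
          (divPow p f n)).support := Finsupp.mem_support_iff.2 h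
      obtain ⟨b, hb, rfl⟩ := Finset.mem_image.1 (Finsupp.mapDomain_support h1)
      have hb' : x.coeff b ≠ 0 := by
        intro h0
        rw [Finsupp.mem_support_iff] at hb
        apply hb
        simp [h0]
      have h2 := hx b hb'
      rw [← totalDegree_divPow n b] at h2
      push_cast at h2
      have h3 : (0 : ℚ) < (p : ℚ) ^ n :=
        pow_pos (Nat.cast_pos.2 (Fact.out : p.Prime).pos) _
      have h4 := le_of_mul_le_mul_left h2 h3
      exact absurd h4 (not_le.2 ha))
  refine ⟨g, hg, fun a u => ?_⟩
  rw [hg']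
  simp

instance charP [CommRing k] [CharP k p] : CharP (perfFiltration p f k).Completion p := by
  have h : Function.Injective ((perfFiltration p f k).of.comp
      (algebraMap k (PerfLaurent p f k))) := by
    refine of_injective.comp ?_
    intro x y h
    have := congrArg (fun z : PerfLaurent p f k => z.coeff 0) h
    simpa using this
  exact charP_of_injective_ringHom h p

/-- The `p`-power map of `A_∞` is bijective: dividing the exponents by `p` and taking `p`-th roots
of the coefficients is continuous, and inverts it. -/
theorem exists_pow_eq [CommRing k] [CharP k p] [PerfectRing k p] :
    ∃ g : (perfFiltration p f k).Completion →+* (perfFiltration p f k).Completion,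
      (∀ x, g x ^ p = x) ∧ ∀ x, g (x ^ p) = x := by
  obtain ⟨g, hg, hg'⟩ := exists_root_hom (p := p) (f := f) 1
    ((frobeniusEquiv k p).symm : k →+* k)
  have hF : Continuous (frobenius (perfFiltration p f k).Completion p) := by
    change Continuous fun x => x ^ p
    fun_prop
  have hT : T2Space (perfFiltration p f k).Completion := inferInstance
  refine ⟨g, fun x => ?_, fun x => ?_⟩
  · have := eq_of_single (g := (frobenius _ p).comp g) (g' := RingHom.id _) (hF.comp hg)
      continuous_id (fun a u => ?_) x
    · exact this
    · rw [RingHom.comp_apply, hg', frobenius_def, ← map_pow, AddMonoidAlgebra.single_pow]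
      have h1 := nsmul_divPow 1 a
      rw [pow_one] at h1
      rw [h1]
      have h2 : ((frobeniusEquiv k p).symm : k →+* k) u ^ p = u :=
        frobenius_apply_frobeniusEquiv_symm k p u
      rw [h2]
      rfl
  · have := eq_of_single (g := g.comp (frobenius _ p)) (g' := RingHom.id _) (hg.comp hF)
      continuous_id (fun a u => ?_) x
    · exact this
    · rw [RingHom.comp_apply, frobenius_def, ← map_pow, AddMonoidAlgebra.single_pow, hg']
      have h1 := divPow_nsmul 1 a
      rw [pow_one] at h1
      rw [h1]
      have h2 : ((frobeniusEquiv k p).symm : k →+* k) (u ^ p) = u :=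
        frobeniusEquiv_symm_apply_frobenius k p u
      rw [h2]
      rfl

instance perfectRing [CommRing k] [CharP k p] [PerfectRing k p] :
    PerfectRing (perfFiltration p f k).Completion p := by
  obtain ⟨g, h1, h2⟩ := exists_pow_eq (p := p) (f := f) (k := k)
  exact ⟨⟨fun x y h => by
    rw [← h2 x, ← h2 y]; exact congrArg g h, fun x => ⟨g x, h1 x⟩⟩⟩

/-- The endomorphism `φ_q` of `A_∞`, on the underlying completion. -/
def phi (p f : ℕ) (k : Type*) [CommRing k] [Fact p.Prime] :
    (perfFiltration p f k).Completion →+* (perfFiltration p f k).Completion :=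
  (perfFiltration p f k).map (perfFiltration p f k) (perfPhi p f k).toRingHom (perfPhi_mem p f k)

theorem continuous_phi [CommRing k] : Continuous (phi p f k) :=
  UniformSpace.Completion.continuous_extension

theorem phi_of [CommRing k] (x : PerfLaurent p f k) :
    phi p f k ((perfFiltration p f k).of x) = (perfFiltration p f k).of (perfPhi p f k x) := by
  have h := UniformSpace.Completion.extensionHom_coe
    ((UniformSpace.Completion.coeRingHom (α := (perfFiltration p f k).Space)).comp
      ((perfFiltration p f k).homSpace (perfFiltration p f k) (perfPhi p f k).toRingHom))
    (UniformSpace.Completion.continuous_coeRingHom.comp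
      ((perfFiltration p f k).continuous_homSpace (perfFiltration p f k) _ (perfPhi_mem p f k)))
  exact h x

theorem phi_of_single [CommRing k] (a : Fin f → invPow p) (u : k) :
    phi p f k ((perfFiltration p f k).of (AddMonoidAlgebra.single a u)) =
      (perfFiltration p f k).of (AddMonoidAlgebra.single (p ^ f • a) u) := by
  rw [phi_of]
  congr 1
  simp [perfPhi]

/-- The endomorphism `φ_q` of `A_∞` is bijective: its inverse divides the exponents by `q`. -/
theorem bijective_phi [CommRing k] : Function.Bijective (phi p f k) := by
  obtain ⟨g, hg, hg'⟩ := exists_root_hom (p := p) (f := f) f (RingHom.id k)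
  have hT : T2Space (perfFiltration p f k).Completion := inferInstance
  refine Function.bijective_iff_has_inverse.2 ⟨g, fun x => ?_, fun x => ?_⟩
  · have := eq_of_single (g := g.comp (phi p f k)) (g' := RingHom.id _) (hg.comp continuous_phi)
      continuous_id (fun a u => ?_) x
    · exact this
    · rw [RingHom.comp_apply, phi_of_single, hg', divPow_nsmul]
      rfl
  · have := eq_of_single (g := (phi p f k).comp g) (g' := RingHom.id _) (continuous_phi.comp hg)
      continuous_id (fun a u => ?_) x
    · exact this
    · rw [RingHom.comp_apply, hg', phi_of_single, nsmul_divPow]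
      rfl

end Frobenius

/-! ### The subring of elements with integral exponents -/

section Integral

variable {k : Type*} [Field k]

/-- The inclusion of the integral exponents in the exponents of `A_∞`. -/
def intExp (p f : ℕ) : (Fin f → ℤ) →+ (Fin f → invPow p) where
  toFun a i := ⟨a i, 0, a i, by simp⟩
  map_zero' := by ext i; simp
  map_add' a b := by ext i; simp

theorem totalDegree_intExp (a : Fin f → ℤ) :
    totalDegree p f (intExp p f a) = ((∑ i, a i : ℤ) : ℚ) := by
  simp [totalDegree, intExp]

/-- The inclusion of the Laurent polynomials with coefficients in a subfield in `A_∞`. -/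
def laurent (p f : ℕ) (κ : Subfield k) :
    AddMonoidAlgebra κ (Fin f → ℤ) →+* (perfFiltration p f k).Completion :=
  (perfFiltration p f k).of.comp ((AddMonoidAlgebra.mapDomainRingHom k (intExp p f)).comp
    (AddMonoidAlgebra.mapRingHom (Fin f → ℤ) κ.subtype))

theorem laurent_single (κ : Subfield k) (a : Fin f → ℤ) (u : κ) :
    laurent p f κ (AddMonoidAlgebra.single a u) =
      (perfFiltration p f k).of (AddMonoidAlgebra.single (intExp p f a) (u : k)) := by
  simp [laurent]

/-- The closed subring `κ((T_0))⟨(T_i/T_0)^{±1}⟩` of `A_∞`, for a subfield `κ` of `k`. -/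
def intSubring (p f : ℕ) (κ : Subfield k) : Subring (perfFiltration p f k).Completion :=
  (laurent p f κ).range.topologicalClosure

theorem mem_intSubring {κ : Subfield k} {x : (perfFiltration p f k).Completion} :
    x ∈ intSubring p f κ ↔ ∀ n, ∃ y, x - laurent p f κ y ∈ (perfFiltration p f k).hat n := by
  change x ∈ closure ((laurent p f κ).range : Set (perfFiltration p f k).Completion) ↔ _
  rw [mem_closure_iff_nhds_zero]
  constructor
  · intro h n
    obtain ⟨_, ⟨y, rfl⟩, hy⟩ := h _ ((perfFiltration p f k).hat_mem_nhds n)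
    exact ⟨y, by simpa using neg_mem hy⟩
  · intro h U hU
    obtain ⟨n, -, hn⟩ := (perfFiltration p f k).hasBasis_hat.mem_iff.1 hU
    obtain ⟨y, hy⟩ := h n
    exact ⟨_, ⟨y, rfl⟩, hn (by simpa using neg_mem hy)⟩

theorem isClosed_intSubring (κ : Subfield k) :
    IsClosed (intSubring p f κ : Set (perfFiltration p f k).Completion) :=
  Subring.isClosed_topologicalClosure _

theorem laurent_mem (κ : Subfield k) (y) : laurent p f κ y ∈ intSubring p f κ :=
  Subring.le_topologicalClosure _ ⟨y, rfl⟩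

theorem cf_laurent (κ : Subfield k) (y) (a : Fin f → invPow p) :
    cf (laurent p f κ y) a ∈ κ ∧ (cf (laurent p f κ y) a ≠ 0 → a ∈ (intExp p f).range) := by
  classical
  induction y using AddMonoidAlgebra.induction_linear with
  | zero => simp [zero_mem]
  | add y z hy hz =>
    rw [map_add, cf_add]
    refine ⟨add_mem hy.1 hz.1, fun h => ?_⟩
    by_cases h1 : cf (laurent p f κ y) a = 0
    · rw [h1, zero_add] at h
      exact hz.2 h
    · exact hy.2 h1
  | single b u =>
    rw [laurent_single, cf_of, AddMonoidAlgebra.coeff_single, Finsupp.single_apply]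
    split_ifs with h
    · exact ⟨u.2, fun _ => ⟨b, h⟩⟩
    · exact ⟨zero_mem _, fun h => absurd rfl h⟩

theorem sum_single_mem {κ : Subfield k} (s : Finset (Fin f → invPow p))
    (c : (Fin f → invPow p) → k) (hc : ∀ a ∈ s, c a ∈ κ)
    (hs : ∀ a ∈ s, a ∈ (intExp p f).range) :
    ∃ y, laurent p f κ y = (perfFiltration p f k).of (∑ a ∈ s, AddMonoidAlgebra.single a (c a)) :=
      by
  classical
  induction s using Finset.induction_on with
  | empty => exact ⟨0, by simp⟩
  | insert a s ha ih =>
    obtain ⟨y, hy⟩ := ih (fun b hb => hc b (Finset.mem_insert_of_mem hb))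
      fun b hb => hs b (Finset.mem_insert_of_mem hb)
    obtain ⟨b, hb⟩ := hs a (Finset.mem_insert_self _ _)
    refine ⟨AddMonoidAlgebra.single b ⟨c a, hc a (Finset.mem_insert_self _ _)⟩ + y, ?_⟩
    rw [Finset.sum_insert ha, map_add, map_add, laurent_single, hy, hb]

theorem sub_sum_mem_hat (x : (perfFiltration p f k).Completion) (n : ℤ) :
    x - (perfFiltration p f k).of (∑ a ∈ (finite_cf x n).toFinset,
      AddMonoidAlgebra.single a (cf x a)) ∈ (perfFiltration p f k).hat n := by
  classical
  rw [mem_hat_iff]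
  intro a ha
  rw [cf_sub, cf_of]
  simp only [AddMonoidAlgebra.coeff_sum, Finsupp.finsetSum_apply,
      AddMonoidAlgebra.coeff_single, Finsupp.single_apply]
  rw [Finset.sum_ite_eq']
  split_ifs with h
  · exact sub_self _
  · rw [Set.Finite.mem_toFinset] at h
    rw [sub_zero]
    by_contra h'
    exact h ⟨ha, h'⟩

/-- The closed subring of elements with integral exponents is described by coefficients. -/
theorem mem_intSubring_iff_cf {κ : Subfield k} {x : (perfFiltration p f k).Completion} :
    x ∈ intSubring p f κ ↔ ∀ a, cf x a ∈ κ ∧ (cf x a ≠ 0 → a ∈ (intExp p f).range) := by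
  constructor
  · intro h a
    obtain ⟨y, hy⟩ := mem_intSubring.1 h (⌊totalDegree p f a⌋ + 1)
    have h1 := mem_hat_iff.1 hy a (by push_cast; exact Int.lt_floor_add_one _)
    rw [cf_sub, sub_eq_zero] at h1
    rw [h1]
    exact cf_laurent κ y a
  · intro h
    rw [mem_intSubring]
    intro n
    obtain ⟨y, hy⟩ := sum_single_mem (κ := κ) (finite_cf x n).toFinset (cf x)
      (fun a _ => (h a).1) (fun a ha => (h a).2 ((finite_cf x n).mem_toFinset.1 ha).2)
    exact ⟨y, by rw [hy]; exact sub_sum_mem_hat x n⟩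

theorem mon_intExp_mem (κ : Subfield k) (a : Fin f → ℤ) :
    mon p f k (intExp p f a) ∈ intSubring p f κ := by
  have := laurent_mem (p := p) κ (AddMonoidAlgebra.single a 1)
  rwa [laurent_single] at this

/-- On elements with integral exponents and coefficients in `𝔽_q`, the map `φ_q` is the
`q`-power map. -/
theorem phi_eq_pow [Fact p.Prime] [CharP k p] {κ : Subfield k} (hκ : ∀ u ∈ κ, u ^ p ^ f = u)
    {x : (perfFiltration p f k).Completion} (hx : x ∈ intSubring p f κ) :
    phi p f k x = x ^ p ^ f := by
  have h1 : (phi p f k).comp (laurent p f κ) =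
      (iterateFrobenius _ p f).comp (laurent p f κ) := by
    refine AddMonoidAlgebra.ringHom_ext (fun r => ?_) fun a => ?_
    · rw [RingHom.comp_apply, RingHom.comp_apply, iterateFrobenius_def, laurent_single,
        phi_of_single, ← map_pow, AddMonoidAlgebra.single_pow, hκ _ r.2]
    · rw [RingHom.comp_apply, RingHom.comp_apply, iterateFrobenius_def, laurent_single,
        phi_of_single, ← map_pow, AddMonoidAlgebra.single_pow, hκ _ (1 : κ).2]
  have h2 : IsClosed {x | phi p f k x = x ^ p ^ f} :=
    isClosed_eq continuous_phi (by fun_prop)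
  have h3 : (intSubring p f κ : Set (perfFiltration p f k).Completion) ⊆
      {x | phi p f k x = x ^ p ^ f} := by
    change closure ((laurent p f κ).range : Set (perfFiltration p f k).Completion) ⊆ _
    refine closure_minimal ?_ h2
    rintro _ ⟨y, rfl⟩
    exact congrArg (· y) h1
  exact h3 hx

end Integral
end PerfCompletion
end MvIwasawa
end

noncomputable section
namespace MvIwasawa

/-! ### Noetherianity of the ring of elements with integral exponents -/

namespace PerfCompletion

open Filter Topology

variable {p f : ℕ} {k : Type*} [Field k]

/-- The ring of elements of `A_∞` of nonnegative degree. -/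
def plus (p f : ℕ) (k : Type*) [Field k] : Subring (perfFiltration p f k).Completion where
  carrier := (perfFiltration p f k).hat 0
  zero_mem' := zero_mem _
  add_mem' := add_mem
  neg_mem' := neg_mem
  one_mem' := (perfFiltration p f k).one_mem_hat
  mul_mem' hx hy := by simpa using (perfFiltration p f k).mul_mem_hat hx hy

theorem mem_plus {x : (perfFiltration p f k).Completion} :
    x ∈ plus p f k ↔ x ∈ (perfFiltration p f k).hat 0 := Iff.rfl

/-- The elements with integral exponents of nonnegative degree. -/
def intPlus (p f : ℕ) (κ : Subfield k) : Subring (perfFiltration p f k).Completion :=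
  intSubring p f κ ⊓ plus p f k

theorem mem_intPlus {κ : Subfield k} {x : (perfFiltration p f k).Completion} :
    x ∈ intPlus p f κ ↔ x ∈ intSubring p f κ ∧ x ∈ (perfFiltration p f k).hat 0 := Iff.rfl

variable [NeZero f]

/-- The exponent of `T_0`. -/
def e0 (f : ℕ) [NeZero f] : Fin f → ℤ := Pi.single 0 1

/-- The element `T_0 ^ n`. -/
def tpow (p f : ℕ) [NeZero f] (k : Type*) [Field k] (n : ℤ) :
    (perfFiltration p f k).Completion := mon p f k (intExp p f (n • e0 f))

theorem totalDegree_e0 (n : ℤ) : totalDegree p f (intExp p f (n • e0 f)) = n := by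
  rw [totalDegree_intExp]
  simp [e0, ← Finset.mul_sum]

theorem tpow_add (m n : ℤ) : tpow p f k (m + n) = tpow p f k m * tpow p f k n := by
  rw [tpow, add_smul, map_add, mon_add, tpow, tpow]

theorem tpow_zero : tpow p f k 0 = 1 := by
  rw [tpow, zero_smul, map_zero, mon_zero]

theorem tpow_nat (n : ℕ) : tpow p f k n = tpow p f k 1 ^ n := by
  rw [tpow, tpow, ← mon_nsmul, ← map_nsmul]
  congr 2
  simp

theorem tpow_mem (κ : Subfield k) (n : ℤ) : tpow p f k n ∈ intSubring p f κ :=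
  mon_intExp_mem κ _

theorem tpow_mul_mem_hat {n m : ℤ} {x : (perfFiltration p f k).Completion}
    (hx : x ∈ (perfFiltration p f k).hat n) :
      tpow p f k m * x ∈ (perfFiltration p f k).hat (m + n) :=
  mon_mul_mem_hat (totalDegree_e0 m) hx

theorem tpow_one_mem_plus : tpow p f k 1 ∈ plus p f k := by
  refine (perfFiltration p f k).hat_anti zero_le_one (mon_mem_hat ?_)
  rw [totalDegree_e0]

theorem tpow_neg_mul_cancel (n : ℤ) (x : (perfFiltration p f k).Completion) :
    tpow p f k n * (tpow p f k (-n) * x) = x := by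
  rw [← mul_assoc, ← tpow_add, add_neg_cancel, tpow_zero, one_mul]

/-- The `T_0`-adic completeness of a closed subring of `A_∞` containing the powers of `T_0`,
or rather of its elements of nonnegative degree. -/
theorem isPowComplete_of_isClosed (D : Subring (perfFiltration p f k).Completion)
    (hD : IsClosed (D : Set (perfFiltration p f k).Completion)) (ht : ∀ n, tpow p f k n ∈ D)
    (M : Type*) [AddCommGroup M] (R : Type*) [CommRing R] [Module R M] (t : R)
    (i : M →+ (perfFiltration p f k).Completion) (hi : Function.Injective i)
    (hM : ∀ x, x ∈ i.range ↔ x ∈ D ∧ x ∈ (perfFiltration p f k).hat 0)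
    (hi' : ∀ x, i (t • x) = tpow p f k 1 * i x) : IsPowComplete t M := by
  have hpow : ∀ (n : ℕ) x, i (t ^ n • x) = tpow p f k n * i x := by
    intro n x
    induction n with
    | zero => rw [pow_zero, one_smul, Nat.cast_zero, tpow_zero, one_mul]
    | succ n ih =>
      rw [pow_succ', mul_smul, hi', ih, ← mul_assoc, ← tpow_add, Nat.cast_succ, add_comm]
  have hdiv : ∀ (n : ℕ) y, i y ∈ (perfFiltration p f k).hat n → ∃ z, y = t ^ n • z := by
    intro n y hy
    have h1 : tpow p f k (-n) * i y ∈ i.range := by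
      rw [hM]
      refine ⟨mul_mem (ht _) ((hM _).1 ⟨y, rfl⟩).1, ?_⟩
      simpa using tpow_mul_mem_hat (m := -n) hy
    obtain ⟨z, hz⟩ := h1
    refine ⟨z, hi ?_⟩
    rw [hpow, hz, tpow_neg_mul_cancel]
  have hmem : ∀ (n : ℕ) x, i (t ^ n • x) ∈ (perfFiltration p f k).hat n := by
    intro n x
    rw [hpow]
    simpa using tpow_mul_mem_hat (m := n) ((hM _).1 ⟨x, rfl⟩).2
  constructor
  · intro x hx
    refine hi ?_
    rw [map_zero]
    refine (perfFiltration p f k).eq_zero_of_forall_mem_hat fun n => ?_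
    obtain ⟨z, rfl⟩ := hx n.toNat
    exact (perfFiltration p f k).hat_anti (Int.self_le_toNat n) (hmem _ z)
  · intro m
    obtain ⟨s, hs⟩ := (perfFiltration p f k).exists_series 0 (fun j => i (t ^ j • m j))
      (fun j => by rw [zero_add]; exact hmem j _)
    simp only [zero_add, ← map_sum] at hs
    have h1 : s ∈ i.range := by
      rw [hM]
      constructor
      · rw [← SetLike.mem_coe, ← hD.closure_eq, mem_closure_iff_nhds_zero]
        intro U hU
        obtain ⟨n, -, hn⟩ := (perfFiltration p f k).hasBasis_hat.mem_iff.1 hU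
        refine ⟨_, ((hM _).1 ⟨∑ j ∈ Finset.range n.toNat, t ^ j • m j, rfl⟩).1, hn ?_⟩
        have h2 := (perfFiltration p f k).hat_anti (Int.self_le_toNat n) (neg_mem (hs n.toNat))
        simpa using h2
      · simpa using hs 0
    obtain ⟨y, rfl⟩ := h1
    refine ⟨y, fun n => ?_⟩
    have h2 := hs n
    rw [← map_sub] at h2
    obtain ⟨z, hz⟩ := hdiv n _ h2
    exact ⟨z, by rw [← hz]; abel⟩

/-- `T_0` as an element of the ring of elements with integral exponents of nonnegative degree. -/
def t0 (p f : ℕ) [NeZero f] (κ : Subfield k) : intPlus p f κ :=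
  ⟨tpow p f k 1, tpow_mem κ 1, tpow_one_mem_plus⟩

theorem isPowComplete_intPlus (κ : Subfield k) : IsPowComplete (t0 p f κ) (intPlus p f κ) := by
  refine isPowComplete_of_isClosed (intSubring p f κ) (isClosed_intSubring κ) (tpow_mem κ) _ _ _
    (intPlus p f κ).subtype.toAddMonoidHom Subtype.val_injective (fun x => ?_) fun x => rfl
  rw [← mem_intPlus]
  constructor
  · rintro ⟨y, rfl⟩
    exact y.2
  · exact fun h => ⟨⟨x, h⟩, rfl⟩

theorem exists_mul_of_mem_hat_one {κ : Subfield k} (x : intPlus p f κ)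
    (hx : (x : (perfFiltration p f k).Completion) ∈ (perfFiltration p f k).hat 1) :
    ∃ z, x = t0 p f κ * z := by
  refine ⟨⟨tpow p f k (-1) * x, mul_mem (tpow_mem κ _) x.2.1, ?_⟩, ?_⟩
  · rw [SetLike.mem_coe, mem_plus]
    simpa using tpow_mul_mem_hat (m := -1) hx
  · exact Subtype.ext (tpow_neg_mul_cancel 1 _).symm

/-- Integral exponents, shifted to degree `0`. -/
def shift (f : ℕ) [NeZero f] : (Fin f → ℤ) →+ (Fin f → ℤ) where
  toFun a := a - (∑ i, a i) • e0 f
  map_zero' := by simp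
  map_add' a b := by
    simp only [Pi.add_apply, Finset.sum_add_distrib, add_smul]
    abel

theorem sum_shift (a : Fin f → ℤ) : ∑ i, shift f a i = 0 := by
  simp [shift, e0, ← Finset.mul_sum]

theorem shift_eq {a : Fin f → ℤ} (h : ∑ i, a i = 0) : shift f a = a := by
  change a - (∑ i, a i) • e0 f = a
  rw [h, zero_smul, sub_zero]

/-- The Laurent polynomials in the `T_i / T_0`. -/
def laurentZero (p f : ℕ) [NeZero f] (κ : Subfield k) :
    AddMonoidAlgebra κ (Fin f → ℤ) →+* intPlus p f κ :=
  ((laurent p f κ).comp (AddMonoidAlgebra.mapDomainRingHom κ (shift f))).codRestrict _ (by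
    intro y
    refine ⟨laurent_mem κ _, ?_⟩
    rw [SetLike.mem_coe, mem_plus]
    induction y using AddMonoidAlgebra.induction_linear with
    | zero => simp [zero_mem]
    | add y z hy hz => rw [map_add]; exact add_mem hy hz
    | single a u =>
      rw [RingHom.comp_apply, AddMonoidAlgebra.mapDomainRingHom_apply,
        AddMonoidAlgebra.mapDomain_single, laurent_single, RingFiltration.of_mem_hat, mem_sub_iff]
      intro b hb
      rw [AddMonoidAlgebra.coeff_single, Finsupp.single_apply, if_neg]
      rintro rfl
      change totalDegree p f (intExp p f (shift f a)) < _ at hb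
      rw [totalDegree_intExp, sum_shift] at hb
      exact lt_irrefl _ hb)

/-- The ring of elements with integral exponents of nonnegative degree is `T_0`-adically complete,
and its quotient by `T_0`, spanned by the monomials of degree zero, is a quotient of a Laurent
polynomial ring. -/
theorem isNoetherianRing_intPlus (κ : Subfield k) : IsNoetherianRing (intPlus p f κ) := by
  classical
  have h0 : IsNoetherianRing (AddMonoidAlgebra κ (Fin f → ℤ)) :=
    Algebra.FiniteType.isNoetherianRing κ _
  suffices IsNoetherianRing (intPlus p f κ ⧸ Ideal.span {t0 p f κ}) from
    (isPowComplete_intPlus κ).isNoetherianRing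
  refine isNoetherianRing_of_surjective _ _ ((Ideal.Quotient.mk _).comp (laurentZero p f κ)) ?_
  intro x
  obtain ⟨x, rfl⟩ := Ideal.Quotient.mk_surjective x
  have hx := mem_intSubring_iff_cf.1 x.2.1
  have hx0 := mem_hat_iff.1 x.2.2
  have key : ∀ s : Finset (Fin f → invPow p), (∀ a ∈ s, totalDegree p f a < (1 : ℤ) ∧
      cf (x : (perfFiltration p f k).Completion) a ≠ 0) →
      ∃ y, (laurentZero p f κ y : (perfFiltration p f k).Completion) =
        (perfFiltration p f k).of (∑ a ∈ s, AddMonoidAlgebra.single a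
          (cf (x : (perfFiltration p f k).Completion) a)) := by
    intro s
    induction s using Finset.induction_on with
    | empty => exact fun _ => ⟨0, by simp⟩
    | insert a s ha ih =>
      intro h
      obtain ⟨y, hy⟩ := ih fun b hb => h b (Finset.mem_insert_of_mem hb)
      obtain ⟨h1, h2⟩ := h a (Finset.mem_insert_self _ _)
      obtain ⟨b, rfl⟩ := (hx a).2 h2
      have h3 : ∑ i, b i = 0 := by
        rw [totalDegree_intExp] at h1
        have h4 : ¬ totalDegree p f (intExp p f b) < (0 : ℤ) := fun h => h2 (hx0 _ h)
        rw [totalDegree_intExp] at h4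
        have h5 : ∑ i, b i < 1 := by exact_mod_cast h1
        have h6 : ¬ ∑ i, b i < 0 := fun h => h4 (by exact_mod_cast h)
        omega
      refine ⟨AddMonoidAlgebra.single b ⟨_, (hx (intExp p f b)).1⟩ + y, ?_⟩
      rw [Finset.sum_insert ha, map_add, map_add, ← hy]
      change laurent p f κ (AddMonoidAlgebra.mapDomainRingHom κ (shift f)
        (AddMonoidAlgebra.single b ⟨_, (hx (intExp p f b)).1⟩)) + _ = _
      rw [AddMonoidAlgebra.mapDomainRingHom_apply,
        AddMonoidAlgebra.mapDomain_single, laurent_single]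
      change (perfFiltration p f k).of (AddMonoidAlgebra.single (intExp p f (shift f b)) _) + _ = _
      rw [shift_eq h3]
  obtain ⟨y, hy⟩ := key (finite_cf (x : (perfFiltration p f k).Completion) 1).toFinset
    fun a ha => (finite_cf _ 1).mem_toFinset.1 ha
  refine ⟨y, ?_⟩
  rw [RingHom.comp_apply, eq_comm, Ideal.Quotient.mk_eq_mk_iff_sub_mem, Ideal.mem_span_singleton]
  refine exists_mul_of_mem_hat_one _ ?_
  rw [AddSubgroupClass.coe_sub, hy]
  exact sub_sum_mem_hat _ 1

/-- The ring `κ((T_0))⟨(T_i/T_0)^{±1}⟩` is Noetherian. -/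
theorem isNoetherianRing_intSubring (κ : Subfield k) : IsNoetherianRing (intSubring p f κ) := by
  have h0 := isNoetherianRing_intPlus (p := p) (f := f) κ
  let j : intPlus p f κ →+* intSubring p f κ := Subring.inclusion inf_le_left
  let : Algebra (intPlus p f κ) (intSubring p f κ) := j.toAlgebra
  have hloc : IsLocalization (Submonoid.powers (t0 p f κ)) (intSubring p f κ) := by
    refine ⟨?_, ?_, ?_⟩
    · rintro ⟨_, n, rfl⟩
      have : IsUnit (algebraMap (intPlus p f κ) (intSubring p f κ) (t0 p f κ)) := by
        refine IsUnit.of_mul_eq_one ⟨tpow p f k (-1), tpow_mem κ _⟩ (Subtype.ext ?_)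
        change tpow p f k 1 * tpow p f k (-1) = 1
        rw [← tpow_add, add_neg_cancel, tpow_zero]
      simpa using this.pow n
    · intro x
      obtain ⟨n, hn⟩ := (perfFiltration p f k).exists_mem_hat
        (x : (perfFiltration p f k).Completion)
      refine ⟨(⟨tpow p f k (-n).toNat * x, mul_mem (tpow_mem κ _) x.2, ?_⟩,
        ⟨t0 p f κ ^ (-n).toNat, _, rfl⟩), Subtype.ext ?_⟩
      · have h1 := tpow_mul_mem_hat (m := (-n).toNat) hn
        refine (perfFiltration p f k).hat_anti ?_ h1
        have := Int.self_le_toNat (-n)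
        omega
      · change (x : (perfFiltration p f k).Completion) * (t0 p f κ ^ (-n).toNat : intPlus p f κ) =
          tpow p f k (-n).toNat * x
        rw [mul_comm, tpow_nat, Subring.coe_pow]
        rfl
    · intro x y h
      refine ⟨1, ?_⟩
      have h1 : x = y := Subtype.ext
        (congrArg (fun z : intSubring p f κ => (z : (perfFiltration p f k).Completion)) h)
      rw [h1]
  exact IsLocalization.isNoetherianRing (Submonoid.powers (t0 p f κ)) _ h0

end PerfCompletion
end MvIwasawa
end

noncomputable section
namespace MvIwasawa

/-! ### Flatness of `A_∞` over the ring of elements with integral exponents -/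

/-- A variant of `IsPowComplete.flat` in which the elements have to be decomposed only
modulo `t`. -/
theorem IsPowComplete.flat_of_relations {R M : Type*} [CommRing R] [AddCommGroup M] [Module R M]
    {t : R} [IsNoetherianRing R] (hM : IsPowComplete t M)
    (htor : ∀ x : M, t • x = 0 → x = 0)
    (h1 : ∀ (l : ℕ) (g : Fin l → R) (y : Fin l → M) (z : M), ∑ i, g i • y i = t • z →
      ∃ (ι : Type) (_ : Fintype ι) (a : Fin l → ι → R) (w : ι → M),
        (∀ i, ∃ y', y i = ∑ j, a i j • w j + t • y') ∧ ∀ j, ∃ c, ∑ i, g i * a i j = t * c) :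
    Module.Flat R M := by
  classical
  refine hM.flat htor fun l g y z hz => ?_
  obtain ⟨ι, _, a, w, ha, hc⟩ := h1 l g y z hz
  choose y' hy' using ha
  let e : ι ⊕ Fin l ≃ Fin (Fintype.card (ι ⊕ Fin l)) := Fintype.equivFin _
  let a' : Fin l → ι ⊕ Fin l → R := fun i => Sum.elim (a i) fun i' => if i = i' then t else 0
  refine ⟨_, fun i j => a' i (e.symm j), fun j => Sum.elim w y' (e.symm j), fun i => ?_,
    fun j => ?_⟩
  · rw [e.symm.sum_comp (fun j => a' i j • Sum.elim w y' j), Fintype.sum_sum_type, hy' i]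
    simp [a']
  · change ∃ c, ∑ i, g i * a' i (e.symm j) = t * c
    rcases e.symm j with j' | i'
    · exact hc j'
    · refine ⟨g i', ?_⟩
      simp [a', mul_comm]

namespace PerfCompletion

open Filter Topology

variable {p f : ℕ} {k : Type*} [Field k]

open Classical in
theorem exists_proj (y : (perfFiltration p f k).Completion) :
    ∃ x : (perfFiltration p f k).Completion, ∀ a,
      cf x a = if a ∈ (intExp p f).range then cf y a else 0 := by
  refine exists_cf_eq _ fun n => (finite_cf y n).subset fun a ha => ⟨ha.1, fun h => ha.2 ?_⟩
  rw [h, ite_self]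

/-- The projection of `A_∞` onto the ring of elements with integral exponents. -/
def proj (y : (perfFiltration p f k).Completion) : (perfFiltration p f k).Completion :=
  (exists_proj y).choose

open Classical in
theorem cf_proj (y : (perfFiltration p f k).Completion) (a : Fin f → invPow p) :
    cf (proj y) a = if a ∈ (intExp p f).range then cf y a else 0 :=
  (exists_proj y).choose_spec a

theorem proj_sub (x y : (perfFiltration p f k).Completion) : proj (x - y) = proj x - proj y := by
  refine ext_cf fun a => ?_
  simp only [cf_sub, cf_proj]
  split_ifs <;> simp

theorem proj_add (x y : (perfFiltration p f k).Completion) : proj (x + y) = proj x + proj y := by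
  refine ext_cf fun a => ?_
  simp only [cf_add, cf_proj]
  split_ifs <;> simp

theorem proj_zero : proj (0 : (perfFiltration p f k).Completion) = 0 := by
  simpa using proj_sub (0 : (perfFiltration p f k).Completion) 0

theorem proj_sum {ι : Type*} (s : Finset ι) (x : ι → (perfFiltration p f k).Completion) :
    proj (∑ i ∈ s, x i) = ∑ i ∈ s, proj (x i) := by
  classical
  induction s using Finset.induction_on with
  | empty => simp [proj_zero]
  | insert i s hi ih => rw [Finset.sum_insert hi, Finset.sum_insert hi, proj_add, ih]

theorem proj_mem_hat {n : ℤ} {y : (perfFiltration p f k).Completion}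
    (hy : y ∈ (perfFiltration p f k).hat n) : proj y ∈ (perfFiltration p f k).hat n := by
  rw [mem_hat_iff] at hy ⊢
  intro a ha
  rw [cf_proj, hy a ha, ite_self]

theorem proj_mem (y : (perfFiltration p f k).Completion) :
    proj y ∈ intSubring p f (⊤ : Subfield k) := by
  classical
  rw [mem_intSubring_iff_cf]
  refine fun a => ⟨trivial, fun h => ?_⟩
  rw [cf_proj] at h
  by_contra h'
  exact h (if_neg h')

theorem proj_eq_self {κ : Subfield k} {y : (perfFiltration p f k).Completion}
    (hy : y ∈ intSubring p f κ) : proj y = y := by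
  classical
  refine ext_cf fun a => ?_
  rw [cf_proj]
  split_ifs with h
  · rfl
  · by_contra h'
    exact h (((mem_intSubring_iff_cf.1 hy) a).2 (Ne.symm h'))

/-- The projection onto the elements with integral exponents is linear over them, since
multiplication by an integral exponent preserves the classes of exponents modulo integers. -/
theorem proj_mul {κ : Subfield k} {d : (perfFiltration p f k).Completion}
    (hd : d ∈ intSubring p f κ) (y : (perfFiltration p f k).Completion) :
    proj (d * y) = d * proj y := by
  classical
  have h1 : ∀ z, proj (laurent p f κ z * y) = laurent p f κ z * proj y := by
    intro z
    induction z using AddMonoidAlgebra.induction_linear with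
    | zero => simp [proj_zero]
    | add u v hu hv => rw [map_add, add_mul, proj_add, hu, hv, add_mul]
    | single b u =>
      rw [laurent_single]
      refine ext_cf fun a => ?_
      rw [cf_proj, cf_of_single_mul, cf_of_single_mul, cf_proj]
      have : a - intExp p f b ∈ (intExp p f).range ↔ a ∈ (intExp p f).range :=
        ⟨fun h => by simpa using add_mem h ⟨b, rfl⟩, fun h => sub_mem h ⟨b, rfl⟩⟩
      simp only [this, mul_ite, mul_zero]
  rw [← sub_eq_zero]
  refine (perfFiltration p f k).eq_zero_of_forall_mem_hat fun n => ?_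
  obtain ⟨m, hm⟩ := (perfFiltration p f k).exists_mem_hat y
  obtain ⟨z, hz⟩ := mem_intSubring.1 hd (n - m)
  have h2 := (perfFiltration p f k).mul_mem_hat hz hm
  have h3 := (perfFiltration p f k).mul_mem_hat hz (proj_mem_hat hm)
  have h4 := sub_mem (proj_mem_hat h2) h3
  rw [sub_mul, proj_sub, h1, sub_mul, sub_sub_sub_cancel_right, sub_add_cancel] at h4
  exact h4

/-- Dividing an element of nonnegative degree by a monomial of degree less than `1` and projecting
to integral exponents yields an element of nonnegative degree, as integral exponents have
integral degree. -/
theorem proj_mon_neg_mem {r : Fin f → invPow p} (hr : totalDegree p f r < 1)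
    {y : (perfFiltration p f k).Completion} (hy : y ∈ (perfFiltration p f k).hat 0) :
    proj (mon p f k (-r) * y) ∈ intPlus p f (⊤ : Subfield k) := by
  classical
  refine mem_intPlus.2 ⟨proj_mem _, mem_hat_iff.2 fun a ha => ?_⟩
  rw [cf_proj, cf_mon_mul]
  split_ifs with h
  · refine mem_hat_iff.1 hy _ ?_
    obtain ⟨b, rfl⟩ := h
    rw [totalDegree_intExp] at ha
    rw [sub_neg_eq_add, map_add, totalDegree_intExp]
    have h1 : ∑ i, b i < 0 := by exact_mod_cast ha
    have h2 : ∑ i, b i ≤ -1 := by omega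
    have h3 : ((∑ i, b i : ℤ) : ℚ) ≤ ((-1 : ℤ) : ℚ) := Int.cast_le.2 h2
    push_cast at h3 ⊢
    linarith
  · rfl

instance algebraPlus (κ : Subfield k) : Algebra (intPlus p f κ) (plus p f k) :=
  (Subring.inclusion inf_le_right).toAlgebra

theorem sum_mul_proj {l : ℕ} {κ : Subfield k} {g y : Fin l → (perfFiltration p f k).Completion}
    {t z : (perfFiltration p f k).Completion} (hg : ∀ i, g i ∈ intSubring p f κ)
    (ht : t ∈ intSubring p f κ) (h : ∑ i, g i * y i = t * z) (r : Fin f → invPow p) :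
    ∑ i, g i * proj (mon p f k (-r) * y i) = t * proj (mon p f k (-r) * z) := by
  have h1 : ∀ i, g i * proj (mon p f k (-r) * y i) = proj (mon p f k (-r) * (g i * y i)) := by
    intro i
    rw [← proj_mul (hg i), mul_left_comm]
  simp only [h1]
  rw [← proj_sum, ← Finset.mul_sum, h, ← proj_mul ht, mul_left_comm]

theorem coe_sum_smul_plus {ι : Type*} (s : Finset ι) {κ : Subfield k} (d : ι → intPlus p f κ)
    (y : ι → plus p f k) :
    ((∑ i ∈ s, d i • y i : plus p f k) : (perfFiltration p f k).Completion) =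
      ∑ i ∈ s, (d i : (perfFiltration p f k).Completion) * y i := by
  rw [AddSubmonoidClass.coe_finsetSum]
  rfl

theorem coe_sum_mul_intPlus {ι : Type*} (s : Finset ι) {κ : Subfield k} (d e : ι → intPlus p f κ) :
    ((∑ i ∈ s, d i * e i : intPlus p f κ) : (perfFiltration p f k).Completion) =
      ∑ i ∈ s, (d i : (perfFiltration p f k).Completion) * e i := by
  rw [AddSubmonoidClass.coe_finsetSum]
  rfl

variable [NeZero f]

/-- The representative with degree in `[0, 1)` of an exponent modulo integral exponents. -/
def rep (b : Fin f → invPow p) : Fin f → invPow p :=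
  (QuotientAddGroup.mk b : (Fin f → invPow p) ⧸ (intExp p f).range).out -
    intExp p f (⌊totalDegree p f
      (QuotientAddGroup.mk b : (Fin f → invPow p) ⧸ (intExp p f).range).out⌋ • e0 f)

theorem rep_eq {a b : Fin f → invPow p} (h : a - b ∈ (intExp p f).range) : rep a = rep b := by
  have : (QuotientAddGroup.mk a : (Fin f → invPow p) ⧸ (intExp p f).range) =
      QuotientAddGroup.mk b := by
    rw [QuotientAddGroup.eq, ← neg_mem_iff]
    simpa [sub_eq_add_neg, add_comm] using h
  rw [rep, rep, this]

theorem sub_rep_mem (b : Fin f → invPow p) : b - rep b ∈ (intExp p f).range := by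
  rw [rep, sub_sub_eq_add_sub, add_sub_right_comm]
  refine add_mem ?_ ⟨_, rfl⟩
  have h := Quotient.out_eq' (QuotientAddGroup.mk b : (Fin f → invPow p) ⧸ (intExp p f).range)
  have h2 := QuotientAddGroup.eq.1 h
  rwa [neg_add_eq_sub] at h2

theorem rep_rep (b : Fin f → invPow p) : rep (rep b) = rep b := by
  refine rep_eq ?_
  rw [← neg_mem_iff, neg_sub]
  exact sub_rep_mem b

theorem totalDegree_rep_nonneg (b : Fin f → invPow p) : 0 ≤ totalDegree p f (rep b) := by
  rw [rep, map_sub, totalDegree_e0, sub_nonneg]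
  exact Int.floor_le _

theorem totalDegree_rep_lt (b : Fin f → invPow p) : totalDegree p f (rep b) < 1 := by
  rw [rep, map_sub, totalDegree_e0, sub_lt_iff_lt_add']
  exact Int.lt_floor_add_one (totalDegree p f _)

theorem isPowComplete_plus (κ : Subfield k) : IsPowComplete (t0 p f κ) (plus p f k) := by
  refine isPowComplete_of_isClosed ⊤ isClosed_univ (fun _ => trivial) _ _ _
    (plus p f k).subtype.toAddMonoidHom Subtype.val_injective (fun x => ?_) fun x => rfl
  constructor
  · rintro ⟨y, rfl⟩
    exact ⟨trivial, y.2⟩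
  · exact fun h => ⟨⟨x, h.2⟩, rfl⟩

/-- An element of `A_∞` is the sum of its components for the classes of exponents modulo integral
exponents, up to terms of degree at least `1`. -/
theorem sub_sum_proj_mem_hat {s : Finset (Fin f → invPow p)} (hs : ∀ r ∈ s, rep r = r)
    {y : (perfFiltration p f k).Completion}
    (hy : ∀ a, totalDegree p f a < (1 : ℤ) → cf y a ≠ 0 → rep a ∈ s) :
    y - ∑ r : s, proj (mon p f k (-r) * y) * mon p f k r ∈ (perfFiltration p f k).hat 1 := by
  classical
  rw [mem_hat_iff]
  intro a ha
  rw [cf_sub, cf_sum]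
  have h1 : ∀ r : s, cf (proj (mon p f k (-r) * y) * mon p f k r) a =
      if rep a = r then cf y a else 0 := by
    intro r
    rw [mul_comm, cf_mon_mul, cf_proj, cf_mon_mul, sub_neg_eq_add, sub_add_cancel]
    refine if_congr ⟨fun h => ?_, fun h => ?_⟩ rfl rfl
    · rw [rep_eq h, hs _ r.2]
    · rw [← h]
      exact sub_rep_mem a
  simp only [h1]
  rw [Finset.sum_coe_sort s (fun r => if rep a = r then cf y a else 0), Finset.sum_ite_eq]
  split_ifs with h
  · exact sub_self _
  · rw [sub_zero]
    by_contra h2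
    exact h (hy a ha h2)

theorem t0_smul_eq_zero {κ : Subfield k} {x : plus p f k} (hx : t0 p f κ • x = 0) : x = 0 := by
  have h1 : tpow p f k 1 * (x : (perfFiltration p f k).Completion) = 0 := congrArg Subtype.val hx
  have h2 := tpow_neg_mul_cancel (-1) (x : (perfFiltration p f k).Completion)
  rw [neg_neg, h1, mul_zero] at h2
  exact Subtype.ext h2.symm

theorem exists_t0_smul_of_mem_hat_one {κ : Subfield k} {x : plus p f k}
    (hx : (x : (perfFiltration p f k).Completion) ∈ (perfFiltration p f k).hat 1) :
    ∃ z, x = t0 p f κ • z := by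
  have h1 : tpow p f k (-1) * (x : (perfFiltration p f k).Completion) ∈ plus p f k := by
    rw [mem_plus]
    simpa using tpow_mul_mem_hat (m := -1) hx
  exact ⟨⟨_, h1⟩, Subtype.ext (tpow_neg_mul_cancel 1 _).symm⟩

/-- The elements of `A_∞` of nonnegative degree are flat over those with integral exponents.
Modulo `T_0` only finitely many classes of exponents modulo integral ones occur in given elements,
and a linear relation holds if and only if it holds on each of these classes, where it is a
relation between elements with integral exponents. -/
theorem flat_plus : Module.Flat (intPlus p f (⊤ : Subfield k)) (plus p f k) := by
  classical
  have := isNoetherianRing_intPlus (p := p) (f := f) (⊤ : Subfield k)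
  refine IsPowComplete.flat_of_relations (isPowComplete_plus ⊤) (fun x => t0_smul_eq_zero)
    fun l g y z hz => ?_
  let s : Finset (Fin f → invPow p) := (Finset.univ.biUnion fun i =>
    (finite_cf (y i : (perfFiltration p f k).Completion) 1).toFinset).image rep
  have hs : ∀ r ∈ s, 0 ≤ totalDegree p f r ∧ totalDegree p f r < 1 ∧ rep r = r := by
    intro r hr
    obtain ⟨b, -, rfl⟩ := Finset.mem_image.1 hr
    exact ⟨totalDegree_rep_nonneg b, totalDegree_rep_lt b, rep_rep b⟩
  have hw : ∀ r : s, mon p f k (r : Fin f → invPow p) ∈ plus p f k := fun r =>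
    mon_mem_hat (m := 0) (by simpa using (hs _ r.2).1)
  have ha : ∀ (y : plus p f k) (r : s),
      proj (mon p f k (-(r : Fin f → invPow p)) * (y : (perfFiltration p f k).Completion)) ∈
        intPlus p f (⊤ : Subfield k) := fun y r =>
    proj_mon_neg_mem (hs _ r.2).2.1 y.2
  refine ⟨s, inferInstance, fun i r => ⟨_, ha (y i) r⟩, fun r => ⟨_, hw r⟩,
    fun i => ?_, fun r => ⟨⟨_, ha z r⟩, Subtype.ext ?_⟩⟩
  · have key := sub_sum_proj_mem_hat (s := s) (fun r hr => (hs r hr).2.2)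
      (y := (y i : (perfFiltration p f k).Completion)) fun a h1 h2 => Finset.mem_image_of_mem _
        (Finset.mem_biUnion.2 ⟨i, Finset.mem_univ _, (finite_cf _ 1).mem_toFinset.2 ⟨h1, h2⟩⟩)
    obtain ⟨y', hy'⟩ := exists_t0_smul_of_mem_hat_one (κ := (⊤ : Subfield k))
      (x := y i - ∑ r : s, (⟨_, ha (y i) r⟩ : intPlus p f (⊤ : Subfield k)) •
        (⟨_, hw r⟩ : plus p f k)) (by
      rw [AddSubgroupClass.coe_sub, coe_sum_smul_plus]
      exact key)
    exact ⟨y', by rw [← hy', add_sub_cancel]⟩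
  · rw [coe_sum_mul_intPlus]
    have h2 := congrArg Subtype.val hz
    rw [coe_sum_smul_plus] at h2
    exact sum_mul_proj (fun i => (g i).2.1) (t0 p f (⊤ : Subfield k)).2.1 h2 r

/-- Linear relations in `A_∞` with coefficients in the ring of elements with integral exponents
are trivial. -/
theorem trivial_relation {l : ℕ} {g y : Fin l → (perfFiltration p f k).Completion}
    (hg : ∀ i, g i ∈ intSubring p f (⊤ : Subfield k)) (h : ∑ i, g i * y i = 0) :
    ∃ (m : ℕ) (a : Fin l → Fin m → (perfFiltration p f k).Completion)
      (w : Fin m → (perfFiltration p f k).Completion),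
      (∀ i j, a i j ∈ intSubring p f (⊤ : Subfield k)) ∧
      (∀ i, y i = ∑ j, a i j * w j) ∧ ∀ j, ∑ i, g i * a i j = 0 := by
  classical
  have hbound : ∀ y : Fin l → (perfFiltration p f k).Completion, ∃ n : ℤ, ∀ i,
      tpow p f k n * y i ∈ (perfFiltration p f k).hat 0 := by
    intro y
    choose n hn using fun i => (perfFiltration p f k).exists_mem_hat (y i)
    refine ⟨∑ i, |n i|, fun i => ?_⟩
    refine (perfFiltration p f k).hat_anti ?_ (tpow_mul_mem_hat (hn i))
    have h1 : |n i| ≤ ∑ i, |n i| :=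
      Finset.single_le_sum (f := fun i => |n i|) (fun i _ => abs_nonneg _) (Finset.mem_univ i)
    have h2 := neg_abs_le (n i)
    linarith
  obtain ⟨n, hn⟩ := hbound g
  obtain ⟨n', hn'⟩ := hbound y
  have := flat_plus (p := p) (f := f) (k := k)
  have hrel := Module.Flat.iff_forall_isTrivialRelation.1 this
    (f := fun i => (⟨tpow p f k n * g i, mul_mem (tpow_mem _ _) (hg i), hn i⟩ :
      intPlus p f (⊤ : Subfield k)))
    (x := fun i => (⟨tpow p f k n' * y i, hn' i⟩ : plus p f k)) (by
      refine Subtype.ext ?_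
      rw [coe_sum_smul_plus]
      change ∑ i, (tpow p f k n * g i) * (tpow p f k n' * y i) = 0
      rw [Finset.sum_congr rfl fun i _ => mul_mul_mul_comm (tpow p f k n) (g i) _ (y i)]
      rw [← Finset.mul_sum, h, mul_zero])
  obtain ⟨m, a, w, h1, h2⟩ := hrel
  refine ⟨m, fun i j => a i j, fun j => tpow p f k (-n') * w j, fun i j => (a i j).2.1,
    fun i => ?_, fun j => ?_⟩
  · have h3 := congrArg Subtype.val (h1 i)
    rw [coe_sum_smul_plus] at h3
    change tpow p f k n' * y i = _ at h3
    change y i = ∑ j, (a i j : (perfFiltration p f k).Completion) * (tpow p f k (-n') * w j)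
    rw [Finset.sum_congr rfl fun j _ => mul_left_comm _ (tpow p f k (-n')) _]
    rw [← Finset.mul_sum, ← h3, ← mul_assoc, ← tpow_add, neg_add_cancel, tpow_zero, one_mul]
  · have h3 := congrArg Subtype.val (h2 j)
    rw [coe_sum_mul_intPlus] at h3
    change ∑ i, tpow p f k n * g i * (a i j : (perfFiltration p f k).Completion) = 0 at h3
    rw [Finset.sum_congr rfl fun i _ => mul_assoc (tpow p f k n) (g i) _] at h3
    rw [← Finset.mul_sum] at h3
    have h4 := tpow_neg_mul_cancel (-n) (∑ i, g i * (a i j : (perfFiltration p f k).Completion))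
    rw [neg_neg, h3] at h4
    rw [← h4]
    exact mul_zero _

end PerfCompletion
end MvIwasawa
end

noncomputable section
namespace MvIwasawa

/-! ### Group algebras over finite fields -/

section FiniteField

variable {p f : ℕ} [Fact p.Prime] {κ : Type*} [Field κ] [Fintype κ] [DecidableEq κ] [CharP κ p]

theorem pow_sub_one_dvd_iff {i : ℕ} (hi : i < f) : p ^ f - 1 ∣ p ^ i - 1 ↔ i = 0 := by
  have hp := (Fact.out : p.Prime).one_lt
  have h1 : p ^ i < p ^ f := Nat.pow_lt_pow_right hp hi
  have h2 : 0 < p ^ i := pow_pos (by omega) _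
  constructor
  · intro h
    by_contra h0
    have h3 : 1 < p ^ i := Nat.one_lt_pow h0 hp
    have := Nat.le_of_dvd (by omega) h
    omega
  · rintro rfl
    simp

/-- An additive map on `𝔽_q` is recovered from its components `∑_ζ ζ^{-p^i} h(ζ)` for the
characters `ζ ↦ ζ^{p^i}`. -/
theorem sum_pow_smul_sum {V : Type*} [AddCommGroup V] [Module κ V]
    (hκ : Fintype.card κ = p ^ f) (h : κ →+ V) (μ : κ) :
    ∑ i : Fin f, μ ^ p ^ (i : ℕ) • ∑ ζ : κˣ, ((ζ⁻¹ : κˣ) : κ) ^ p ^ (i : ℕ) • h ζ = -h μ := by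
  have hp := (Fact.out : p.Prime)
  by_cases hμ : μ = 0
  · subst hμ
    rw [map_zero, neg_zero]
    refine Finset.sum_eq_zero fun i _ => ?_
    rw [zero_pow (pow_ne_zero _ hp.ne_zero), zero_smul]
  let u : κˣ := Units.mk0 μ hμ
  -- the trace takes values in the prime field
  have htr : ∀ x : κ, ∃ m : ℕ, ∑ i : Fin f, x ^ p ^ (i : ℕ) = m := by
    intro x
    let : Algebra (ZMod p) κ := ZMod.algebra κ p
    have hr : Module.finrank (ZMod p) κ = f := by
      have h1 := Module.card_eq_pow_finrank (K := ZMod p) (V := κ)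
      rw [hκ, ZMod.card] at h1
      exact (Nat.pow_right_injective hp.two_le h1).symm
    have h2 := FiniteField.algebraMap_trace_eq_sum_pow (ZMod p) κ x
    rw [hr, Nat.card_zmod, Finset.sum_range] at h2
    refine ⟨(Algebra.trace (ZMod p) κ x).val, ?_⟩
    rw [← h2]
    conv_lhs => rw [← ZMod.natCast_zmod_val (Algebra.trace (ZMod p) κ x)]
    rw [map_natCast]
  have h1 : ∀ ζ : κˣ, (∑ i : Fin f, (μ * ((ζ⁻¹ : κˣ) : κ)) ^ p ^ (i : ℕ)) • h ζ =
      h ((∑ i : Fin f, (μ * ((ζ⁻¹ : κˣ) : κ)) ^ p ^ (i : ℕ)) * ζ) := by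
    intro ζ
    obtain ⟨m, hm⟩ := htr (μ * ((ζ⁻¹ : κˣ) : κ))
    rw [hm, Nat.cast_smul_eq_nsmul, ← map_nsmul, nsmul_eq_mul]
  simp only [Finset.smul_sum, smul_smul, ← mul_pow]
  rw [Finset.sum_comm]
  simp only [← Finset.sum_smul, h1]
  rw [← map_sum, ← map_neg]
  congr 1
  rw [← (Equiv.divLeft u).sum_comp]
  have h2 : ∀ x : κˣ, (∑ i : Fin f, (μ * (((Equiv.divLeft u x)⁻¹ : κˣ) : κ)) ^ p ^ (i : ℕ)) *
      ((Equiv.divLeft u x : κˣ) : κ) = μ * ∑ i : Fin f, (x : κ) ^ (p ^ (i : ℕ) - 1) := by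
    intro x
    have h3 : μ * (((Equiv.divLeft u x)⁻¹ : κˣ) : κ) = x := by
      simp only [Equiv.divLeft_apply, inv_div, Units.val_div_eq_div_val, u, Units.val_mk0]
      field_simp
    have h4 : ((Equiv.divLeft u x : κˣ) : κ) = μ * (x : κ)⁻¹ := by
      simp [Equiv.divLeft_apply, u, div_eq_mul_inv]
    rw [h3, h4, mul_left_comm, Finset.sum_mul]
    congr 1
    refine Finset.sum_congr rfl fun i _ => ?_
    have h5 : p ^ (i : ℕ) = p ^ (i : ℕ) - 1 + 1 :=
      (Nat.sub_add_cancel (Nat.one_le_pow _ _ hp.pos)).symm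
    conv_lhs => rw [h5, pow_succ]
    field_simp
  rw [Finset.sum_congr rfl fun x _ => h2 x, ← Finset.mul_sum, Finset.sum_comm]
  have h6 : ∀ i : Fin f, ∑ x : κˣ, (x : κ) ^ (p ^ (i : ℕ) - 1) =
      if (i : ℕ) = 0 then -1 else 0 := by
    intro i
    have := FiniteField.sum_pow_units κ (p ^ (i : ℕ) - 1)
    rw [hκ] at this
    rw [this]
    exact if_congr (pow_sub_one_dvd_iff i.2) rfl rfl
  have hf : 0 < f := by
    rcases Nat.eq_zero_or_pos f with rfl | h
    · have := Fintype.one_lt_card (α := κ)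
      rw [hκ, pow_zero] at this
      exact absurd this (lt_irrefl _)
    · exact h
  rw [Finset.sum_congr rfl fun i _ => h6 i, Finset.sum_eq_single ⟨0, hf⟩]
  · simp
  · intro i _ hi
    rw [if_neg]
    exact fun h => hi (Fin.ext h)
  · simp

/-- The powers sums `∑_ζ ζ^{-p^i}` vanish for `q ≠ 2`. -/
theorem sum_inv_pow_eq_zero (hκ : Fintype.card κ = p ^ f) (hq : p ^ f ≠ 2) (i : Fin f) :
    ∑ ζ : κˣ, ((ζ⁻¹ : κˣ) : κ) ^ p ^ (i : ℕ) = 0 := by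
  rw [← Equiv.sum_comp (Equiv.inv κˣ) fun ζ : κˣ => ((ζ⁻¹ : κˣ) : κ) ^ p ^ (i : ℕ)]
  simp only [Equiv.inv_apply, inv_inv]
  have := FiniteField.sum_pow_units κ (p ^ (i : ℕ))
  rw [hκ] at this
  rw [this, if_neg]
  have hp := (Fact.out : p.Prime).two_le
  have h1 : p ^ (i : ℕ) * p ≤ p ^ f := by
    rw [← pow_succ]
    exact Nat.pow_le_pow_right (by omega) i.2
  have h2 : 0 < p ^ (i : ℕ) := pow_pos (by omega) _
  have h4 : p ^ (i : ℕ) * 2 ≤ p ^ (i : ℕ) * p := Nat.mul_le_mul_left _ hp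
  intro h
  have h3 := Nat.le_of_dvd h2 h
  -- now `p ^ i = 1` and `q = 2`
  omega

variable {G : Type*} [AddCommGroup G]

/-- The augmentation ideal of a group algebra. -/
def augIdeal (κ G : Type*) [Field κ] [AddCommGroup G] : Ideal (AddMonoidAlgebra κ G) :=
  Ideal.span (Set.range fun g : G => AddMonoidAlgebra.single g 1 - 1)

theorem single_sub_one_mem (g : G) : AddMonoidAlgebra.single g 1 - 1 ∈ augIdeal κ G :=
  Ideal.subset_span ⟨g, rfl⟩

theorem exists_sub_algebraMap_mem (x : AddMonoidAlgebra κ G) :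
    ∃ c : κ, x - algebraMap κ _ c ∈ augIdeal κ G := by
  induction x using AddMonoidAlgebra.induction_linear with
  | zero => exact ⟨0, by simp⟩
  | add x y hx hy =>
    obtain ⟨c, hc⟩ := hx
    obtain ⟨d, hd⟩ := hy
    refine ⟨c + d, ?_⟩
    rw [map_add, add_sub_add_comm]
    exact add_mem hc hd
  | single g u =>
    refine ⟨u, ?_⟩
    have h : AddMonoidAlgebra.single g u - algebraMap κ (AddMonoidAlgebra κ G) u =
        algebraMap κ (AddMonoidAlgebra κ G) u * (AddMonoidAlgebra.single g 1 - 1) := by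
      rw [mul_sub, mul_one, AddMonoidAlgebra.coe_algebraMap]
      simp [AddMonoidAlgebra.single_mul_single]
    rw [h]
    exact Ideal.mul_mem_left _ _ (single_sub_one_mem g)

instance charPGroupAlgebra : CharP (AddMonoidAlgebra κ G) p :=
  charP_of_injective_algebraMap (algebraMap κ (AddMonoidAlgebra κ G)).injective p

theorem single_sub_one_pow {n : ℕ} (hn : ∀ g : G, p ^ n • g = 0) (g : G) :
    (AddMonoidAlgebra.single g 1 - 1 : AddMonoidAlgebra κ G) ^ p ^ n = 0 := by
  rw [sub_pow_char_pow, AddMonoidAlgebra.single_pow, hn, one_pow, one_pow,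
    AddMonoidAlgebra.one_def, sub_self]

theorem augIdeal_le_nilradical {n : ℕ} (hn : ∀ g : G, p ^ n • g = 0) :
    augIdeal κ G ≤ nilradical (AddMonoidAlgebra κ G) := by
  rw [augIdeal, Ideal.span_le]
  rintro _ ⟨g, rfl⟩
  exact ⟨p ^ n, single_sub_one_pow hn g⟩

/-- Modulo the square of the augmentation ideal, `g ↦ [g] - 1` is additive, and it depends only
on the class of `g` modulo `p`. -/
theorem exists_additive (r : G →+ κ) (hr : Function.Surjective r)
    (hker : ∀ g, r g = 0 → ∃ g', g = p • g') :
    ∃ h : κ →+ AddMonoidAlgebra κ G ⧸ augIdeal κ G ^ 2, ∀ g,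
      h (r g) = Ideal.Quotient.mk _ (AddMonoidAlgebra.single g 1 - 1) := by
  let h0 : G →+ AddMonoidAlgebra κ G ⧸ augIdeal κ G ^ 2 :=
    { toFun := fun g => Ideal.Quotient.mk _ (AddMonoidAlgebra.single g 1 - 1)
      map_zero' := by
        rw [← AddMonoidAlgebra.one_def, sub_self, map_zero]
      map_add' := by
        intro g g'
        rw [← map_add, Ideal.Quotient.mk_eq_mk_iff_sub_mem, pow_two]
        have := Ideal.mul_mem_mul (single_sub_one_mem (κ := κ) g) (single_sub_one_mem (κ := κ) g')
        convert this using 1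
        have h1 : (AddMonoidAlgebra.single (g + g') 1 : AddMonoidAlgebra κ G) =
            AddMonoidAlgebra.single g 1 * AddMonoidAlgebra.single g' 1 := by
          rw [AddMonoidAlgebra.single_mul_single, one_mul]
        rw [h1]
        ring }
  have hk : r.ker ≤ h0.ker := by
    intro g hg
    obtain ⟨g', rfl⟩ := hker g hg
    rw [AddMonoidHom.mem_ker, map_nsmul, nsmul_eq_mul]
    have : ((p : ℕ) : AddMonoidAlgebra κ G ⧸ augIdeal κ G ^ 2) = 0 := by
      rw [← map_natCast (Ideal.Quotient.mk (augIdeal κ G ^ 2)), CharP.cast_eq_zero, map_zero]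
    rw [this, zero_mul]
  refine ⟨r.liftOfSurjective hr ⟨h0, hk⟩, fun g => ?_⟩
  exact AddMonoidHom.liftOfRightInverse_comp_apply r _ _ ⟨h0, hk⟩ g

variable [Finite G]

/-- The monomials in given elements with exponents in a box. -/
def boxMap {R : Type*} [CommRing R] [Algebra κ R] (t : Fin f → R) (N : ℕ) :
    ((Fin f → Fin N) → κ) →ₗ[κ] R :=
  Fintype.linearCombination κ fun a => ∏ i, t i ^ (a i : ℕ)

omit [Fintype κ] in
theorem aeval_eq_boxMap {R : Type*} [CommRing R] [Algebra κ R] {t : Fin f → R} {N : ℕ}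
    (ht : ∀ i, t i ^ N = 0) (P : MvPolynomial (Fin f) κ) :
    MvPolynomial.aeval t P =
      boxMap t N fun a => P.coeff (Finsupp.equivFunOnFinite.symm fun i => (a i : ℕ)) := by
  classical
  induction P using MvPolynomial.induction_on' with
  | add P Q hP hQ =>
    rw [map_add, hP, hQ, ← map_add]
    congr 1
  | monomial a u =>
    rw [MvPolynomial.aeval_monomial, boxMap, Fintype.linearCombination_apply]
    simp only [MvPolynomial.coeff_monomial, ite_smul, zero_smul]
    rw [Finsupp.prod_fintype _ _ (fun i => pow_zero _), ← Algebra.smul_def]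
    by_cases h : ∀ i, a i < N
    · rw [Finset.sum_eq_single fun i => ⟨a i, h i⟩]
      · rw [if_pos]
        ext i
        simp
      · intro b _ hb
        rw [if_neg]
        rintro rfl
        exact hb (by ext i; simp)
      · simp
    · push Not at h
      obtain ⟨i, hi⟩ := h
      rw [Finset.prod_eq_zero (Finset.mem_univ i), smul_zero, Finset.sum_eq_zero]
      · intro b _
        rw [if_neg]
        rintro rfl
        simp only [Finsupp.equivFunOnFinite_symm_apply_apply] at hi
        exact absurd (b i).2 (not_lt.2 hi)
      · exact pow_eq_zero_of_le hi (ht i)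

variable (hκ : Fintype.card κ = p ^ f) {n : ℕ} (hn : ∀ g : G, p ^ n • g = 0)
  (r : G →+ κ) (hr : Function.Surjective r) (hker : ∀ g, r g = 0 → ∃ g', g = p • g')
  {t : Fin f → AddMonoidAlgebra κ G} {τ : κˣ → G} (hτ : ∀ ζ, r (τ ζ) = ζ)
  (ht : ∀ i, t i = ∑ ζ : κˣ, (((ζ⁻¹ : κˣ) : κ) ^ p ^ (i : ℕ)) •
    (AddMonoidAlgebra.single (τ ζ) 1 - 1))

include hn ht in
omit [Finite G] in
theorem pow_eq_zero_of_sum (i : Fin f) : t i ^ p ^ n = 0 := by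
  rw [ht, sum_pow_char_pow]
  refine Finset.sum_eq_zero fun ζ _ => ?_
  rw [smul_pow, single_sub_one_pow hn, smul_zero]

include hκ hn hr hker hτ ht in
/-- The twisted sums `t i` generate the augmentation ideal `I`: by Nakayama's lemma it is enough to
show this modulo `I ^ 2`, where `[g] - 1` is additive in `g` and thus a combination of its
components for the characters `ζ ↦ ζ ^ p ^ i`. -/
theorem augIdeal_eq_span : augIdeal κ G = Ideal.span (Set.range t) := by
  have hfin : Module.Finite κ (AddMonoidAlgebra κ G) := inferInstance
  have hN : IsNoetherianRing (AddMonoidAlgebra κ G) := IsNoetherianRing.of_finite κ _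
  refine le_antisymm ?_ ?_
  · refine Submodule.le_of_le_smul_of_le_jacobson_bot (I := augIdeal κ G) (hN.noetherian _)
      ((augIdeal_le_nilradical hn).trans (Ideal.radical_le_jacobson (I := ⊥))) ?_
    rw [augIdeal, Ideal.span_le]
    rintro _ ⟨g, rfl⟩
    obtain ⟨h, hh⟩ := exists_additive (p := p) r hr hker
    have h1 := sum_pow_smul_sum hκ h (r g)
    have h2 : ∀ i : Fin f, ∑ ζ : κˣ, ((ζ⁻¹ : κˣ) : κ) ^ p ^ (i : ℕ) • h ζ =
        Ideal.Quotient.mk _ (t i) := by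
      intro i
      rw [ht, map_sum]
      refine Finset.sum_congr rfl fun ζ _ => ?_
      rw [← hτ ζ, hh]
      rfl
    simp only [h2] at h1
    rw [hh] at h1
    have h3 : Ideal.Quotient.mk (augIdeal κ G ^ 2) (AddMonoidAlgebra.single g 1 - 1 +
        ∑ i : Fin f, r g ^ p ^ (i : ℕ) • t i) = 0 := by
      rw [map_add, map_sum, ← neg_eq_iff_add_eq_zero, ← h1]
      rfl
    rw [Ideal.Quotient.eq_zero_iff_mem, pow_two] at h3
    have h4 : ∑ i : Fin f, r g ^ p ^ (i : ℕ) • t i ∈ Ideal.span (Set.range t) := by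
      refine sum_mem fun i _ => ?_
      rw [Algebra.smul_def]
      exact Ideal.mul_mem_left _ _ (Ideal.subset_span ⟨i, rfl⟩)
    have h5 := sub_mem (Ideal.mem_sup_right (S := Ideal.span (Set.range t)) h3)
      (Ideal.mem_sup_left (T := augIdeal κ G * augIdeal κ G) h4)
    rw [add_sub_cancel_right] at h5
    exact h5
  · rw [Ideal.span_le]
    rintro _ ⟨i, rfl⟩
    rw [ht]
    refine sum_mem fun ζ _ => ?_
    rw [Algebra.smul_def]
    exact Ideal.mul_mem_left _ _ (single_sub_one_mem _)

include hκ hn hr hker hτ ht in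
/-- The `t i` generate the group algebra, because they generate the nilpotent augmentation ideal. -/
theorem surjective_aeval : Function.Surjective (MvPolynomial.aeval (R := κ) t) := by
  have hfin : Module.Finite κ (AddMonoidAlgebra κ G) := inferInstance
  have hN : IsNoetherianRing (AddMonoidAlgebra κ G) := IsNoetherianRing.of_finite κ _
  have hI := augIdeal_eq_span hκ hn r hr hker hτ ht
  obtain ⟨m, hm⟩ := Ideal.exists_pow_le_of_le_radical_of_fg
    (augIdeal_le_nilradical (κ := κ) hn) (hN.noetherian _)
  intro x
  obtain ⟨y, hy, hxy⟩ := exists_mem_adjoin_sub_mem_pow (t := t) (A := κ) (fun x => by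
    rw [← hI]
    exact exists_sub_algebraMap_mem x) m x
  rw [← hI] at hxy
  have h1 := hm hxy
  rw [Ideal.zero_eq_bot, Ideal.mem_bot, sub_eq_zero] at h1
  rw [Algebra.adjoin_range_eq_range_aeval] at hy
  obtain ⟨P, hP⟩ := hy
  exact ⟨P, hP.trans h1.symm⟩

include hκ hn hr hker hτ ht in
/-- The monomials in the `t i` with exponents less than `p ^ n` are linearly independent, since
they generate the group algebra and their number is its dimension. -/
theorem coeff_eq_zero_of_aeval_eq_zero (hG : Nat.card G = (p ^ n) ^ f)
    {P : MvPolynomial (Fin f) κ} (hP : MvPolynomial.aeval t P = 0) (a : Fin f →₀ ℕ)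
    (ha : ∀ i, a i < p ^ n) : P.coeff a = 0 := by
  have hfin : Module.Finite κ (AddMonoidAlgebra κ G) := inferInstance
  have h0 := pow_eq_zero_of_sum hn ht
  have hs : Function.Surjective (boxMap (κ := κ) t (p ^ n)) := by
    intro y
    obtain ⟨P, rfl⟩ := surjective_aeval hκ hn r hr hker hτ ht y
    exact ⟨_, (aeval_eq_boxMap h0 P).symm⟩
  have hd : Module.finrank κ ((Fin f → Fin (p ^ n)) → κ) =
      Module.finrank κ (AddMonoidAlgebra κ G) := by
    have : Fintype G := Fintype.ofFinite G
    rw [Module.finrank_fintype_fun_eq_card,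
      (AddMonoidAlgebra.coeffLinearEquiv κ).finrank_eq,
      Module.finrank_finsupp_self, ← Nat.card_eq_fintype_card (α := G), hG]
    simp
  have hi := (LinearMap.injective_iff_surjective_of_finrank_eq_finrank hd).2 hs
  rw [aeval_eq_boxMap h0] at hP
  have h1 := congrFun (hi (hP.trans (map_zero _).symm)) fun i => ⟨a i, ha i⟩
  have h2 : (Finsupp.equivFunOnFinite.symm fun i => a i) = a := by
    ext i
    simp
  simp only [h2] at h1
  exact h1

end FiniteField
end MvIwasawa
end

noncomputable section
namespace MvIwasawa

/-! ### Products of complete modules -/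

section Complete

variable {R : Type*} [CommRing R] {t : R} {M N : Type*} [AddCommGroup M] [Module R M]
  [AddCommGroup N] [Module R N]

theorem IsPowComplete.exists_limit (hM : IsPowComplete t M) (s : ℕ → M)
    (hs : ∀ n, ∃ z, s (n + 1) - s n = t ^ n • z) : ∃ l, ∀ n, ∃ z, l - s n = t ^ n • z := by
  choose m hm using hs
  obtain ⟨l, hl⟩ := hM.prec m
  refine ⟨s 0 + l, fun n => ?_⟩
  obtain ⟨z, hz⟩ := hl n
  refine ⟨z, ?_⟩
  have h1 : ∑ k ∈ Finset.range n, t ^ k • m k = s n - s 0 := by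
    rw [← Finset.sum_range_sub]
    exact Finset.sum_congr rfl fun k _ => (hm k).symm
  rw [hz, h1]
  abel

theorem IsPowComplete.pi (hR : IsPowComplete t R) (ι : Type*) : IsPowComplete t (ι → R) := by
  constructor
  · intro x hx
    ext i
    refine hR.haus _ fun n => ?_
    obtain ⟨z, rfl⟩ := hx n
    exact ⟨z i, rfl⟩
  · intro m
    choose s hs using fun i => hR.prec fun n => m n i
    choose z hz using hs
    refine ⟨s, fun n => ⟨fun i => z i n, ?_⟩⟩
    ext i
    rw [hz i n]
    simp

theorem IsPowComplete.of_equiv (hM : IsPowComplete t M) (e : M ≃ₗ[R] N) : IsPowComplete t N := by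
  constructor
  · intro x hx
    have : e.symm x = 0 := hM.haus _ fun n => by
      obtain ⟨z, rfl⟩ := hx n
      exact ⟨e.symm z, map_smul _ _ _⟩
    simpa using this
  · intro m
    obtain ⟨s, hs⟩ := hM.prec fun n => e.symm (m n)
    refine ⟨e s, fun n => ?_⟩
    obtain ⟨z, hz⟩ := hs n
    exact ⟨e z, by rw [hz]; simp⟩

end Complete

/-! ### Unramified rings and Teichmüller representatives -/

/-- A reduction map `ρ : O → κ` of a complete unramified ring with residue field `κ = 𝔽_q`,
`q = p ^ f`. -/
structure IsUnramifiedReduction (p f : ℕ) {O κ : Type*} [CommRing O] [Field κ] [Fintype κ]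
    (ρ : O →+* κ) : Prop where
  complete : IsAdicComplete (Ideal.span {(p : O)}) O
  ne_zero : (p : O) ≠ 0
  surjective : Function.Surjective ρ
  map_eq_zero : ∀ x, ρ x = 0 → ∃ y, x = p * y
  card : Fintype.card κ = p ^ f
  charP : CharP κ p

section Unramified

variable {p f : ℕ} [Fact p.Prime] {O κ : Type*} [CommRing O] [IsDomain O] [Field κ] [Fintype κ]
  [DecidableEq κ] {ρ : O →+* κ} (hρ : IsUnramifiedReduction p f ρ)

include hρ

namespace IsUnramifiedReduction

theorem isPowComplete : IsPowComplete (p : O) O := by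
  have := hρ.complete
  exact isPowComplete_of_isAdicComplete _ _

theorem map_p : ρ p = 0 := by
  have := hρ.charP
  rw [map_natCast, CharP.cast_eq_zero]

theorem map_eq_zero_iff (x : O) : ρ x = 0 ↔ x ∈ Ideal.span {(p : O)} := by
  rw [Ideal.mem_span_singleton]
  constructor
  · exact hρ.map_eq_zero x
  · rintro ⟨y, rfl⟩
    rw [map_mul, hρ.map_p, zero_mul]

theorem mul_left_cancel_pow {n : ℕ} {x : O} (h : (p : O) ^ n * x = 0) : x = 0 :=
  (mul_eq_zero.1 h).resolve_left (pow_ne_zero _ hρ.ne_zero)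

theorem ne_zero_f : f ≠ 0 := by
  rintro rfl
  have := hρ.card
  have := Fintype.one_lt_card (α := κ)
  rw [hρ.card, pow_zero] at this
  exact absurd this (lt_irrefl _)

theorem two_le_card : 2 ≤ p ^ f := by
  rw [← hρ.card]
  exact Fintype.one_lt_card

theorem isUnit_iff (x : O) : IsUnit x ↔ ρ x ≠ 0 := by
  refine ⟨fun h => (h.map ρ).ne_zero, fun h => ?_⟩
  have := hρ.complete
  obtain ⟨y, hy⟩ := hρ.surjective (ρ x)⁻¹
  have h1 : ρ (1 - x * y) = 0 := by
    rw [map_sub, map_one, map_mul, hy, mul_inv_cancel₀ h, sub_self]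
  have h2 := IsAdicComplete.le_jacobson_bot (Ideal.span {(p : O)}) ((hρ.map_eq_zero_iff _).1 h1)
  have h3 := Ideal.mem_jacobson_bot.1 h2 (-1)
  have h4 : (1 - x * y) * -1 + 1 = x * y := by ring
  rw [h4] at h3
  exact isUnit_of_mul_isUnit_left h3

/-- The roots of unity of order dividing `q - 1` reduce bijectively to `𝔽_q^×`. -/
theorem bijective_rootsOfUnity : Function.Bijective
    ((Units.map (ρ : O →* κ)).comp (rootsOfUnity (p ^ f - 1) O).subtype) := by
  have hq := hρ.two_le_card
  have hcomp := hρ.complete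
  have hchar := hρ.charP
  have hq0 : ((p ^ f - 1 : ℕ) : κ) = -1 := by
    rw [Nat.cast_sub (by omega), Nat.cast_pow, CharP.cast_eq_zero, zero_pow hρ.ne_zero_f,
      Nat.cast_one, zero_sub]
  constructor
  · rw [injective_iff_map_eq_one]
    intro ζ hζ
    have h1 : ρ ((ζ : Oˣ) : O) = 1 := congrArg Units.val hζ
    have h2 : (((ζ : Oˣ) : O)) ^ (p ^ f - 1) = 1 := by
      have := ζ.2
      rw [mem_rootsOfUnity] at this
      exact congrArg Units.val this
    have h3 := geom_sum_mul ((ζ : Oˣ) : O) (p ^ f - 1)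
    rw [h2, sub_self] at h3
    have h4 : ∑ i ∈ Finset.range (p ^ f - 1), ((ζ : Oˣ) : O) ^ i ≠ 0 := by
      intro h
      have := congrArg ρ h
      rw [map_sum] at this
      simp only [map_pow, h1, one_pow, Finset.sum_const, Finset.card_range, nsmul_eq_mul,
        mul_one, map_zero, hq0] at this
      exact neg_ne_zero.2 one_ne_zero this
    have h5 := (mul_eq_zero.1 h3).resolve_left h4
    exact Subtype.ext (Units.ext (sub_eq_zero.1 h5))
  · intro u
    obtain ⟨x, hx⟩ := hρ.surjective u
    have hH : HenselianRing O (Ideal.span {(p : O)}) := inferInstance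
    have hu : (u : κ) ^ (p ^ f - 1) = 1 := by
      rw [← hρ.card]
      exact FiniteField.pow_card_sub_one_eq_one _ u.ne_zero
    obtain ⟨a, ha, hax⟩ := hH.is_henselian (Polynomial.X ^ (p ^ f - 1) - 1)
      (Polynomial.monic_X_pow_sub_C 1 (by omega)) x (by
        rw [← hρ.map_eq_zero_iff]
        simp [hx, hu]) (by
        refine IsUnit.map _ ((hρ.isUnit_iff _).2 ?_)
        rw [Polynomial.derivative_sub, Polynomial.derivative_X_pow, Polynomial.derivative_one,
          sub_zero, Polynomial.eval_mul, Polynomial.eval_C, Polynomial.eval_pow,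
          Polynomial.eval_X, map_mul, map_natCast, hq0, map_pow, hx]
        exact mul_ne_zero (neg_ne_zero.2 one_ne_zero) (pow_ne_zero _ u.ne_zero))
    have ha' : a ^ (p ^ f - 1) = 1 := by
      have : a ^ (p ^ f - 1) - 1 = 0 := by simpa [Polynomial.IsRoot] using ha
      exact sub_eq_zero.1 this
    have hρa : ρ a = u := by
      rw [← hρ.map_eq_zero_iff, map_sub, sub_eq_zero] at hax
      rw [hax, hx]
    refine ⟨⟨Units.ofPowEqOne a (p ^ f - 1) ha' (by omega), ?_⟩, Units.ext hρa⟩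
    rw [mem_rootsOfUnity]
    exact Units.ext ha'

/-- The Teichmüller lift. -/
def teich : κˣ ≃* rootsOfUnity (p ^ f - 1) O :=
  (MulEquiv.ofBijective _ hρ.bijective_rootsOfUnity).symm

theorem map_teich (ζ : κˣ) : ρ ((hρ.teich ζ : Oˣ) : O) = ζ :=
  congrArg Units.val ((MulEquiv.ofBijective _ hρ.bijective_rootsOfUnity).apply_symm_apply ζ)

/-- The sum of a nontrivial character of the group of Teichmüller representatives vanishes, so that
`T_i` is also the sum of the `[λ]^{-p^i} ([[λ]] - 1)`; for `q = 2` the character is trivial. -/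
theorem sum_teich_eq_zero (hq : p ^ f ≠ 2) (i : Fin f) :
    ∑ ζ : κˣ, (((hρ.teich ζ : Oˣ)⁻¹ ^ p ^ (i : ℕ) : Oˣ) : O) = 0 := by
  have hchar := hρ.charP
  let χ : κˣ →* O := (Units.coeHom O).comp ((powMonoidHom (p ^ (i : ℕ))).comp
    (invMonoidHom.comp ((rootsOfUnity (p ^ f - 1) O).subtype.comp (hρ.teich : κˣ →* _))))
  have hχ : ∀ ζ, ρ (χ ζ) = ((ζ⁻¹ : κˣ) : κ) ^ p ^ (i : ℕ) := by
    intro ζ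
    change ρ (((hρ.teich ζ : Oˣ)⁻¹ ^ p ^ (i : ℕ) : Oˣ) : O) = _
    rw [Units.val_pow_eq_pow_val, map_pow]
    congr 1
    have h1 := hρ.map_teich ζ⁻¹
    rw [map_inv] at h1
    exact h1
  refine sum_hom_units_eq_zero χ fun h => ?_
  have h1 := sum_inv_pow_eq_zero hρ.card hq i
  simp only [← hχ, h, MonoidHom.one_apply, map_one] at h1
  have h2 := FiniteField.sum_pow_units κ 0
  simp only [pow_zero, dvd_zero, if_true] at h2
  rw [h2] at h1
  exact neg_ne_zero.2 one_ne_zero h1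

/-- The element `T_i` in terms of the elements `[ζ] - 1` of the augmentation ideal. -/
theorem T_eq (i : Fin f) : T p O f i = ∑ ζ : κˣ,
    (((hρ.teich ζ : Oˣ)⁻¹ ^ p ^ (i : ℕ) : Oˣ) : O) •
      (groupElt p O ((hρ.teich ζ : Oˣ) : O) - 1) := by
  rw [T]
  split_ifs with hq
  · have h1 : Fintype.card κˣ = 1 := by
      rw [Fintype.card_units, hρ.card, hq]
    obtain ⟨x, hx⟩ := Fintype.card_eq_one_iff.1 h1
    rw [Fintype.sum_eq_single (1 : κˣ) fun y hy => absurd ((hx y).trans (hx 1).symm) hy, map_one]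
    simp
  · simp only [smul_sub, Finset.sum_sub_distrib]
    rw [← Finset.sum_smul, hρ.sum_teich_eq_zero hq, zero_smul, sub_zero,
      ← finsum_eq_sum_of_fintype]
    exact (finsum_comp_equiv hρ.teich.toEquiv).symm

end IsUnramifiedReduction

end Unramified
end MvIwasawa
end

noncomputable section
namespace MvIwasawa

/-! ### The Iwasawa algebra modulo `p` -/

section LayerReduction

variable {p f : ℕ} {O κ : Type*} [CommRing O] [Field κ] {ρ : O →+* κ}

/-- The projection of the Iwasawa algebra to a layer. -/
def evalLayer (p : ℕ) (O : Type*) [CommRing O] (n : ℕ) : Iwasawa p O →ₐ[O] LayerAlgebra p O n :=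
  (Pi.evalAlgHom O _ n).comp (iwasawaSubalgebra p O).val

theorem evalLayer_groupElt (n : ℕ) (a : O) : evalLayer p O n (groupElt p O a) =
    AddMonoidAlgebra.single (Ideal.Quotient.mk _ a) 1 := rfl

theorem layerTransition_evalLayer (n : ℕ) (x : Iwasawa p O) :
    layerTransition p O n (evalLayer p O (n + 1) x) = evalLayer p O n x := x.2 n

theorem evalLayer_ext {x y : Iwasawa p O} (h : ∀ n, evalLayer p O n x = evalLayer p O n y) :
    x = y := Subtype.ext (funext h)

theorem exists_evalLayer_eq (x : ∀ n, LayerAlgebra p O n)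
    (hx : ∀ n, layerTransition p O n (x (n + 1)) = x n) :
    ∃ y : Iwasawa p O, ∀ n, evalLayer p O n y = x n :=
  ⟨⟨x, hx⟩, fun _ => rfl⟩

/-- Reduction of coefficients. -/
def redLayer (p : ℕ) (ρ : O →+* κ) (n : ℕ) :
    LayerAlgebra p O n →+* AddMonoidAlgebra κ (Layer p O n) :=
  AddMonoidAlgebra.mapRingHom _ ρ

/-- The transition maps between group algebras over the residue field. -/
def transκ (p : ℕ) (O κ : Type*) [CommRing O] [Field κ] (n : ℕ) :
    AddMonoidAlgebra κ (Layer p O (n + 1)) →ₐ[κ] AddMonoidAlgebra κ (Layer p O n) :=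
  AddMonoidAlgebra.mapDomainAlgHom κ κ (layerRed p O n).toAddMonoidHom

theorem transκ_redLayer (n : ℕ) (x : LayerAlgebra p O (n + 1)) :
    transκ p O κ n (redLayer p ρ (n + 1) x) = redLayer p ρ n (layerTransition p O n x) := by
  have : (transκ p O κ n).toRingHom.comp (redLayer p ρ (n + 1)) =
      (redLayer p ρ n).comp (layerTransition p O n).toRingHom := by
    refine AddMonoidAlgebra.ringHom_ext (fun r => ?_) fun a => ?_
    · simp [transκ, redLayer, layerTransition]
    · simp [transκ, redLayer, layerTransition]
  exact congrArg (· x) this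

theorem layer_nsmul (n : ℕ) (g : Layer p O n) : p ^ n • g = 0 := by
  obtain ⟨x, rfl⟩ := Ideal.Quotient.mk_surjective g
  rw [← map_nsmul, Ideal.Quotient.eq_zero_iff_mem, nsmul_eq_mul, Nat.cast_pow]
  exact Ideal.mul_mem_right _ _ (Ideal.pow_mem_pow (Ideal.mem_span_singleton_self _) n)

variable [Fact p.Prime] [IsDomain O] [Fintype κ] [DecidableEq κ]
  (hρ : IsUnramifiedReduction p f ρ)

namespace IsUnramifiedReduction

include hρ

/-- The `n`-th layer `O / p ^ n` has `q ^ n` elements. -/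
theorem card_layer (n : ℕ) : Nat.card (Layer p O n) = (p ^ n) ^ f := by
  have h1 : ∀ n, (Ideal.span {(p : O)} ^ (n + 1)).toAddSubgroup =
      (Ideal.span {(p : O)} ^ n).toAddSubgroup.map (AddMonoidHom.mulLeft (p : O)) := by
    intro n
    ext x
    simp only [Ideal.span_singleton_pow, Submodule.mem_toAddSubgroup, AddSubgroup.mem_map,
      Ideal.mem_span_singleton, AddMonoidHom.coe_mulLeft]
    constructor
    · rintro ⟨y, rfl⟩
      exact ⟨_, ⟨y, rfl⟩, by ring⟩
    · rintro ⟨_, ⟨y, rfl⟩, rfl⟩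
      exact ⟨y, by ring⟩
  have hinj : Function.Injective (AddMonoidHom.mulLeft (p : O)) := fun x y h =>
    mul_left_cancel₀ hρ.ne_zero h
  have h2 : (AddMonoidHom.mulLeft (p : O)).range.index = p ^ f := by
    have h3 : (AddMonoidHom.mulLeft (p : O)).range = ρ.toAddMonoidHom.ker := by
      ext x
      constructor
      · rintro ⟨y, rfl⟩
        change ρ (p * y) = 0
        rw [map_mul, hρ.map_p, zero_mul]
      · intro h
        obtain ⟨y, rfl⟩ := hρ.map_eq_zero x h
        exact ⟨y, rfl⟩
    rw [h3, AddSubgroup.index_ker, AddMonoidHom.range_eq_top.2 hρ.surjective, ← hρ.card]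
    simp
  have h3 : ∀ n, (Ideal.span {(p : O)} ^ n).toAddSubgroup.index = (p ^ n) ^ f := by
    intro n
    induction n with
    | zero =>
      rw [pow_zero, pow_zero, one_pow, Ideal.one_eq_top]
      exact AddSubgroup.index_top
    | succ n ih =>
      rw [h1, AddSubgroup.index_map_of_injective _ hinj, ih, h2, ← mul_pow, pow_succ]
  exact h3 n

theorem finite_layer (n : ℕ) : Finite (Layer p O n) := by
  refine Nat.finite_of_card_ne_zero ?_
  rw [hρ.card_layer]
  exact pow_ne_zero _ (pow_ne_zero _ (Fact.out : p.Prime).ne_zero)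

/-- The reduction of a layer to the residue field. -/
theorem exists_layer_hom {n : ℕ} (hn : n ≠ 0) : ∃ r : Layer p O n →+ κ,
    (∀ x, r (Ideal.Quotient.mk _ x) = ρ x) ∧ Function.Surjective r ∧
      ∀ g, r g = 0 → ∃ g', g = p • g' := by
  let r : Layer p O n →+* κ := Ideal.Quotient.lift _ ρ fun x hx =>
    (hρ.map_eq_zero_iff x).2 (Ideal.pow_le_self hn hx)
  refine ⟨r.toAddMonoidHom, fun x => rfl, fun y => ?_, fun g hg => ?_⟩
  · obtain ⟨x, rfl⟩ := hρ.surjective y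
    exact ⟨Ideal.Quotient.mk _ x, rfl⟩
  · obtain ⟨x, rfl⟩ := Ideal.Quotient.mk_surjective g
    obtain ⟨y, rfl⟩ := hρ.map_eq_zero x hg
    refine ⟨Ideal.Quotient.mk _ y, ?_⟩
    rw [← map_nsmul, nsmul_eq_mul]

theorem redLayer_eq_zero {n : ℕ} {x : LayerAlgebra p O n} (hx : redLayer p ρ n x = 0) :
    ∃ y, x = (p : O) • y := by
  classical
  have h : ∀ a, ∃ y, x.coeff a = p * y := by
    intro a
    refine hρ.map_eq_zero _ ?_
    have := congrArg (fun z => z.coeff a) hx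
    simpa [redLayer] using this
  choose y hy using h
  refine ⟨∑ a ∈ x.coeff.support, AddMonoidAlgebra.single a (y a), ?_⟩
  refine AddMonoidAlgebra.coeff_injective (Finsupp.ext fun a => ?_)
  rw [AddMonoidAlgebra.coeff_smul, Finsupp.smul_apply, AddMonoidAlgebra.coeff_sum,
    Finsupp.finsetSum_apply]
  simp only [AddMonoidAlgebra.coeff_single, Finsupp.single_apply, Finset.sum_ite_eq']
  split_ifs with ha
  · rw [hy, smul_eq_mul]
  · rw [Finsupp.notMem_support_iff.1 ha, smul_zero]

theorem redLayer_smul_p {n : ℕ} (y : LayerAlgebra p O n) : redLayer p ρ n ((p : O) • y) = 0 := by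
  rw [Algebra.smul_def, map_mul]
  have : redLayer p ρ n (algebraMap O _ (p : O)) = 0 := by
    have h1 : algebraMap O (LayerAlgebra p O n) (p : O) = AddMonoidAlgebra.single 0 (p : O) := rfl
    rw [h1, redLayer, AddMonoidAlgebra.mapRingHom_single, hρ.map_p, AddMonoidAlgebra.single_zero]
  rw [this, zero_mul]

/-- The reduction of `T_i` in a layer. -/
def tLayer (p : ℕ) (ρ : O →+* κ) (n f : ℕ) (i : Fin f) : AddMonoidAlgebra κ (Layer p O n) :=
  redLayer p ρ n (evalLayer p O n (T p O f i))

theorem tLayer_eq (n : ℕ) (i : Fin f) : tLayer p ρ n f i = ∑ ζ : κˣ,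
    (((ζ⁻¹ : κˣ) : κ) ^ p ^ (i : ℕ)) •
      (AddMonoidAlgebra.single (Ideal.Quotient.mk _ ((hρ.teich ζ : Oˣ) : O)) 1 - 1) := by
  rw [tLayer, hρ.T_eq, map_sum, map_sum]
  refine Finset.sum_congr rfl fun ζ _ => ?_
  rw [map_smul, Algebra.smul_def, map_mul, Algebra.smul_def]
  congr 1
  · have h1 : ρ (((hρ.teich ζ : Oˣ)⁻¹ ^ p ^ (i : ℕ) : Oˣ) : O) =
        ((ζ⁻¹ : κˣ) : κ) ^ p ^ (i : ℕ) := by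
      rw [Units.val_pow_eq_pow_val, map_pow]
      congr 1
      have h1 := hρ.map_teich ζ⁻¹
      rw [map_inv] at h1
      exact h1
    rw [← h1]
    simp [redLayer, AddMonoidAlgebra.coe_algebraMap]
  · rw [map_sub, map_sub, map_one, map_one, evalLayer_groupElt]
    simp [redLayer]

theorem tLayer_pow (n : ℕ) (i : Fin f) : tLayer p ρ n f i ^ p ^ n = 0 := by
  have := hρ.charP
  exact pow_eq_zero_of_sum (layer_nsmul n) (hρ.tLayer_eq n) i

/-- The images of the `T_i` generate the group algebra of the `n`-th layer over the residue field.
-/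
theorem surjective_aeval_tLayer {n : ℕ} (hn : n ≠ 0) :
    Function.Surjective (MvPolynomial.aeval (R := κ) (tLayer p ρ n f)) := by
  have := hρ.charP
  have := hρ.finite_layer n
  obtain ⟨r, hr, hs, hk⟩ := hρ.exists_layer_hom hn
  exact surjective_aeval hρ.card (layer_nsmul n) r hs hk
    (fun ζ => (hr _).trans (hρ.map_teich ζ)) (hρ.tLayer_eq n)

theorem coeff_eq_zero_of_aeval_tLayer {n : ℕ} (hn : n ≠ 0) {P : MvPolynomial (Fin f) κ}
    (hP : MvPolynomial.aeval (tLayer p ρ n f) P = 0) (a : Fin f →₀ ℕ) (ha : ∀ i, a i < p ^ n) :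
    P.coeff a = 0 := by
  have := hρ.charP
  have := hρ.finite_layer n
  obtain ⟨r, hr, hs, hk⟩ := hρ.exists_layer_hom hn
  exact coeff_eq_zero_of_aeval_eq_zero hρ.card (layer_nsmul n) r hs hk
    (fun ζ => (hr _).trans (hρ.map_teich ζ)) (hρ.tLayer_eq n) (hρ.card_layer n) hP a ha

omit hρ in
theorem redLayer_aeval (n : ℕ) (P : MvPolynomial (Fin f) O) :
    redLayer p ρ n (evalLayer p O n (MvPolynomial.aeval (T p O f) P)) =
      MvPolynomial.aeval (tLayer p ρ n f) (MvPolynomial.map ρ P) := by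
  have : ((redLayer p ρ n).comp (evalLayer p O n).toRingHom).comp
      (MvPolynomial.aeval (R := O) (T p O f)).toRingHom =
      (MvPolynomial.aeval (R := κ) (tLayer p ρ n f)).toRingHom.comp (MvPolynomial.map ρ) := by
    refine MvPolynomial.ringHom_ext (fun r => ?_) fun i => ?_
    · simp [redLayer, AddMonoidAlgebra.coe_algebraMap]
    · simp [tLayer]
  exact congrArg (· P) this

/-! ### The Iwasawa algebra as a ring of power series -/

theorem isPowComplete_layer (n : ℕ) : IsPowComplete (p : O) (LayerAlgebra p O n) := by
  have := hρ.finite_layer n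
  exact (hρ.isPowComplete.pi (Layer p O n)).of_equiv
    ((AddMonoidAlgebra.coeffLinearEquiv O).trans
      (Finsupp.linearEquivFunOnFinite O O (Layer p O n))).symm

theorem smul_eq_zero_layer {n : ℕ} {x : LayerAlgebra p O n} {m : ℕ} (hx : (p : O) ^ m • x = 0) :
    x = 0 := by
  refine AddMonoidAlgebra.coeff_injective (Finsupp.ext fun a => ?_)
  have := congrArg (fun z => z.coeff a) hx
  exact hρ.mul_left_cancel_pow this

/-- The Iwasawa algebra is `p`-torsion free. -/
theorem smul_eq_zero {x : Iwasawa p O} {m : ℕ} (hx : (p : O) ^ m • x = 0) : x = 0 := by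
  refine evalLayer_ext fun n => ?_
  rw [map_zero]
  refine hρ.smul_eq_zero_layer (m := m) ?_
  rw [← map_smul, hx, map_zero]

theorem exists_smul_iff {x : Iwasawa p O} {m : ℕ} :
    (∃ y, x = (p : O) ^ m • y) ↔ ∀ n, ∃ y, evalLayer p O n x = (p : O) ^ m • y := by
  constructor
  · rintro ⟨y, rfl⟩ n
    exact ⟨evalLayer p O n y, map_smul _ _ _⟩
  · intro h
    choose y hy using h
    obtain ⟨z, hz⟩ := exists_evalLayer_eq y fun n => by
      rw [← sub_eq_zero]
      refine hρ.smul_eq_zero_layer (m := m) ?_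
      rw [smul_sub, ← map_smul, ← hy, ← hy, layerTransition_evalLayer, sub_self]
    refine ⟨z, evalLayer_ext fun n => ?_⟩
    rw [map_smul, hz, hy]

/-- The Iwasawa algebra is `p`-adically complete, each group algebra `O[O / p ^ n]` being so. -/
theorem isPowComplete_iwasawa : IsPowComplete (p : O) (Iwasawa p O) := by
  constructor
  · intro x hx
    refine evalLayer_ext fun n => ?_
    rw [map_zero]
    refine (hρ.isPowComplete_layer n).haus _ fun m => ?_
    exact hρ.exists_smul_iff.1 (hx m) n
  · intro m
    choose s hs using fun n => (hρ.isPowComplete_layer n).prec fun j => evalLayer p O n (m j)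
    obtain ⟨z, hz⟩ := exists_evalLayer_eq s fun n => by
      rw [← sub_eq_zero]
      refine (hρ.isPowComplete_layer n).haus _ fun j => ?_
      obtain ⟨u, hu⟩ := hs (n + 1) j
      obtain ⟨v, hv⟩ := hs n j
      refine ⟨layerTransition p O n u - v, ?_⟩
      rw [hu, hv, map_add, map_sum, smul_sub, map_smul]
      simp only [map_smul, layerTransition_evalLayer]
      abel
    refine ⟨z, fun n => ?_⟩
    obtain ⟨w, hw⟩ := hρ.exists_smul_iff (m := n).2 fun j => by
      obtain ⟨u, hu⟩ := hs j n
      refine ⟨u, (?_ : evalLayer p O j (z - ∑ k ∈ Finset.range n, (p : O) ^ k • m k) = _)⟩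
      rw [map_sub, map_sum, hz, hu]
      simp only [map_smul]
      abel
    exact ⟨w, by rw [← hw]; abel⟩

end IsUnramifiedReduction

/-- The ideal of elements of the Iwasawa algebra whose image in the `n`-th layer is divisible
by `p ^ n`. -/
def layerIdeal (p : ℕ) (O : Type*) [CommRing O] (n : ℕ) : Ideal (Iwasawa p O) :=
  (Ideal.span {((p : O) ^ n • 1 : LayerAlgebra p O n)}).comap (evalLayer p O n)

theorem mem_layerIdeal {n : ℕ} {x : Iwasawa p O} :
    x ∈ layerIdeal p O n ↔ ∃ y, evalLayer p O n x = (p : O) ^ n • y := by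
  rw [layerIdeal, Ideal.mem_comap, Ideal.mem_span_singleton]
  simp only [Dvd.dvd, smul_mul_assoc, one_mul]

/-- The condition defining the `(n + j)`-th layer ideal implies divisibility by `p ^ (n + j)` in the
`n`-th layer. -/
theorem exists_of_mem_layerIdeal {n : ℕ} {x : Iwasawa p O} (j : ℕ) :
    (∃ y, evalLayer p O (n + j) x = (p : O) ^ (n + j) • y) →
      ∃ y, evalLayer p O n x = (p : O) ^ (n + j) • y := by
  have h : ∀ m i, (∃ y, evalLayer p O (n + i) x = (p : O) ^ m • y) →
      ∃ y, evalLayer p O n x = (p : O) ^ m • y := by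
    intro m i
    induction i with
    | zero => exact id
    | succ i ih =>
      rintro ⟨y, hy⟩
      refine ih ⟨layerTransition p O (n + i) y, ?_⟩
      rw [← layerTransition_evalLayer, ← map_smul]
      exact congrArg _ hy
  exact h _ j

namespace IsUnramifiedReduction

include hρ

theorem layerIdeal_haus {x : Iwasawa p O} (hx : ∀ n, x ∈ layerIdeal p O n) : x = 0 := by
  refine evalLayer_ext fun n => ?_
  rw [map_zero]
  refine (hρ.isPowComplete_layer n).haus _ fun m => ?_
  obtain ⟨y, hy⟩ := exists_of_mem_layerIdeal (n := n) m (mem_layerIdeal.1 (hx (n + m)))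
  exact ⟨(p : O) ^ n • y, by rw [hy, smul_smul, ← pow_add, add_comm]⟩

/-- The Iwasawa algebra is complete for the topology defined by the layer ideals. -/
theorem layerIdeal_prec (s : ℕ → Iwasawa p O) (hs : ∀ n, s (n + 1) - s n ∈ layerIdeal p O n) :
    ∃ l, ∀ n, l - s n ∈ layerIdeal p O n := by
  have h1 : ∀ n : ℕ, ∃ l, ∀ j, ∃ z,
      l - evalLayer p O n (s (n + j)) = (p : O) ^ (n + j) • z := by
    intro n
    have h2 : ∀ j, ∃ z, evalLayer p O n (s (n + j + 1)) - evalLayer p O n (s (n + j)) =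
        (p : O) ^ (n + j) • z := by
      intro j
      rw [← map_sub]
      exact exists_of_mem_layerIdeal j (mem_layerIdeal.1 (hs (n + j)))
    choose z hz using h2
    obtain ⟨l, hl⟩ := (hρ.isPowComplete_layer n).prec z
    refine ⟨evalLayer p O n (s n) + (p : O) ^ n • l, fun j => ?_⟩
    obtain ⟨w, hw⟩ := hl j
    refine ⟨w, ?_⟩
    have h3 : ∑ i ∈ Finset.range j, (p : O) ^ n • (p : O) ^ i • z i =
        evalLayer p O n (s (n + j)) - evalLayer p O n (s n) := by
      have := Finset.sum_range_sub (fun j => evalLayer p O n (s (n + j))) j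
      refine Eq.trans (Finset.sum_congr rfl fun i _ => ?_) this
      rw [smul_smul, ← pow_add]
      exact (hz i).symm
    rw [hw, smul_add, Finset.smul_sum, h3, smul_smul, ← pow_add]
    abel
  choose l hl using h1
  obtain ⟨z, hz⟩ := exists_evalLayer_eq l fun n => by
    rw [← sub_eq_zero]
    refine (hρ.isPowComplete_layer n).haus _ fun j => ?_
    obtain ⟨u, hu⟩ := hl (n + 1) j
    obtain ⟨v, hv⟩ := hl n (j + 1)
    refine ⟨(p : O) ^ (n + 1) • (layerTransition p O n u - v), ?_⟩
    have h4 : layerTransition p O n (l (n + 1)) - evalLayer p O n (s (n + 1 + j)) =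
        (p : O) ^ (n + 1 + j) • layerTransition p O n u := by
      rw [← layerTransition_evalLayer, ← map_sub, hu, map_smul]
    have h5 : n + (j + 1) = n + 1 + j := by omega
    rw [h5] at hv
    rw [smul_smul, ← pow_add, smul_sub, add_comm j, ← h4, ← hv]
    abel
  refine ⟨z, fun n => mem_layerIdeal.2 ?_⟩
  rw [map_sub, hz]
  exact hl n 0

/-- Each layer ideal contains a power of the ideal of the `T_i`, since `T_i ^ p ^ n` is divisible
by `p` in the `n`-th layer. -/
theorem exists_pow_le_layerIdeal (n : ℕ) :
    ∃ m, Ideal.span (Set.range (T p O f)) ^ m ≤ layerIdeal p O n := by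
  refine Ideal.exists_pow_le_of_le_radical_of_fg ?_ (Submodule.fg_span (Set.finite_range _))
  rw [Ideal.span_le]
  rintro _ ⟨i, rfl⟩
  refine ⟨p ^ n * n, ?_⟩
  obtain ⟨y, hy⟩ := hρ.redLayer_eq_zero (n := n)
    (x := evalLayer p O n (T p O f i ^ p ^ n)) (by
      rw [map_pow, map_pow]
      exact hρ.tLayer_pow n i)
  rw [mem_layerIdeal, pow_mul, map_pow, hy]
  exact ⟨y ^ n, smul_pow _ _ _⟩

/-- The power series ring over `O` maps isomorphically to the Iwasawa algebra, the variables
being mapped to the `T_i`. Modulo `p`, this results from the fact that the monomials in the `T_i`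
with exponents less than `p ^ n` form a basis of the group algebra of the `n`-th layer. -/
theorem exists_powerSeries_equiv : ∃ ψ : MvPowerSeries (Fin f) O →ₐ[O] Iwasawa p O,
    Function.Bijective ψ ∧ ∀ P : MvPolynomial (Fin f) O,
      ψ (P : MvPowerSeries (Fin f) O) = MvPolynomial.aeval (T p O f) P := by
  classical
  choose M hM using hρ.exists_pow_le_layerIdeal
  obtain ⟨ψ, hψ⟩ := exists_powerSeries_eval (A := O) (T p O f) (layerIdeal p O)
    (fun x => hρ.layerIdeal_haus) hρ.layerIdeal_prec M hM
  have hred : ∀ c n m, n ≠ 0 → M n ≤ m → redLayer p ρ n (evalLayer p O n (ψ c)) =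
      MvPolynomial.aeval (tLayer p ρ n f)
        (MvPolynomial.map ρ (MvPowerSeries.truncTotal m c)) := by
    intro c n m hn hm
    rw [← redLayer_aeval, ← sub_eq_zero, ← map_sub, ← map_sub]
    obtain ⟨y, hy⟩ := mem_layerIdeal.1 (hψ c n m hm)
    have h1 : (p : O) ^ n • y = (p : O) • (p : O) ^ (n - 1) • y := by
      rw [smul_smul, ← pow_succ', Nat.sub_add_cancel (Nat.one_le_iff_ne_zero.2 hn)]
    rw [hy, h1, hρ.redLayer_smul_p]
  have hinj : ∀ c x, ψ c = (p : O) • x → ∃ c', c = (p : O) • c' := by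
    intro c x hx
    have h : ∀ a, ∃ y, MvPowerSeries.coeff a c = p * y := by
      intro a
      let n := ∑ i, a i + 1
      let m := max (M n) (a.degree + 1)
      have h1 := hred c n m (Nat.succ_ne_zero _) (le_max_left _ _)
      rw [hx, map_smul, hρ.redLayer_smul_p] at h1
      have h2 := hρ.coeff_eq_zero_of_aeval_tLayer (Nat.succ_ne_zero _) h1.symm a fun i => by
        have h3 : a i ≤ ∑ i, a i :=
          Finset.single_le_sum (f := fun i => a i) (fun _ _ => Nat.zero_le _) (Finset.mem_univ i)
        have h4 := Nat.lt_pow_self (n := n) (Fact.out : p.Prime).one_lt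
        exact lt_trans (Nat.lt_succ_of_le h3) h4
      rw [MvPolynomial.coeff_map, MvPowerSeries.coeff_truncTotal _
        (lt_of_lt_of_le (Nat.lt_succ_self _) (le_max_right _ _))] at h2
      exact hρ.map_eq_zero _ h2
    choose c' hc' using h
    refine ⟨c', ?_⟩
    ext a
    exact hc' a
  have hsurj : ∀ x, ∃ c y, x = ψ c + (p : O) • y := by
    intro x
    have h : ∀ n : ℕ, ∃ P : MvPolynomial (Fin f) κ, n ≠ 0 →
        MvPolynomial.aeval (tLayer p ρ n f) P = redLayer p ρ n (evalLayer p O n x) := by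
      intro n
      by_cases hn : n = 0
      · exact ⟨0, fun h => absurd hn h⟩
      · obtain ⟨P, hP⟩ := hρ.surjective_aeval_tLayer hn (redLayer p ρ n (evalLayer p O n x))
        exact ⟨P, fun _ => hP⟩
    choose P hP using h
    -- the coefficients of these polynomials stabilize
    have hstep : ∀ n, n ≠ 0 → ∀ a : Fin f →₀ ℕ, (∀ i, a i < p ^ n) →
        (P (n + 1)).coeff a = (P n).coeff a := by
      intro n hn a ha
      rw [← sub_eq_zero, ← MvPolynomial.coeff_sub]
      refine hρ.coeff_eq_zero_of_aeval_tLayer hn ?_ a ha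
      have h1 := congrArg (transκ p O κ n) (hP (n + 1) (Nat.succ_ne_zero _))
      have h2 : (fun i => transκ p O κ n (tLayer p ρ (n + 1) f i)) = tLayer p ρ n f := by
        ext1 i
        rw [tLayer, transκ_redLayer, layerTransition_evalLayer, tLayer]
      have h3 := DFunLike.congr_fun
        (MvPolynomial.comp_aeval (tLayer p ρ (n + 1) f) (transκ p O κ n)) (P (n + 1))
      rw [AlgHom.comp_apply, h2, h1, transκ_redLayer, layerTransition_evalLayer] at h3
      rw [map_sub, hP n hn, ← h3, sub_self]
    have hchain : ∀ n, n ≠ 0 → ∀ a : Fin f →₀ ℕ, (∀ i, a i < p ^ n) → ∀ j,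
        (P (n + j)).coeff a = (P n).coeff a := by
      intro n hn a ha j
      induction j with
      | zero => rfl
      | succ j ih =>
        rw [← ih]
        refine hstep (n + j) (by omega) a fun i => (ha i).trans_le ?_
        exact Nat.pow_le_pow_right (Fact.out : p.Prime).pos (Nat.le_add_right _ _)
    obtain ⟨c, hc⟩ : ∃ c : MvPowerSeries (Fin f) O, ∀ a : Fin f →₀ ℕ,
        ρ (MvPowerSeries.coeff a c) = (P (∑ i, a i + 1)).coeff a := by
      choose c hc using fun a : Fin f →₀ ℕ => hρ.surjective ((P (∑ i, a i + 1)).coeff a)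
      exact ⟨c, hc⟩
    have hlt : ∀ a : Fin f →₀ ℕ, ∀ i, a i < p ^ (∑ i, a i + 1) := by
      intro a i
      have h3 : a i ≤ ∑ i, a i :=
        Finset.single_le_sum (f := fun i => a i) (fun _ _ => Nat.zero_le _) (Finset.mem_univ i)
      exact lt_trans (Nat.lt_succ_of_le h3) (Nat.lt_pow_self (Fact.out : p.Prime).one_lt)
    have hPc : ∀ n, n ≠ 0 → ∀ a : Fin f →₀ ℕ, (∀ i, a i < p ^ n) → 
        (P n).coeff a = ρ (MvPowerSeries.coeff a c) := by
      intro n hn a ha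
      rw [hc, ← hchain n hn a ha (∑ i, a i + 1),
        ← hchain (∑ i, a i + 1) (Nat.succ_ne_zero _) a (hlt a) n, add_comm n]
    have hψc : ∀ n, n ≠ 0 → redLayer p ρ n (evalLayer p O n (x - ψ c)) = 0 := by
      intro n hn
      rw [map_sub, map_sub, hred c n (max (M n) (f * p ^ n)) hn (le_max_left _ _), ← hP n hn,
        sub_eq_zero, aeval_eq_boxMap (fun i => hρ.tLayer_pow n i),
        aeval_eq_boxMap (fun i => hρ.tLayer_pow n i)]
      congr 1
      ext a
      have h1 : ∀ i, (Finsupp.equivFunOnFinite.symm fun i => (a i : ℕ)) i < p ^ n :=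
        fun i => (a i).2
      rw [hPc n hn _ h1, MvPolynomial.coeff_map, MvPowerSeries.coeff_truncTotal]
      · refine lt_of_lt_of_le ?_ (le_max_right _ _)
        rw [Finsupp.degree_eq_sum]
        have hf : Nonempty (Fin f) := Fin.pos_iff_nonempty.1 (Nat.pos_of_ne_zero hρ.ne_zero_f)
        have h2 := Finset.sum_lt_sum_of_nonempty Finset.univ_nonempty
          fun i (_ : i ∈ (Finset.univ : Finset (Fin f))) => h1 i
        simpa using h2
    obtain ⟨y, hy⟩ := hρ.exists_smul_iff (x := x - ψ c) (m := 1).2 fun n => by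
      rw [pow_one]
      by_cases hn : n = 0
      · subst hn
        obtain ⟨y, hy⟩ := hρ.redLayer_eq_zero (hψc 1 one_ne_zero)
        refine ⟨layerTransition p O 0 y, ?_⟩
        rw [← layerTransition_evalLayer, ← map_smul]
        exact congrArg _ hy
      · exact hρ.redLayer_eq_zero (hψc n hn)
    refine ⟨c, y, ?_⟩
    rw [pow_one] at hy
    rw [← hy, add_sub_cancel]
  have hO := hρ.isPowComplete
  have hS : IsPowComplete (p : O) (MvPowerSeries (Fin f) O) := hO.pi (Fin f →₀ ℕ)
  refine ⟨ψ, ⟨?_, ?_⟩, ?_⟩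
  · rw [injective_iff_map_eq_zero]
    intro c hc
    have h1 : ∀ n : ℕ, ∃ c', c = (p : O) ^ n • c' ∧ ψ c' = 0 := by
      intro n
      induction n with
      | zero => exact ⟨c, by simp, hc⟩
      | succ n ih =>
        obtain ⟨c', h1, h2⟩ := ih
        obtain ⟨c'', rfl⟩ := hinj c' 0 (by rw [h2, smul_zero])
        refine ⟨c'', by rw [h1, smul_smul, ← pow_succ], ?_⟩
        refine hρ.smul_eq_zero (m := 1) ?_
        rw [pow_one, ← map_smul, h2]
    exact hS.haus c fun n => (h1 n).imp fun _ h => h.1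
  · intro x
    choose c y hcy using hsurj
    let X : ℕ → Iwasawa p O := fun n => Nat.rec x (fun _ z => y z) n
    have hX : ∀ n : ℕ, x = ψ (∑ j ∈ Finset.range n, (p : O) ^ j • c (X j)) + (p : O) ^ n • X n := by
      intro n
      induction n with
      | zero => simp [X]
      | succ n ih =>
        conv_lhs => rw [ih, hcy (X n)]
        rw [Finset.sum_range_succ, map_add, map_smul, smul_add, smul_smul, ← pow_succ]
        exact (add_assoc _ _ _).symm
    obtain ⟨s, hs⟩ := hS.prec fun j => c (X j)
    refine ⟨s, ?_⟩
    rw [← sub_eq_zero]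
    refine hρ.isPowComplete_iwasawa.haus _ fun n => ?_
    obtain ⟨z, hz⟩ := hs n
    refine ⟨ψ z - X n, ?_⟩
    conv_lhs => rw [hX n, hz]
    rw [map_add, map_smul, smul_sub]
    abel
  · intro P
    rw [← sub_eq_zero]
    refine hρ.layerIdeal_haus fun n => ?_
    have h1 := hψ P n (max (M n) (P.totalDegree + 1)) (le_max_left _ _)
    rwa [(MvPowerSeries.truncTotal_coe_eq_self_iff P (by omega)).2] at h1
    exact lt_of_lt_of_le (Nat.lt_succ_self _) (le_max_right _ _)

end IsUnramifiedReduction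

end LayerReduction
end MvIwasawa
end

noncomputable section
namespace MvIwasawa

/-! ### The powers of the ideal of the variables -/

section PowerSeries

variable {σ R : Type*} [Finite σ] [CommRing R]

theorem mem_span_X_pow_of_coeff (m : ℕ) (c : MvPowerSeries σ R)
    (hc : ∀ a, a.degree < m → MvPowerSeries.coeff a c = 0) :
    c ∈ Ideal.span (Set.range (MvPowerSeries.X (σ := σ) (R := R))) ^ m := by
  classical
  have := Fintype.ofFinite σ
  induction m generalizing c with
  | zero => simp
  | succ m ih =>
    rcases isEmpty_or_nonempty σ with hσ | hσ
    · have : c = 0 := by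
        ext a
        refine hc a ?_
        have : a = 0 := Subsingleton.elim _ _
        rw [this]
        simp
      rw [this]
      exact zero_mem _
    have h0 : ∀ a : σ →₀ ℕ, a ≠ 0 → ∃ i, a i ≠ 0 := fun a ha => by
      by_contra! h
      exact ha (Finsupp.ext h)
    choose! j hj using h0
    let d : σ → MvPowerSeries σ R := fun i b =>
      if j (Finsupp.single i 1 + b) = i then MvPowerSeries.coeff (Finsupp.single i 1 + b) c else 0
    have hd : ∀ i b, MvPowerSeries.coeff b (d i) = if j (Finsupp.single i 1 + b) = i then
      MvPowerSeries.coeff (Finsupp.single i 1 + b) c else 0 := fun _ _ => rfl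
    have h1 : c = ∑ i, MvPowerSeries.X i * d i := by
      ext a
      rw [map_sum]
      have h2 : ∀ i, MvPowerSeries.coeff a (MvPowerSeries.X i * d i) =
          if a i ≠ 0 ∧ j a = i then MvPowerSeries.coeff a c else 0 := by
        intro i
        rw [MvPowerSeries.X, MvPowerSeries.coeff_monomial_mul, one_mul, hd]
        have h3 : Finsupp.single i 1 ≤ a ↔ a i ≠ 0 := by
          rw [Finsupp.single_le_iff, Nat.one_le_iff_ne_zero]
        by_cases h4 : a i ≠ 0
        · rw [if_pos (h3.2 h4), add_tsub_cancel_of_le (h3.2 h4)]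
          simp [h4]
        · rw [if_neg (fun h => h4 (h3.1 h)), if_neg (fun h => h4 h.1)]
      simp only [h2]
      by_cases ha : a = 0
      · subst ha
        simpa using hc 0 (by simp)
      · rw [Finset.sum_eq_single (j a)]
        · rw [if_pos ⟨hj a ha, rfl⟩]
        · intro i _ hi
          rw [if_neg]
          exact fun h => hi h.2.symm
        · simp
    rw [h1]
    refine sum_mem fun i _ => ?_
    rw [pow_succ']
    refine Ideal.mul_mem_mul (Ideal.subset_span ⟨i, rfl⟩) (ih _ fun b hb => ?_)
    rw [hd, hc, ite_self]
    rw [map_add, Finsupp.degree_single]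
    omega

theorem mem_span_X_pow_iff (m : ℕ) (c : MvPowerSeries σ R) :
    c ∈ Ideal.span (Set.range (MvPowerSeries.X (σ := σ) (R := R))) ^ m ↔
      ∀ a, a.degree < m → MvPowerSeries.coeff a c = 0 := by
  refine ⟨fun h => ?_, mem_span_X_pow_of_coeff m c⟩
  have key : ∀ m : ℕ, ∀ c ∈ Ideal.span (Set.range (MvPowerSeries.X (σ := σ) (R := R))) ^ m,
      (m : ℕ∞) ≤ MvPowerSeries.order c := by
    intro m
    induction m with
    | zero => simp
    | succ m ih =>
      intro c hc
      rw [pow_succ] at hc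
      refine Submodule.mul_induction_on hc (fun x hx y hy => ?_) fun x y hx hy => ?_
      · refine le_trans ?_ MvPowerSeries.le_order_mul
        rw [Nat.cast_succ]
        refine add_le_add (ih x hx) ?_
        refine MvPowerSeries.one_le_order_iff_constCoeff_eq_zero.2 ?_
        have h1 : Ideal.span (Set.range (MvPowerSeries.X (σ := σ) (R := R))) ≤
            RingHom.ker (MvPowerSeries.constantCoeff (σ := σ) (R := R)) := by
          rw [Ideal.span_le]
          rintro _ ⟨i, rfl⟩
          exact MvPowerSeries.constantCoeff_X i
        exact h1 hy
      · exact le_trans (le_min hx hy) MvPowerSeries.min_order_le_add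
  intro a ha
  exact MvPowerSeries.coeff_of_lt_order (lt_of_lt_of_le (by exact_mod_cast ha) (key m c h))

end PowerSeries

/-! ### The ideal `𝔭` of the Iwasawa algebra -/

section IdealT

variable {p f : ℕ} [Fact p.Prime] {O κ : Type*} [CommRing O] [IsDomain O] [Field κ] [Fintype κ]
  [DecidableEq κ] {ρ : O →+* κ} (hρ : IsUnramifiedReduction p f ρ)

namespace IsUnramifiedReduction

include hρ

omit [IsDomain O] [Fintype κ] [DecidableEq κ] hρ in
theorem mem_idealT_pow_iff {ψ : MvPowerSeries (Fin f) O →ₐ[O] Iwasawa p O}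
    (hψ : Function.Bijective ψ) (hψ' : ∀ P : MvPolynomial (Fin f) O,
      ψ (P : MvPowerSeries (Fin f) O) = MvPolynomial.aeval (T p O f) P)
    {m : ℕ} {c : MvPowerSeries (Fin f) O} :
    ψ c ∈ idealT p O f ^ m ↔ ∀ a, a.degree < m → MvPowerSeries.coeff a c = 0 := by
  rw [← mem_span_X_pow_iff]
  have hX : ψ ∘ MvPowerSeries.X = T p O f := by
    ext1 i
    have := hψ' (MvPolynomial.X i)
    rw [MvPolynomial.coe_X, MvPolynomial.aeval_X] at this
    exact this
  have h1 : idealT p O f ^ m = (Ideal.span (Set.range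
      (MvPowerSeries.X (σ := Fin f) (R := O))) ^ m).map ψ.toRingHom := by
    rw [Ideal.map_pow, Ideal.map_span, ← Set.range_comp, idealT]
    congr 3
    exact hX.symm
  rw [h1, Ideal.mem_map_iff_of_surjective ψ.toRingHom hψ.2]
  constructor
  · rintro ⟨d, hd, h⟩
    rwa [← hψ.1 h]
  · exact fun h => ⟨c, h, rfl⟩

/-- Multiplication by `p` does not change the `𝔭`-adic order. This is seen on power series. -/
theorem mem_idealT_pow_of_smul {y : Iwasawa p O} {m : ℕ} (hy : (p : O) • y ∈ idealT p O f ^ m) :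
    y ∈ idealT p O f ^ m := by
  obtain ⟨ψ, hψ, hψ'⟩ := hρ.exists_powerSeries_equiv
  obtain ⟨c, rfl⟩ := hψ.2 y
  rw [← map_smul, mem_idealT_pow_iff hψ hψ'] at hy
  rw [mem_idealT_pow_iff hψ hψ']
  intro a ha
  have h1 := hy a ha
  rw [MvPowerSeries.coeff_smul] at h1
  exact (mul_eq_zero.1 h1).resolve_left hρ.ne_zero

theorem exists_sub_algebraMap_mem_idealT (x : Iwasawa p O) :
    ∃ c : O, x - algebraMap O _ c ∈ idealT p O f := by
  obtain ⟨ψ, hψ, hψ'⟩ := hρ.exists_powerSeries_equiv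
  obtain ⟨c, rfl⟩ := hψ.2 x
  refine ⟨MvPowerSeries.coeff 0 c, ?_⟩
  rw [← pow_one (idealT p O f), ← AlgHom.commutes ψ, ← map_sub, mem_idealT_pow_iff hψ hψ']
  intro a ha
  have : a = 0 := by
    rw [← Finsupp.degree_eq_zero_iff]
    omega
  subst this
  simp [MvPowerSeries.algebraMap_apply]

omit hρ [IsDomain O] [Fintype κ] [DecidableEq κ] in
theorem evalLayer_zero_groupElt (a : O) : evalLayer p O 0 (groupElt p O a) = 1 := by
  rw [evalLayer_groupElt, AddMonoidAlgebra.one_def]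
  congr 1
  refine (Ideal.Quotient.eq_zero_iff_mem).2 ?_
  simp

/-- The ideal `𝔭` is the augmentation ideal. -/
theorem mem_idealT_iff {x : Iwasawa p O} : x ∈ idealT p O f ↔ evalLayer p O 0 x = 0 := by
  have h1 : idealT p O f ≤ RingHom.ker (evalLayer p O 0).toRingHom := by
    rw [idealT, Ideal.span_le]
    rintro _ ⟨i, rfl⟩
    change evalLayer p O 0 (T p O f i) = 0
    rw [hρ.T_eq, map_sum]
    refine Finset.sum_eq_zero fun ζ _ => ?_
    rw [map_smul, map_sub, map_one, evalLayer_zero_groupElt, sub_self, smul_zero]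
  refine ⟨fun h => h1 h, fun h => ?_⟩
  obtain ⟨c, hc⟩ := hρ.exists_sub_algebraMap_mem_idealT x
  have h2 : evalLayer p O 0 (x - algebraMap O _ c) = 0 := h1 hc
  rw [map_sub, h, zero_sub, neg_eq_zero, AlgHom.commutes] at h2
  have h3 : c = 0 := by
    have := congrArg (fun z => z.coeff 0) h2
    simpa [AddMonoidAlgebra.coe_algebraMap] using this
  rwa [h3, map_zero, sub_zero] at hc

omit hρ [IsDomain O] [Fintype κ] [DecidableEq κ] in
theorem evalLayer_iwasawaMul (c : O) (n : ℕ) (x : Iwasawa p O) :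
    evalLayer p O n (iwasawaMul p O c x) = AddMonoidAlgebra.mapDomainAlgHom O O
      (AddMonoidHom.mulLeft (Ideal.Quotient.mk (Ideal.span {(p : O)} ^ n) c))
      (evalLayer p O n x) := rfl

omit hρ [IsDomain O] [Fintype κ] [DecidableEq κ] in
theorem iwasawaMul_groupElt (c a : O) :
    iwasawaMul p O c (groupElt p O a) = groupElt p O (c * a) := by
  refine evalLayer_ext fun n => ?_
  rw [evalLayer_iwasawaMul, evalLayer_groupElt, evalLayer_groupElt]
  simp

/-- Multiplication by `q` on the group lifts the `q`-power map modulo `p`. -/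
theorem exists_iwasawaMul_eq (x : Iwasawa p O) :
    ∃ y, iwasawaMul p O (p ^ f) x = x ^ p ^ f + (p : O) • y := by
  have hchar := hρ.charP
  obtain ⟨y, hy⟩ := hρ.exists_smul_iff (x := iwasawaMul p O (p ^ f) x - x ^ p ^ f) (m := 1).2
    fun n => by
      rw [pow_one]
      refine hρ.redLayer_eq_zero ?_
      have h1 : (redLayer p ρ n).comp (AddMonoidAlgebra.mapDomainAlgHom O O (AddMonoidHom.mulLeft
          (Ideal.Quotient.mk (Ideal.span {(p : O)} ^ n) ((p : O) ^ f)))).toRingHom =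
          (iterateFrobenius _ p f).comp (redLayer p ρ n) := by
        refine AddMonoidAlgebra.ringHom_ext (fun r => ?_) fun a => ?_
        · have h2 : ρ r ^ p ^ f = ρ r := by
            rw [← hρ.card]
            exact FiniteField.pow_card _
          simp [redLayer, iterateFrobenius_def, AddMonoidAlgebra.single_pow, h2]
        · simp [redLayer, iterateFrobenius_def, AddMonoidAlgebra.single_pow]
      have h2 := congrArg (· (evalLayer p O n x)) h1
      rw [map_sub, map_sub, map_pow, map_pow, sub_eq_zero]
      exact h2
  exact ⟨y, by rw [pow_one] at hy; rw [← hy]; abel⟩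

/-- Multiplication by `q` on `O` maps `T_i` to `T_i ^ q` up to a multiple of `p`, which moreover
lies in `p 𝔭`: modulo `p`, the Frobenius power raises group elements to the power `q` and fixes
the coefficients. -/
theorem exists_iwasawaMul_T_eq (i : Fin f) : ∃ y ∈ idealT p O f,
    iwasawaMul p O (p ^ f) (T p O f i) = T p O f i ^ p ^ f + (p : O) • y := by
  obtain ⟨y, hy⟩ := hρ.exists_iwasawaMul_eq (T p O f i)
  refine ⟨y, ?_, hy⟩
  have h1 : (p : O) • y ∈ idealT p O f := by
    have h2 : iwasawaMul p O (p ^ f) (T p O f i) ∈ idealT p O f := by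
      rw [hρ.mem_idealT_iff, hρ.T_eq, map_sum, map_sum]
      refine Finset.sum_eq_zero fun ζ _ => ?_
      rw [map_smul, map_smul, map_sub, map_one, map_sub, map_one, iwasawaMul_groupElt,
        evalLayer_zero_groupElt, sub_self, smul_zero]
    have h3 : T p O f i ^ p ^ f ∈ idealT p O f :=
      Ideal.pow_mem_of_mem _ (Ideal.subset_span (Set.mem_range_self i)) _
        (pow_pos (Fact.out : p.Prime).pos _)
    have h4 := sub_mem h2 h3
    rwa [hy, add_sub_cancel_left] at h4
  rw [← pow_one (idealT p O f)] at h1 ⊢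
  exact hρ.mem_idealT_pow_of_smul h1

end IsUnramifiedReduction

end IdealT

/-! ### The reduction of the Iwasawa algebra to `A_∞` -/

section Reduction

open PerfCompletion

variable {p f : ℕ} [Fact p.Prime] {O k : Type*} [CommRing O] [IsDomain O] [Field k]
  {κ : Subfield k} [Fintype κ] [DecidableEq κ] {ρ : O →+* κ} (hρ : IsUnramifiedReduction p f ρ)

omit [Fact p.Prime] [Fintype κ] [DecidableEq κ] in
theorem cf_laurent_intExp (Q : AddMonoidAlgebra κ (Fin f → ℤ)) (b : Fin f → ℤ) :
    cf (laurent p f κ Q) (intExp p f b) = Q.coeff b := by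
  classical
  have hinj : Function.Injective (intExp p f) := by
    intro a b h
    ext i
    have := congrArg (fun z => ((z i : invPow p) : ℚ)) h
    simpa [intExp] using this
  induction Q using AddMonoidAlgebra.induction_linear with
  | zero => simp
  | add P Q hP hQ => rw [map_add, cf_add, hP, hQ]; rfl
  | single a u =>
    rw [laurent_single, cf_of, AddMonoidAlgebra.coeff_single, AddMonoidAlgebra.coeff_single,
      Finsupp.single_apply, Finsupp.single_apply]
    simp only [hinj.eq_iff]
    split_ifs <;> rfl

/-- Reduction of coefficients, from polynomials over `O` to Laurent polynomials. -/
def toLaurent (f : ℕ) (ρ : O →+* κ) : MvPolynomial (Fin f) O →+* AddMonoidAlgebra κ (Fin f → ℤ) :=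
  MvPolynomial.eval₂Hom ((algebraMap κ (AddMonoidAlgebra κ (Fin f → ℤ))).comp ρ)
    fun i => AddMonoidAlgebra.single (Pi.single i 1) 1

omit [IsDomain O] [Fintype κ] [DecidableEq κ] in
theorem toLaurent_monomial (a : Fin f →₀ ℕ) (u : O) : toLaurent f ρ (MvPolynomial.monomial a u) =
    AddMonoidAlgebra.single (fun i => (a i : ℤ)) (ρ u) := by
  rw [toLaurent, MvPolynomial.coe_eval₂Hom, MvPolynomial.eval₂_monomial,
    Finsupp.prod_fintype _ _ (fun i => pow_zero _)]
  simp only [AddMonoidAlgebra.single_pow, one_pow]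
  rw [AddMonoidAlgebra.prod_single]
  rw [RingHom.comp_apply, AddMonoidAlgebra.coe_algebraMap]
  simp only [Function.comp_apply, AddMonoidAlgebra.single_mul_single, Finset.prod_const_one,
    zero_add, Algebra.algebraMap_self, RingHom.id_apply, mul_one]
  congr 1
  ext i
  simp [Finset.sum_apply, Pi.single_apply]

omit [IsDomain O] [Fintype κ] [DecidableEq κ] in
theorem coeff_toLaurent (P : MvPolynomial (Fin f) O) (a : Fin f →₀ ℕ) :
    (toLaurent f ρ P).coeff (fun i => (a i : ℤ)) = ρ (P.coeff a) := by
  classical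
  induction P using MvPolynomial.induction_on' with
  | add P Q hP hQ => rw [map_add, MvPolynomial.coeff_add, map_add, ← hP, ← hQ]; rfl
  | monomial b u =>
    rw [toLaurent_monomial, AddMonoidAlgebra.coeff_single, Finsupp.single_apply,
      MvPolynomial.coeff_monomial]
    have : ((fun i => (b i : ℤ)) = fun i => (a i : ℤ)) ↔ b = a := by
      rw [funext_iff, Finsupp.ext_iff]
      simp
    simp only [this]
    split_ifs
    · rfl
    · rw [map_zero]

/-- The ideals `hat n ∩ plus`. -/
def plusIdeal (p f : ℕ) (k : Type*) [Field k] (n : ℕ) : Ideal (plus p f k) where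
  carrier := {x | (x : (perfFiltration p f k).Completion) ∈ (perfFiltration p f k).hat n}
  zero_mem' := zero_mem ((perfFiltration p f k).hat n)
  add_mem' hx hy := ((perfFiltration p f k).hat n).add_mem hx hy
  smul_mem' c x hx := by
    have := (perfFiltration p f k).mul_mem_hat c.2 hx
    rwa [zero_add] at this

omit [Fact p.Prime] in
theorem mem_plusIdeal {n : ℕ} {x : plus p f k} : x ∈ plusIdeal p f k n ↔
    (x : (perfFiltration p f k).Completion) ∈ (perfFiltration p f k).hat n := Iff.rfl

omit [IsDomain O] [Fact p.Prime] [Fintype κ] [DecidableEq κ] in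
/-- Evaluation of power series over `O` in `A_∞`. -/
theorem exists_powerSeries_red (ρ : O →+* κ) :
    ∃ s : MvPowerSeries (Fin f) O →+* (perfFiltration p f k).Completion,
      ∀ c (m : ℕ), s c - laurent p f κ (toLaurent f ρ (MvPowerSeries.truncTotal m c)) ∈
        (perfFiltration p f k).hat m := by
  have hmem : ∀ i : Fin f, mon p f k (intExp p f (Pi.single i 1)) ∈ (perfFiltration p f k).hat 1 :=
    fun i => mon_mem_hat (by rw [totalDegree_intExp]; simp)
  let t : Fin f → plus p f k := fun i => ⟨_, (perfFiltration p f k).hat_anti zero_le_one (hmem i)⟩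
  let α : O →+* (perfFiltration p f k).Completion :=
    (laurent p f κ).comp ((algebraMap κ (AddMonoidAlgebra κ (Fin f → ℤ))).comp ρ)
  have hα : ∀ x, α x ∈ plus p f k := by
    intro x
    change laurent p f κ (AddMonoidAlgebra.single 0 (ρ x)) ∈ (perfFiltration p f k).hat 0
    rw [laurent_single, map_zero, RingFiltration.of_mem_hat, mem_sub_iff]
    intro a ha
    rw [AddMonoidAlgebra.coeff_single, Finsupp.single_apply, if_neg]
    rintro rfl
    simp at ha
  let : Algebra O (plus p f k) := (α.codRestrict _ hα).toAlgebra
  have hle : ∀ n, Ideal.span (Set.range t) ^ n ≤ plusIdeal p f k n := by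
    intro n
    induction n with
    | zero => intro x _; exact x.2
    | succ n ih =>
      rw [pow_succ]
      refine Ideal.mul_le.2 fun x hx y hy => ?_
      have hy' : y ∈ plusIdeal p f k 1 := by
        refine (Ideal.span_le.2 ?_ : _ ≤ plusIdeal p f k 1) hy
        rintro _ ⟨i, rfl⟩
        exact hmem i
      have := (perfFiltration p f k).mul_mem_hat (ih hx) hy'
      exact_mod_cast this
  obtain ⟨ψ, hψ⟩ := exists_powerSeries_eval (A := O) t (plusIdeal p f k) (fun x hx => by
      refine Subtype.ext ((perfFiltration p f k).eq_zero_of_forall_mem_hat fun n => ?_)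
      exact (perfFiltration p f k).hat_anti (Int.self_le_toNat n) (hx n.toNat)) (fun s hs => by
      obtain ⟨l, hl⟩ := (perfFiltration p f k).exists_series 0
        (fun j => ((s (j + 1) - s j : plus p f k) : (perfFiltration p f k).Completion))
        fun j => by rw [zero_add]; exact hs j
      have hl' : ∀ n : ℕ, l + s 0 - s n ∈ (perfFiltration p f k).hat n := by
        intro n
        have h1 := hl n
        rw [zero_add] at h1
        simp only [AddSubgroupClass.coe_sub] at h1
        rw [Finset.sum_range_sub (fun j => ((s j : plus p f k) :
          (perfFiltration p f k).Completion))] at h1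
        rwa [← sub_add, sub_add_eq_add_sub] at h1
      have hl0 : l + s 0 ∈ plus p f k := by
        have h1 := add_mem (hl' 0) (s 0).2
        rwa [sub_add_cancel] at h1
      exact ⟨⟨_, hl0⟩, hl'⟩) (fun n => n) hle
  refine ⟨(plus p f k).subtype.comp ψ.toRingHom, fun c m => ?_⟩
  have h1 : (plus p f k).subtype.comp (MvPolynomial.aeval (R := O) t).toRingHom =
      (laurent p f κ).comp (toLaurent f ρ) := by
    refine MvPolynomial.ringHom_ext (fun r => ?_) fun i => ?_
    · change ((MvPolynomial.aeval (R := O) t (MvPolynomial.C r) : plus p f k) :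
        (perfFiltration p f k).Completion) = laurent p f κ (toLaurent f ρ (MvPolynomial.C r))
      rw [MvPolynomial.aeval_C, toLaurent, MvPolynomial.coe_eval₂Hom, MvPolynomial.eval₂_C]
      rfl
    · change ((MvPolynomial.aeval (R := O) t (MvPolynomial.X i) : plus p f k) :
        (perfFiltration p f k).Completion) = laurent p f κ (toLaurent f ρ (MvPolynomial.X i))
      rw [MvPolynomial.aeval_X, toLaurent, MvPolynomial.coe_eval₂Hom, MvPolynomial.eval₂_X,
        laurent_single]
      rfl
  have h2 := congrArg (· (MvPowerSeries.truncTotal m c)) h1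
  have h3 := mem_plusIdeal.1 (hψ c m m le_rfl)
  rw [AddSubgroupClass.coe_sub] at h3
  change ((ψ c : plus p f k) : (perfFiltration p f k).Completion) - _ ∈ _
  change ((MvPolynomial.aeval (R := O) t (MvPowerSeries.truncTotal m c) : plus p f k) :
    (perfFiltration p f k).Completion) =
      laurent p f κ (toLaurent f ρ (MvPowerSeries.truncTotal m c)) at h2
  rwa [h2] at h3

/-- The properties of the reduction map from the Iwasawa algebra to `A_∞`, which is the power
series ring modulo `p`: the `𝔭`-adic filtration modulo `p` is induced by the filtration of `A_∞`
by the degree. -/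
structure IsReduction (ρ : O →+* κ) (r : Iwasawa p O →+* (perfFiltration p f k).Completion) :
    Prop where
  map_algebraMap : ∀ c, r (algebraMap O _ c) = (perfFiltration p f k).of
    (AddMonoidAlgebra.single 0 (ρ c : k))
  map_T : ∀ i, r (T p O f i) = mon p f k (intExp p f (Pi.single i 1))
  mem_hat : ∀ (m : ℕ) x, x ∈ idealT p O f ^ m → r x ∈ (perfFiltration p f k).hat m
  exists_of_mem_hat : ∀ (m : ℕ) x, r x ∈ (perfFiltration p f k).hat m →
    ∃ y ∈ idealT p O f ^ m, ∃ z, x = y + (p : O) • z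
  mem_intSubring : ∀ x, r x ∈ intSubring p f κ

include hρ in
/-- On power series in the `T_i`, the reduction maps the coefficients to the residue field and
expands the result in `A_∞`. -/
theorem IsUnramifiedReduction.exists_red :
    ∃ r : Iwasawa p O →+* (perfFiltration p f k).Completion, IsReduction ρ r := by
  classical
  obtain ⟨ψ, hψ, hψ'⟩ := hρ.exists_powerSeries_equiv
  obtain ⟨s, hs⟩ := exists_powerSeries_red (p := p) (f := f) ρ
  let e : MvPowerSeries (Fin f) O ≃+* Iwasawa p O := RingEquiv.ofBijective ψ hψ
  have he : ∀ c, e.symm (ψ c) = c := fun c => e.symm_apply_apply c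
  -- the values on polynomials
  have hpoly : ∀ P : MvPolynomial (Fin f) O,
      s (P : MvPowerSeries (Fin f) O) = laurent p f κ (toLaurent f ρ P) := by
    intro P
    rw [← sub_eq_zero]
    refine (perfFiltration p f k).eq_zero_of_forall_mem_hat fun n => ?_
    have h1 := hs P (max n.toNat (P.totalDegree + 1))
    rw [(MvPowerSeries.truncTotal_coe_eq_self_iff P (by omega)).2
      (lt_of_lt_of_le (Nat.lt_succ_self _) (le_max_right _ _))] at h1
    refine (perfFiltration p f k).hat_anti ?_ h1
    have := Int.self_le_toNat n
    omega
  have hpoly' : ∀ P : MvPolynomial (Fin f) O,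
      s (e.symm (MvPolynomial.aeval (T p O f) P)) = laurent p f κ (toLaurent f ρ P) := by
    intro P
    rw [← hψ', he, hpoly]
  refine ⟨s.comp e.symm.toRingHom, fun c => ?_, fun i => ?_, fun m x hx => ?_, fun m x hx => ?_,
    fun x => ?_⟩
  · have h1 := hpoly' (MvPolynomial.C c)
    rw [MvPolynomial.aeval_C, MvPolynomial.C_apply, toLaurent_monomial, laurent_single] at h1
    have h2 : intExp p f (fun i => (((0 : Fin f →₀ ℕ) i : ℕ) : ℤ)) = 0 := by
      ext i
      simp [intExp]
    rw [h2] at h1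
    exact h1
  · have h1 := hpoly' (MvPolynomial.X i)
    rw [MvPolynomial.aeval_X, toLaurent, MvPolynomial.coe_eval₂Hom, MvPolynomial.eval₂_X,
        laurent_single] at h1
    exact h1
  · obtain ⟨c, rfl⟩ := hψ.2 x
    rw [mem_idealT_pow_iff hψ hψ'] at hx
    have h1 : MvPowerSeries.truncTotal m c = 0 := by
      ext a
      rw [MvPowerSeries.coeff_truncTotal_eq_ite]
      split_ifs with h
      · rw [hx a h, MvPolynomial.coeff_zero]
      · rw [MvPolynomial.coeff_zero]
    have h2 := hs c m
    rw [h1, map_zero, map_zero, sub_zero] at h2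
    change s (e.symm (ψ c)) ∈ _
    rwa [he]
  · obtain ⟨c, rfl⟩ := hψ.2 x
    change s (e.symm (ψ c)) ∈ _ at hx
    rw [he] at hx
    have h1 : ∀ a : Fin f →₀ ℕ, a.degree < m → ∃ y, MvPowerSeries.coeff a c = p * y := by
      intro a ha
      refine hρ.map_eq_zero _ ?_
      have h2 := sub_mem hx (hs c m)
      rw [sub_sub_cancel] at h2
      have h3 := mem_hat_iff.1 h2 (intExp p f fun i => (a i : ℤ)) (by
        rw [totalDegree_intExp, ← Nat.cast_sum, ← Finsupp.degree_eq_sum]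
        exact_mod_cast ha)
      rw [cf_laurent_intExp, coeff_toLaurent, MvPowerSeries.coeff_truncTotal _ ha] at h3
      exact_mod_cast h3
    choose! d hd using h1
    let d' : MvPowerSeries (Fin f) O := fun a => if a.degree < m then d a else 0
    have hd' : ∀ a, MvPowerSeries.coeff a d' = if a.degree < m then d a else 0 := fun _ => rfl
    refine ⟨ψ (c - (p : O) • d'), ?_, ψ d', ?_⟩
    · rw [mem_idealT_pow_iff hψ hψ']
      intro a ha
      rw [map_sub, MvPowerSeries.coeff_smul, hd', if_pos ha, hd a ha, sub_self]
    · rw [map_sub, map_smul, sub_add_cancel]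
  · rw [mem_intSubring]
    intro n
    exact ⟨_, (perfFiltration p f k).hat_anti (Int.self_le_toNat n) (hs (e.symm x) n.toNat)⟩

end Reduction
end MvIwasawa
end

noncomputable section
namespace MvIwasawa

/-! ### The completed localization of the Iwasawa algebra -/

section Localization

open PerfCompletion RingFiltration

variable {p f : ℕ} [Fact p.Prime] {O k : Type*} [CommRing O] [IsDomain O] [Field k]
  {κ : Subfield k} [Fintype κ] [DecidableEq κ] {ρ : O →+* κ} (hρ : IsUnramifiedReduction p f ρ)

theorem exists_mul_pow_eq (x : LocIwasawa p O f) : ∃ (l : ℕ) (P : Iwasawa p O),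
    x * algebraMap _ (LocIwasawa p O f) (prodT p O f) ^ l = algebraMap _ _ P := by
  obtain ⟨n, hn⟩ := (locFiltration p O f).exhaustive x
  obtain ⟨l, P, -, h⟩ := hn
  exact ⟨l, P, h⟩

theorem isUnit_prodT : IsUnit (algebraMap _ (LocIwasawa p O f) (prodT p O f)) :=
  IsLocalization.Away.algebraMap_isUnit _

theorem algebraMap_mem_locFiltration {m : ℕ} {x : Iwasawa p O} (hx : x ∈ idealT p O f ^ m) :
    algebraMap _ (LocIwasawa p O f) x ∈ (locFiltration p O f).sub m :=
  ⟨0, x, by simpa using hx, by simp⟩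

namespace IsUnramifiedReduction

include hρ

theorem isDomain_iwasawa : IsDomain (Iwasawa p O) := by
  obtain ⟨ψ, hψ, -⟩ := hρ.exists_powerSeries_equiv
  have : IsDomain (MvPowerSeries (Fin f) O) := NoZeroDivisors.to_isDomain _
  exact (RingEquiv.ofBijective ψ hψ).symm.toMulEquiv.isDomain _

theorem prodT_ne_zero : prodT p O f ≠ 0 := by
  obtain ⟨ψ, hψ, hψ'⟩ := hρ.exists_powerSeries_equiv
  have := hρ.isDomain_iwasawa
  refine Finset.prod_ne_zero_iff.2 fun i _ h => ?_
  have h1 := hψ' (MvPolynomial.X i)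
  rw [MvPolynomial.aeval_X, h, ← map_zero ψ] at h1
  have h2 := hψ.1 h1
  rw [MvPolynomial.coe_X] at h2
  have h3 := congrArg (MvPowerSeries.coeff (Finsupp.single i 1)) h2
  rw [MvPowerSeries.coeff_index_single_self_X, map_zero] at h3
  exact one_ne_zero h3

theorem algebraMap_injective :
    Function.Injective (algebraMap (Iwasawa p O) (LocIwasawa p O f)) := by
  have := hρ.isDomain_iwasawa
  exact IsLocalization.injective _
    (powers_le_nonZeroDivisors_of_noZeroDivisors hρ.prodT_ne_zero)

/-- Multiplication by `p` preserves the degree in the localization; hence so it does in its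
completion, and the quotient by `p` can be computed before completion. -/
theorem mem_locFiltration_of_mul {n : ℤ} {x : LocIwasawa p O f}
    (hx : (p : LocIwasawa p O f) * x ∈ (locFiltration p O f).sub n) :
    x ∈ (locFiltration p O f).sub n := by
  obtain ⟨m, P, hP, h1⟩ := hx
  obtain ⟨l, Q, h2⟩ := exists_mul_pow_eq x
  refine ⟨m + l, Q * prodT p O f ^ m, ?_, ?_⟩
  · have h3 : (p : O) • (Q * prodT p O f ^ m) = P * prodT p O f ^ l := by
      apply hρ.algebraMap_injective
      rw [Nat.cast_smul_eq_nsmul, nsmul_eq_mul, map_mul, map_mul, map_mul, map_pow, map_pow, ← h1,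
        ← h2, map_natCast]
      ring
    refine hρ.mem_idealT_pow_of_smul ?_
    rw [h3]
    have h4 := Ideal.mul_mem_mul hP (Ideal.pow_mem_pow (prodT_mem p O f) l)
    rw [← pow_mul, ← pow_add] at h4
    refine Ideal.pow_le_pow_right ?_ h4
    rw [Int.toNat_le]
    push_cast
    have := Int.self_le_toNat (n + m * f)
    linarith
  · rw [pow_add, ← mul_assoc, mul_right_comm, h2, map_mul, map_pow]

/-- Multiplication by `p` on the completed localization is strict for the filtration. -/
theorem mem_hat_of_mul {n : ℤ} {y : LocCompletion p O f}
    (hy : (p : LocCompletion p O f) * y ∈ (locFiltration p O f).hat n) :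
    y ∈ (locFiltration p O f).hat n := by
  obtain ⟨x, hx⟩ := (locFiltration p O f).exists_sub_of_mem_hat y n
  rw [← sub_add_cancel y ((locFiltration p O f).of x)]
  refine add_mem hx ((locFiltration p O f).of_mem_hat.2 (hρ.mem_locFiltration_of_mul ?_))
  rw [← (locFiltration p O f).of_mem_hat, map_mul, map_natCast]
  have h1 : (p : LocCompletion p O f) * (y - (locFiltration p O f).of x) ∈
      (locFiltration p O f).hat n := by
    rw [← nsmul_eq_mul]
    exact nsmul_mem hx p
  have h2 := sub_mem hy h1
  rwa [mul_sub, sub_sub_cancel] at h2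

theorem eq_zero_of_mul_eq_zero {y : LocCompletion p O f}
    (hy : (p : LocCompletion p O f) * y = 0) : y = 0 :=
  (locFiltration p O f).eq_zero_of_forall_mem_hat fun n => hρ.mem_hat_of_mul (by
    rw [hy]
    exact zero_mem _)

end IsUnramifiedReduction

/-- The properties of the reduction map from the completed localization of the Iwasawa algebra
to `A_∞`. -/
structure IsComplReduction (ρ : O →+* κ)
    (s : LocCompletion p O f →+* (perfFiltration p f k).Completion) : Prop where
  continuous : Continuous s
  map_algebraMap : ∀ c : O, s (algebraMap O _ c) = (perfFiltration p f k).of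
    (AddMonoidAlgebra.single 0 (ρ c : k))
  map_T : ∀ i, s ((locFiltration p O f).of (algebraMap _ _ (T p O f i))) =
    mon p f k (intExp p f (Pi.single i 1))
  mem_hat : ∀ n, ∀ y ∈ (locFiltration p O f).hat n, s y ∈ (perfFiltration p f k).hat n
  exists_of_mem_hat : ∀ n y, s y ∈ (perfFiltration p f k).hat n →
    ∃ y' ∈ (locFiltration p O f).hat n, ∃ z, y = y' + p * z
  mem_intSubring : ∀ y, s y ∈ intSubring p f κ

theorem mon_single_pow (a : Fin f → ℤ) (b : Fin f → ℕ) (h : ∀ i, a i = b i) :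
    mon p f k (intExp p f a) = ∏ i, mon p f k (intExp p f (Pi.single i 1)) ^ b i := by
  have h1 : a = ∑ i, b i • (Pi.single i 1 : Fin f → ℤ) := by
    ext j
    rw [Finset.sum_apply, h]
    simp [Pi.single_apply]
  have h2 : ∀ s : Finset (Fin f), mon p f k (∑ i ∈ s, b i • intExp p f (Pi.single i 1)) =
      ∏ i ∈ s, mon p f k (intExp p f (Pi.single i 1)) ^ b i := by
    classical
    intro s
    induction s using Finset.induction_on with
    | empty => simp [mon_zero]
    | insert i s hi ih => rw [Finset.sum_insert hi, Finset.prod_insert hi, mon_add, ih, mon_nsmul]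
  rw [h1, map_sum, ← h2]
  simp only [map_nsmul]

theorem mon_const (n : ℕ) : mon p f k (intExp p f fun _ => (n : ℤ)) =
    (∏ i, mon p f k (intExp p f (Pi.single i 1))) ^ n := by
  rw [mon_single_pow _ (fun _ => n) fun _ => rfl, Finset.prod_pow]

namespace IsUnramifiedReduction

include hρ

/-- The reduction map on the localization: its effect on the filtration and its image. -/
theorem exists_locRed : ∃ g : LocIwasawa p O f →+* (perfFiltration p f k).Completion,
    (∀ c : O, g (algebraMap _ _ (algebraMap O (Iwasawa p O) c)) =
      (perfFiltration p f k).of (AddMonoidAlgebra.single 0 (ρ c : k))) ∧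
    (∀ i, g (algebraMap _ _ (T p O f i)) = mon p f k (intExp p f (Pi.single i 1))) ∧
    (∀ n, ∀ x ∈ (locFiltration p O f).sub n, g x ∈ (perfFiltration p f k).hat n) ∧
    (∀ n x, g x ∈ (perfFiltration p f k).hat n →
      ∃ x' ∈ (locFiltration p O f).sub n, ∃ z, x = x' + p * z) ∧
    ∀ x, g x ∈ intSubring p f κ := by
  obtain ⟨r, hr⟩ := hρ.exists_red
  have ht : r (prodT p O f) = ∏ i, mon p f k (intExp p f (Pi.single i 1)) := by
    rw [prodT, map_prod]
    exact Finset.prod_congr rfl fun i _ => hr.map_T i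
  have ht' : ∀ l : ℕ, r (prodT p O f) ^ l = mon p f k (intExp p f fun _ => (l : ℤ)) := by
    intro l
    rw [ht, mon_const]
  have hinv : ∀ (l : ℕ) (x : (perfFiltration p f k).Completion),
      mon p f k (-intExp p f fun _ => (l : ℤ)) * (x * r (prodT p O f) ^ l) = x := by
    intro l x
    rw [ht', mul_left_comm, mon_neg_mul_mon, mul_one]
  have hu : IsUnit (r (prodT p O f)) := by
    refine IsUnit.of_mul_eq_one (mon p f k (-intExp p f fun _ => ((1 : ℕ) : ℤ))) ?_
    have := hinv 1 1
    rwa [pow_one, one_mul, mul_comm] at this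
  have hdeg : ∀ l : ℕ, totalDegree p f (intExp p f fun _ => (l : ℤ)) = ((l * f : ℤ) : ℚ) := by
    intro l
    rw [totalDegree_intExp]
    simp [mul_comm]
  have hdeg' : ∀ l : ℕ, totalDegree p f (-intExp p f fun _ => (l : ℤ)) = ((-(l * f) : ℤ) : ℚ) := by
    intro l
    rw [map_neg, hdeg, Int.cast_neg]
  obtain ⟨g, hg⟩ : ∃ g : LocIwasawa p O f →+* (perfFiltration p f k).Completion,
      ∀ x, g (algebraMap _ _ x) = r x :=
    ⟨IsLocalization.Away.lift (prodT p O f) hu, fun x => IsLocalization.Away.lift_eq _ hu x⟩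
  have hgl : ∀ {x : LocIwasawa p O f} {l : ℕ} {P : Iwasawa p O},
      x * algebraMap _ (LocIwasawa p O f) (prodT p O f) ^ l = algebraMap _ _ P →
      g x * r (prodT p O f) ^ l = r P := by
    intro x l P h
    have := congrArg g h
    rwa [map_mul, map_pow, hg, hg] at this
  refine ⟨g, fun c => ?_, fun i => ?_, ?_, fun n x hx => ?_, fun x => ?_⟩
  · rw [hg, hr.map_algebraMap]
  · rw [hg, hr.map_T]
  · rintro n x ⟨l, P, hP, h⟩
    rw [← hinv l (g x), hgl h]
    have h1 := (perfFiltration p f k).hat_anti (Int.self_le_toNat _) (hr.mem_hat _ _ hP)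
    have h2 := mon_mul_mem_hat (hdeg' l) h1
    exact (perfFiltration p f k).hat_anti (by omega) h2
  · obtain ⟨l, Q, h⟩ := exists_mul_pow_eq x
    obtain ⟨v, hv⟩ := (isUnit_prodT (p := p) (f := f) (O := O)).exists_left_inv
    have hv' : x = algebraMap _ _ Q * v ^ l := by
      rw [← h, mul_assoc, ← mul_pow, mul_comm _ v, hv, one_pow, mul_one]
    have h1 : r Q ∈ (perfFiltration p f k).hat (n + l * f) := by
      rw [← hgl h, mul_comm (g x), ht', add_comm n]
      exact mon_mul_mem_hat (hdeg l) hx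
    obtain ⟨y, hy, z, hz⟩ : ∃ y ∈ idealT p O f ^ (n + l * f).toNat, ∃ z, Q = y + (p : O) • z := by
      rcases le_total 0 (n + l * f) with h0 | h0
      · refine hr.exists_of_mem_hat _ _ ?_
        rwa [Int.toNat_of_nonneg h0]
      · refine ⟨Q, ?_, 0, by simp⟩
        rw [Int.toNat_of_nonpos h0]
        simp
    refine ⟨algebraMap _ _ y * v ^ l, ⟨l, y, hy, ?_⟩, algebraMap _ _ z * v ^ l, ?_⟩
    · rw [mul_assoc, ← mul_pow, hv, one_pow, mul_one]
    · rw [hv', hz, map_add, Nat.cast_smul_eq_nsmul, map_nsmul, nsmul_eq_mul, add_mul, mul_assoc]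
  · obtain ⟨l, Q, h⟩ := exists_mul_pow_eq x
    rw [← hinv l (g x), hgl h, ← map_neg]
    exact mul_mem (mon_intExp_mem _ _) (hr.mem_intSubring Q)

/-- The reduction extends to the completed localization, where the image of each `T_i` is
invertible and the filtrations are compatible. -/
theorem exists_complRed [CharP k p] :
    ∃ s : LocCompletion p O f →+* (perfFiltration p f k).Completion, IsComplReduction ρ s := by
  obtain ⟨g, hgO, hgT, hmem, hex, hint⟩ := hρ.exists_locRed
  obtain ⟨s, hs, hsg⟩ := (locFiltration p O f).exists_extension
    (perfFiltration p f k).completeSpace_right g (by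
      intro U hU
      obtain ⟨n, -, hn⟩ := (perfFiltration p f k).hasBasis_hat.mem_iff.1 hU
      exact ⟨n, fun x hx => hn (hmem n x hx)⟩)
  have hsmem : ∀ n, ∀ y ∈ (locFiltration p O f).hat n, s y ∈ (perfFiltration p f k).hat n := by
    intro n y hy
    have h1 : IsClosed (s ⁻¹' ((perfFiltration p f k).hat n :
      Set (perfFiltration p f k).Completion)) :=
      ((perfFiltration p f k).isClosed_hat n).preimage hs
    have hy' : y ∈ closure ((locFiltration p O f).of '' ((locFiltration p O f).sub n :
      Set (LocIwasawa p O f))) := hy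
    refine closure_minimal (t := s ⁻¹' ((perfFiltration p f k).hat n :
      Set (perfFiltration p f k).Completion)) ?_ h1 hy'
    rintro _ ⟨x, hx, rfl⟩
    change s ((locFiltration p O f).of x) ∈ (perfFiltration p f k).hat n
    rw [hsg]
    exact hmem n x hx
  refine ⟨s, hs, fun c => ?_, fun i => ?_, hsmem, fun n y hy => ?_, fun y => ?_⟩
  · rw [← hgO, ← hsg]
    rfl
  · rw [hsg, hgT]
  · obtain ⟨x, hx⟩ := (locFiltration p O f).exists_sub_of_mem_hat y n
    have h1 : g x ∈ (perfFiltration p f k).hat n := by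
      have := sub_mem hy (hsmem n _ hx)
      rwa [← map_sub, sub_sub_cancel, hsg] at this
    obtain ⟨x', hx', z, hz⟩ := hex n x h1
    refine ⟨(y - (locFiltration p O f).of x) + (locFiltration p O f).of x',
      add_mem hx ((locFiltration p O f).of_mem_hat.2 hx'), (locFiltration p O f).of z, ?_⟩
    rw [hz, map_add, map_mul, map_natCast]
    ring
  · have h1 : IsClosed (s ⁻¹' (intSubring p f κ)) := (isClosed_intSubring κ).preimage hs
    have h3 : y ∈ closure (Set.range (locFiltration p O f).of) :=
      (locFiltration p O f).denseRange_of y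
    refine closure_minimal ?_ h1 h3
    rintro _ ⟨x, rfl⟩
    change s _ ∈ intSubring p f κ
    rw [hsg]
    exact hint x

variable {s : LocCompletion p O f →+* (perfFiltration p f k).Completion}
  (hs : IsComplReduction ρ s)

include hs

/-- The kernel of the reduction map is generated by `p`. -/
theorem exists_of_complRed_eq_zero [CharP k p] {y : LocCompletion p O f} (hy : s y = 0) :
    ∃ z, y = p * z := by
  have hp : s p = 0 := by rw [map_natCast, CharP.cast_eq_zero]
  have h0 : ∀ (n : ℤ) (y : LocCompletion p O f), ∃ y' z, s y = 0 →
      y' ∈ (locFiltration p O f).hat n ∧ y = y' + p * z ∧ s y' = 0 := by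
    intro n y
    by_cases h : s y = 0
    · obtain ⟨y', hy', z, hz⟩ := hs.exists_of_mem_hat n y (by rw [h]; exact zero_mem _)
      refine ⟨y', z, fun _ => ⟨hy', hz, ?_⟩⟩
      rw [hz, map_add, map_mul, hp, zero_mul, add_zero] at h
      exact h
    · exact ⟨0, 0, fun h' => absurd h' h⟩
  choose u v huv using h0
  let w : ℕ → LocCompletion p O f := Nat.rec (u 0 y) fun n x => u (n + 1 : ℕ) x
  have hw : ∀ n : ℕ, s (w n) = 0 ∧ w n ∈ (locFiltration p O f).hat n := by
    intro n
    induction n with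
    | zero => exact ⟨(huv 0 y hy).2.2, (huv 0 y hy).1⟩
    | succ n ih => exact ⟨(huv _ _ ih.1).2.2, (huv (n + 1 : ℕ) _ ih.1).1⟩
  have hwv : ∀ n : ℕ, w n = w (n + 1) + p * v (n + 1 : ℕ) (w n) :=
    fun n => (huv (n + 1 : ℕ) _ (hw n).1).2.1
  have hv : ∀ n : ℕ, v (n + 1 : ℕ) (w n) ∈ (locFiltration p O f).hat (0 + n) := by
    intro n
    refine hρ.mem_hat_of_mul ?_
    rw [← sub_eq_iff_eq_add'.2 (hwv n), zero_add]
    exact sub_mem (hw n).2 ((locFiltration p O f).hat_anti (by push_cast; omega) (hw (n + 1)).2)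
  obtain ⟨z, hz⟩ := (locFiltration p O f).exists_series 0 _ hv
  have hsum : ∀ n : ℕ, w 0 - p * ∑ j ∈ Finset.range n, v (j + 1 : ℕ) (w j) = w n := by
    intro n
    induction n with
    | zero => simp
    | succ n ih =>
      rw [Finset.sum_range_succ, mul_add, ← sub_sub, ih]
      exact sub_eq_iff_eq_add.2 (hwv n)
  refine ⟨v 0 y + z, ?_⟩
  have h1 : w 0 - p * z = 0 := by
    refine (locFiltration p O f).eq_zero_of_forall_mem_hat fun n => ?_
    have h2 : w 0 - p * z = w n.toNat -
        p * (z - ∑ j ∈ Finset.range n.toNat, v (j + 1 : ℕ) (w j)) := by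
      rw [← hsum n.toNat]
      ring
    rw [h2, ← nsmul_eq_mul]
    refine (locFiltration p O f).hat_anti (Int.self_le_toNat n)
      (sub_mem (hw _).2 (nsmul_mem ?_ p))
    have := hz n.toNat
    rwa [zero_add] at this
  rw [mul_add, ← sub_eq_zero.1 h1, add_comm]
  exact (huv 0 y hy).2.1

/-- The image of the reduction map consists of the series with integral exponents and
coefficients in `κ`. -/
theorem exists_complRed_eq [CharP k p] {x : (perfFiltration p f k).Completion}
    (hx : x ∈ intSubring p f κ) : ∃ y, s y = x := by
  have hp : s p = 0 := by rw [map_natCast, CharP.cast_eq_zero]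
  have hof : ∀ y : AddMonoidAlgebra κ (Fin f → ℤ), ∃ b, s b = laurent p f κ y := by
    intro y
    induction y using AddMonoidAlgebra.induction_linear with
    | zero => exact ⟨0, by simp⟩
    | add y z hy hz =>
      obtain ⟨b, hb⟩ := hy
      obtain ⟨c, hc⟩ := hz
      exact ⟨b + c, by rw [map_add, map_add, hb, hc]⟩
    | single a u =>
      obtain ⟨c, rfl⟩ := hρ.surjective u
      obtain ⟨w, hw⟩ := (isUnit_prodT (p := p) (f := f) (O := O)).exists_left_inv
      -- a common bound for the negative parts of the exponents
      obtain ⟨N, hN⟩ : ∃ N : ℕ, ∀ i, 0 ≤ a i + N := by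
        refine ⟨∑ i, (a i).natAbs, fun i => ?_⟩
        have := Finset.single_le_sum (f := fun i => (a i).natAbs) (fun _ _ => Nat.zero_le _)
          (Finset.mem_univ i)
        have h2 : (a i).natAbs ≤ ∑ i, (a i).natAbs := this
        omega
      have h1 : s ((locFiltration p O f).of (w ^ N)) =
          mon p f k (-intExp p f fun _ => (N : ℤ)) := by
        have h2 : s ((locFiltration p O f).of (w ^ N)) *
            mon p f k (intExp p f fun _ => (N : ℤ)) = 1 := by
          rw [mon_const, ← Finset.prod_congr rfl fun i _ => hs.map_T i, ← map_prod, ← map_prod,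
            ← map_prod, ← map_pow, ← map_pow, ← map_mul, ← map_mul]
          change s ((locFiltration p O f).of (w ^ N * algebraMap _ _ (prodT p O f) ^ N)) = 1
          rw [← mul_pow, hw, one_pow, map_one, map_one]
        calc _ = mon p f k (-intExp p f fun _ => (N : ℤ)) * (s ((locFiltration p O f).of (w ^ N)) *
              mon p f k (intExp p f fun _ => (N : ℤ))) := by
              rw [mul_left_comm, mon_neg_mul_mon, mul_one]
          _ = _ := by rw [h2, mul_one]
      refine ⟨algebraMap O _ c * (locFiltration p O f).of (w ^ N) *
        ∏ i, (locFiltration p O f).of (algebraMap _ _ (T p O f i)) ^ (a i + N).toNat, ?_⟩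
      rw [map_mul, map_mul, map_prod, hs.map_algebraMap, h1]
      simp only [map_pow, hs.map_T]
      rw [← mon_single_pow (fun i => a i + N) _ fun i => (Int.toNat_of_nonneg (hN i)).symm,
        mul_assoc, ← mon_add, laurent_single, mon, ← map_mul, AddMonoidAlgebra.single_mul_single,
        mul_one, zero_add]
      congr 2
      rw [neg_add_eq_sub, ← map_sub]
      congr 1
      ext i
      simp
  have h0 : ∀ (n : ℤ) (x : (perfFiltration p f k).Completion), ∃ b, x ∈ intSubring p f κ →
      x - s b ∈ (perfFiltration p f k).hat (n + 1) ∧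
        (x ∈ (perfFiltration p f k).hat n → b ∈ (locFiltration p O f).hat n) := by
    intro n x
    by_cases hx : x ∈ intSubring p f κ
    · obtain ⟨y, hy⟩ := mem_intSubring.1 hx (n + 1)
      obtain ⟨b, hb⟩ := hof y
      by_cases hx' : x ∈ (perfFiltration p f k).hat n
      · have h1 : s b ∈ (perfFiltration p f k).hat n := by
          have := sub_mem hx' ((perfFiltration p f k).hat_anti (by omega : n ≤ n + 1) hy)
          rwa [sub_sub_cancel, ← hb] at this
        obtain ⟨b', hb', z, hz⟩ := hs.exists_of_mem_hat n b h1
        refine ⟨b', fun _ => ⟨?_, fun _ => hb'⟩⟩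
        rw [← hb, hz, map_add, map_mul, hp, zero_mul, add_zero] at hy
        exact hy
      · exact ⟨b, fun _ => ⟨by rwa [hb], fun h => absurd h hx'⟩⟩
    · exact ⟨0, fun h => absurd h hx⟩
  choose b hb using h0
  obtain ⟨n₀, hn₀⟩ := (perfFiltration p f k).exists_mem_hat x
  let w : ℕ → (perfFiltration p f k).Completion := Nat.rec x fun n y => y - s (b (n₀ + n) y)
  have hw : ∀ n : ℕ, w n ∈ intSubring p f κ ∧ w n ∈ (perfFiltration p f k).hat (n₀ + n) := by
    intro n
    induction n with
    | zero => exact ⟨hx, by simpa [w] using hn₀⟩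
    | succ n ih =>
      refine ⟨sub_mem ih.1 (hs.mem_intSubring _), ?_⟩
      have := (hb (n₀ + n) (w n) ih.1).1
      rw [Nat.cast_succ, ← add_assoc]
      exact this
  obtain ⟨z, hz⟩ := (locFiltration p O f).exists_series n₀ (fun n => b (n₀ + n) (w n))
    fun n => (hb _ _ (hw n).1).2 (hw n).2
  have hsum : ∀ n : ℕ, x - s (∑ j ∈ Finset.range n, b (n₀ + j) (w j)) = w n := by
    intro n
    induction n with
    | zero => simp [w]
    | succ n ih => rw [Finset.sum_range_succ, map_add, ← sub_sub, ih]
  refine ⟨z, ?_⟩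
  rw [← sub_eq_zero]
  refine (perfFiltration p f k).eq_zero_of_forall_mem_hat fun n => ?_
  have h1 := hs.mem_hat _ _ (hz (n - n₀).toNat)
  have h2 := (hw (n - n₀).toNat).2
  rw [← hsum] at h2
  rw [map_sub] at h1
  have h3 := sub_mem h1 h2
  rw [sub_sub_sub_cancel_right] at h3
  exact (perfFiltration p f k).hat_anti (by omega) h3

end IsUnramifiedReduction

end Localization
end MvIwasawa
end

noncomputable section
namespace MvIwasawa

/-! ### The `p`-adic completion `A_mv` -/

section AdicCompletion

variable {B : Type*} [CommRing B] (p : ℕ)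

theorem pow_smul_eq (n : ℕ) (z : AdicCompletion (Ideal.span {(p : B)}) B) :
    (p : B) ^ n • z = (p : AdicCompletion (Ideal.span {(p : B)}) B) ^ n * z := by
  rw [Algebra.smul_def, map_pow, map_natCast]

theorem isPowComplete_adicCompletion : IsPowComplete
    (p : AdicCompletion (Ideal.span {(p : B)}) B) (AdicCompletion (Ideal.span {(p : B)}) B) := by
  have h1 : IsAdicComplete (Ideal.span {(p : B)}) (AdicCompletion (Ideal.span {(p : B)}) B) :=
    AdicCompletion.isAdicComplete ⟨{(p : B)}, by simp⟩
  have h2 := isPowComplete_of_isAdicComplete (p : B) (AdicCompletion (Ideal.span {(p : B)}) B)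
  refine ⟨fun x hx => h2.haus x fun n => ?_, fun m => ?_⟩
  · obtain ⟨z, hz⟩ := hx n
    exact ⟨z, by rw [hz, pow_smul_eq, smul_eq_mul]⟩
  · obtain ⟨s, hs⟩ := h2.prec m
    refine ⟨s, fun n => ?_⟩
    obtain ⟨z, hz⟩ := hs n
    refine ⟨z, ?_⟩
    rw [hz]
    simp only [pow_smul_eq, smul_eq_mul]

theorem exists_of_eval_eq_zero {n : ℕ} {x : AdicCompletion (Ideal.span {(p : B)}) B}
    (hx : AdicCompletion.eval (Ideal.span {(p : B)}) B n x = 0) :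
    ∃ y, x = (p : AdicCompletion (Ideal.span {(p : B)}) B) ^ n * y := by
  have h1 : x ∈ (AdicCompletion.eval (Ideal.span {(p : B)}) B n).ker := hx
  rw [← AdicCompletion.pow_smul_top_eq_ker_eval ⟨{(p : B)}, by simp⟩,
    Ideal.span_singleton_pow, Submodule.ideal_span_singleton_smul,
    Submodule.mem_smul_pointwise_iff_exists] at h1
  obtain ⟨y, -, hy⟩ := h1
  exact ⟨y, by rw [← hy, pow_smul_eq]⟩

end AdicCompletion

namespace Amv

section Basic

variable {p f : ℕ} {O : Type*} [CommRing O]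

/-- The ideal `p ^ n B` of the completed localization `B`, in the form in which it occurs in the
definition of the `p`-adic completion. -/
abbrev pIdeal (p f : ℕ) (O : Type*) [CommRing O] (n : ℕ) : Ideal (LocCompletion p O f) :=
  Ideal.span {(p : LocCompletion p O f)} ^ n • ⊤

theorem mem_pIdeal {n : ℕ} {b : LocCompletion p O f} :
    b ∈ pIdeal p f O n ↔ ∃ c, b = (p : LocCompletion p O f) ^ n * c := by
  rw [pIdeal, smul_eq_mul, Ideal.mul_top, Ideal.span_singleton_pow, Ideal.mem_span_singleton]
  exact Iff.rfl

/-- The projection `A_mv → B / p ^ n`. -/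
def ev (p f : ℕ) (O : Type*) [CommRing O] (n : ℕ) : Amv p O f →+*
    LocCompletion p O f ⧸ pIdeal p f O n where
  toFun x := AdicCompletion.eval (Ideal.span {(p : LocCompletion p O f)}) (LocCompletion p O f) n x
  map_zero' := map_zero _
  map_add' := map_add _
  map_one' := AdicCompletion.val_one _ n
  map_mul' := AdicCompletion.val_mul _ n

/-- The canonical map `B → A_mv`. -/
def ofB (p f : ℕ) (O : Type*) [CommRing O] : LocCompletion p O f →+* Amv p O f :=
  algebraMap (LocCompletion p O f)
    (AdicCompletion (Ideal.span {(p : LocCompletion p O f)}) (LocCompletion p O f))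

theorem ev_ofB (n : ℕ) (b : LocCompletion p O f) :
    ev p f O n (ofB p f O b) = Ideal.Quotient.mk _ b := rfl

theorem toAmv_algebraMap (c : O) : toAmv p O f (algebraMap O _ c) = algebraMap O (Amv p O f) c :=
  rfl

theorem ext_ev {x y : Amv p O f} (h : ∀ n, ev p f O n x = ev p f O n y) : x = y :=
  AdicCompletion.ext h

theorem continuous_ev (n : ℕ) : Continuous (ev p f O n) :=
  continuous_iff_le_induced.2 (iInf_le _ n)

theorem continuous_iff {X : Type*} [TopologicalSpace X] {g : X → Amv p O f} :
    Continuous g ↔ ∀ n, Continuous fun x => ev p f O n (g x) := by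
  refine continuous_iInf_rng.trans (forall_congr' fun n => ?_)
  exact continuous_induced_rng

theorem continuous_mk (n : ℕ) : Continuous (Ideal.Quotient.mk (pIdeal p f O n)) :=
  continuous_quot_mk

theorem continuous_ofB : Continuous (ofB p f O) :=
  continuous_iff.2 fun n => continuous_mk n

theorem pIdeal_anti : Antitone (pIdeal p f O) := fun m n h b hb => by
  obtain ⟨c, rfl⟩ := mem_pIdeal.1 hb
  obtain ⟨l, rfl⟩ := Nat.exists_eq_add_of_le h
  exact mem_pIdeal.2 ⟨p ^ l * c, by rw [pow_add, mul_assoc]⟩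

/-- Ring homomorphisms into `A_mv` are compatible families of homomorphisms into the `B / p ^ n`. -/
theorem exists_hom {R : Type*} [CommRing R] (g : ∀ n, R →+* LocCompletion p O f ⧸ pIdeal p f O n)
    (hg : ∀ m n (h : m ≤ n) x, Ideal.Quotient.factor (pIdeal_anti h) (g n x) = g m x) :
    ∃ G : R →+* Amv p O f, ∀ n x, ev p f O n (G x) = g n x := by
  let G : R → Amv p O f := fun x => ⟨fun n => g n x, fun h => hg _ _ h x⟩
  have hG : ∀ n x, ev p f O n (G x) = g n x := fun _ _ => rfl
  have h1 : G 1 = 1 := ext_ev fun n => by rw [hG, map_one, map_one]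
  have h2 : ∀ x y, G (x * y) = G x * G y :=
    fun x y => ext_ev fun n => by rw [map_mul, hG, hG, hG, map_mul]
  have h3 : ∀ x y, G (x + y) = G x + G y :=
    fun x y => ext_ev fun n => by rw [map_add, hG, hG, hG, map_add]
  exact ⟨RingHom.mk' ⟨⟨G, h1⟩, h2⟩ h3, hG⟩

theorem isPowComplete : IsPowComplete (p : Amv p O f) (Amv p O f) :=
  isPowComplete_adicCompletion p

theorem exists_of_ev_eq_zero {n : ℕ} {x : Amv p O f} (hx : ev p f O n x = 0) :
    ∃ y, x = (p : Amv p O f) ^ n * y :=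
  exists_of_eval_eq_zero p hx

theorem exists_eq_ofB_add (n : ℕ) (x : Amv p O f) : ∃ b z, x =
    ofB p f O b + (p : Amv p O f) ^ n * z := by
  obtain ⟨b, hb⟩ := Ideal.Quotient.mk_surjective (ev p f O n x)
  obtain ⟨z, hz⟩ := exists_of_ev_eq_zero (n := n) (x := x - ofB p f O b) (by
    rw [map_sub, ev_ofB, hb, sub_self])
  exact ⟨b, z, by rw [← hz, add_sub_cancel]⟩

theorem ev_pow_mul (n : ℕ) (x : Amv p O f) : ev p f O n ((p : Amv p O f) ^ n * x) = 0 := by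
  obtain ⟨b, hb⟩ := Ideal.Quotient.mk_surjective (ev p f O n x)
  rw [map_mul, map_pow, map_natCast, ← hb, ← map_natCast (Ideal.Quotient.mk _), ← map_pow,
    ← map_mul, Ideal.Quotient.eq_zero_iff_mem]
  exact mem_pIdeal.2 ⟨b, rfl⟩

theorem completeSpace_quotient (n : ℕ) : @CompleteSpace (LocCompletion p O f ⧸ pIdeal p f O n)
    (IsTopologicalAddGroup.rightUniformSpace _) :=
  QuotientAddGroup.completeSpace_right _ (pIdeal p f O n).toAddSubgroup

end Basic

section Reduction

open PerfCompletion RingFiltration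

variable {p f : ℕ} [Fact p.Prime] {O k : Type*} [CommRing O] [IsDomain O] [Field k] [CharP k p]
  {κ : Subfield k} [Fintype κ] [DecidableEq κ] {ρ : O →+* κ} (hρ : IsUnramifiedReduction p f ρ)

include hρ in
theorem eq_zero_of_mul_eq_zero {x : Amv p O f} (hx : (p : Amv p O f) * x = 0) : x = 0 := by
  refine ext_ev fun n => ?_
  obtain ⟨b, z, rfl⟩ := exists_eq_ofB_add (n + 1) x
  have h1 := congrArg (ev p f O (n + 1)) hx
  rw [mul_add, mul_left_comm, map_add, ev_pow_mul, add_zero, map_zero, ← map_natCast (ofB p f O),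
    ← map_mul, ev_ofB, Ideal.Quotient.eq_zero_iff_mem, mem_pIdeal] at h1
  obtain ⟨c, hc⟩ := h1
  rw [pow_succ', mul_assoc, ← sub_eq_zero, ← mul_sub] at hc
  rw [map_add, pow_succ, mul_assoc, ev_pow_mul, add_zero, ev_ofB, map_zero,
    Ideal.Quotient.eq_zero_iff_mem, mem_pIdeal]
  exact ⟨c, sub_eq_zero.1 (hρ.eq_zero_of_mul_eq_zero hc)⟩

variable (k κ) in
include hρ in
/-- The ideals `p ^ n B` are closed: `p B` is the kernel of the continuous reduction, and the
multiplication by `p` is strict for the filtration. -/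
theorem isClosed_pIdeal (n : ℕ) : IsClosed (pIdeal p f O n : Set (LocCompletion p O f)) := by
  obtain ⟨s, hs⟩ := hρ.exists_complRed
  induction n with
  | zero =>
    have : pIdeal p f O 0 = ⊤ := by simp [pIdeal]
    rw [this]
    exact isClosed_univ
  | succ n ih =>
    refine isClosed_of_closure_subset fun x hx => ?_
    have h0 : s x = 0 := by
      have h1 : IsClosed {x | s x = 0} := isClosed_eq hs.continuous continuous_const
      refine closure_minimal (t := {x | s x = 0}) ?_ h1 hx
      intro y hy
      obtain ⟨c, rfl⟩ := mem_pIdeal.1 hy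
      change s _ = 0
      rw [map_mul, map_pow, map_natCast, CharP.cast_eq_zero, zero_pow n.succ_ne_zero, zero_mul]
    obtain ⟨y, rfl⟩ := hρ.exists_of_complRed_eq_zero hs h0
    have h2 : y ∈ closure (pIdeal p f O n : Set (LocCompletion p O f)) := by
      rw [mem_closure_iff_nhds_zero]
      intro U hU
      obtain ⟨m, -, hm⟩ := (locFiltration p O f).hasBasis_hat.mem_iff.1 hU
      obtain ⟨z, hz, hz'⟩ := mem_closure_iff_nhds_zero.1 hx _ ((locFiltration p O f).hat_mem_nhds m)
      obtain ⟨c, rfl⟩ := mem_pIdeal.1 hz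
      refine ⟨p ^ n * c, mem_pIdeal.2 ⟨c, rfl⟩, hm (hρ.mem_hat_of_mul ?_)⟩
      rw [pow_succ', mul_assoc, ← mul_sub] at hz'
      exact hz'
    rw [ih.closure_eq] at h2
    obtain ⟨c, rfl⟩ := mem_pIdeal.1 h2
    exact mem_pIdeal.2 ⟨c, by rw [pow_succ', mul_assoc]⟩

variable (k κ) in
include hρ in
theorem t2Space_quotient (n : ℕ) : T2Space (LocCompletion p O f ⧸ pIdeal p f O n) := by
  have : IsClosed ((pIdeal p f O n).toAddSubgroup : Set (LocCompletion p O f)) :=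
    isClosed_pIdeal k κ hρ n
  exact inferInstanceAs (T2Space (LocCompletion p O f ⧸ (pIdeal p f O n).toAddSubgroup))

end Reduction

/-- The properties of the reduction map from `A_mv` to `A_∞`. -/
structure IsRed {p f : ℕ} {O k : Type*} [CommRing O] [Field k] {κ : Subfield k} (ρ : O →+* κ)
    (π : Amv p O f →+* (perfFiltration p f k).Completion) : Prop where
  continuous : Continuous π
  map_algebraMap : ∀ c : O, π (algebraMap O _ c) = (perfFiltration p f k).of
    (AddMonoidAlgebra.single 0 (ρ c : k))
  map_T : ∀ i, π (toAmv p O f (T p O f i)) =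
    PerfCompletion.mon p f k (PerfCompletion.intExp p f (Pi.single i 1))
  exists_of_eq_zero : ∀ x, π x = 0 → ∃ y, x = p * y
  mem_intSubring : ∀ x, π x ∈ PerfCompletion.intSubring p f κ
  exists_eq : ∀ x ∈ PerfCompletion.intSubring p f κ, ∃ y, π y = x

section Reduction

open PerfCompletion RingFiltration

variable {p f : ℕ} [Fact p.Prime] {O k : Type*} [CommRing O] [IsDomain O] [Field k] [CharP k p]
  {κ : Subfield k} [Fintype κ] [DecidableEq κ] {ρ : O →+* κ} (hρ : IsUnramifiedReduction p f ρ)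

include hρ

/-- The reduction of `A_mv` to `A_∞`, through which `A_mv / p` becomes the ring of elements with
integral exponents and coefficients in the residue field of `O`. -/
theorem exists_isRed : ∃ π : Amv p O f →+* (perfFiltration p f k).Completion, IsRed ρ π := by
  obtain ⟨s, hs⟩ := hρ.exists_complRed
  have h1 : ∀ b ∈ pIdeal p f O 1, s b = 0 := by
    intro b hb
    obtain ⟨c, rfl⟩ := mem_pIdeal.1 hb
    rw [map_mul, map_pow, map_natCast, CharP.cast_eq_zero, pow_one, zero_mul]
  let π : Amv p O f →+* (perfFiltration p f k).Completion :=
    (Ideal.Quotient.lift (pIdeal p f O 1) s h1).comp (ev p f O 1)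
  have hπ : ∀ b, π (ofB p f O b) = s b := fun b => rfl
  have hp : ∀ x, π (p * x) = 0 := by
    intro x
    rw [map_mul, map_natCast, CharP.cast_eq_zero, zero_mul]
  refine ⟨π, ?_, fun c => hs.map_algebraMap c, fun i => hs.map_T i, fun x hx => ?_, fun x => ?_,
    fun x hx => ?_⟩
  · exact (continuous_quot_lift _ hs.continuous).comp (continuous_ev 1)
  · obtain ⟨b, z, rfl⟩ := exists_eq_ofB_add 1 x
    rw [pow_one, map_add, hp, add_zero, hπ] at hx
    obtain ⟨c, rfl⟩ := hρ.exists_of_complRed_eq_zero hs hx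
    exact ⟨ofB p f O c + z, by rw [mul_add, map_mul, map_natCast, pow_one]⟩
  · obtain ⟨b, z, rfl⟩ := exists_eq_ofB_add 1 x
    rw [pow_one, map_add, hp, add_zero, hπ]
    exact hs.mem_intSubring b
  · obtain ⟨b, hb⟩ := hρ.exists_complRed_eq hs hx
    exact ⟨ofB p f O b, hb⟩

/-- A continuous homomorphism from `A_mv` to `A_∞` is determined by its values on `O` and on the
variables. -/
theorem hom_eq {g g' : Amv p O f →+* (perfFiltration p f k).Completion} (hg : Continuous g)
    (hg' : Continuous g') (hO : ∀ c : O, g (algebraMap O _ c) = g' (algebraMap O _ c))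
    (hT : ∀ i, g (toAmv p O f (T p O f i)) = g' (toAmv p O f (T p O f i))) : g = g' := by
  have hcont : ∀ g : Amv p O f →+* (perfFiltration p f k).Completion, Continuous g → ∀ n,
      ∃ m : ℕ, ∀ x ∈ idealT p O f ^ m, g (toAmv p O f x) ∈ (perfFiltration p f k).hat n := by
    intro g hg n
    obtain ⟨m, hm⟩ := exists_forall_mem_hat_of_continuous _ _ (g.comp (ofB p f O)).toAddMonoidHom
      (hg.comp continuous_ofB) n
    refine ⟨m.toNat, fun x hx => hm _ ((locFiltration p O f).of_mem_hat.2 ?_)⟩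
    exact (locFiltration p O f).anti (Int.self_le_toNat m) (algebraMap_mem_locFiltration hx)
  -- the two maps agree on the Iwasawa algebra
  have h1 : ∀ x, g (toAmv p O f x) = g' (toAmv p O f x) := by
    intro x
    rw [← sub_eq_zero]
    refine (perfFiltration p f k).eq_zero_of_forall_mem_hat fun n => ?_
    obtain ⟨m, hm⟩ := hcont g hg n
    obtain ⟨m', hm'⟩ := hcont g' hg' n
    obtain ⟨y, hy, hxy⟩ := exists_mem_adjoin_sub_mem_pow (t := T p O f) (A := O)
      (fun x => hρ.exists_sub_algebraMap_mem_idealT x) (max m m') x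
    have h2 : g (toAmv p O f y) = g' (toAmv p O f y) := by
      clear hxy
      induction hy using Algebra.adjoin_induction with
      | mem x hx =>
        obtain ⟨i, rfl⟩ := hx
        exact hT i
      | algebraMap c => exact hO c
      | add x y _ _ hx hy => simp only [map_add, hx, hy]
      | mul x y _ _ hx hy => simp only [map_mul, hx, hy]
    have h3 := hm _ (Ideal.pow_le_pow_right (le_max_left _ _) hxy)
    have h4 := hm' _ (Ideal.pow_le_pow_right (le_max_right _ _) hxy)
    rw [map_sub, map_sub] at h3 h4
    have h5 := sub_mem h3 h4
    rw [h2, sub_sub_sub_cancel_right] at h5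
    exact h5
  have h2 : (g.comp (ofB p f O)).comp (locFiltration p O f).of =
      (g'.comp (ofB p f O)).comp (locFiltration p O f).of :=
    IsLocalization.ringHom_ext (Submonoid.powers (prodT p O f)) (RingHom.ext h1)
  have h3 : ∀ b, g (ofB p f O b) = g' (ofB p f O b) :=
    congrFun ((locFiltration p O f).eq_of_eq_of (hg.comp continuous_ofB) (hg'.comp continuous_ofB)
      fun x => congrArg (· x) h2)
  ext x
  obtain ⟨b, z, rfl⟩ := exists_eq_ofB_add 1 x
  simp only [map_add, h3, map_mul, map_natCast, CharP.cast_eq_zero, pow_one, zero_mul]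

end Reduction

end Amv
end MvIwasawa
end

noncomputable section
namespace MvIwasawa

/-! ### The endomorphism `φ_q` of `A_mv` -/

section Slope

variable {R Q : Type*} [CommRing R] [CommRing Q] (F : RingFiltration R) (j : R →+* Q) (p : ℕ)
  (c : ℤ)

/-- The filtration on `Q` for which the image of an element of the `n`-th step of `F` lies in the
`n`-th step, and for which multiplication by `p` raises the degree by `c`. -/
def slopeSub (n : ℤ) : AddSubgroup Q :=
  AddSubgroup.closure {y | ∃ (s : ℕ) (x : R), x ∈ F.sub (n - s * c) ∧ y = (p : Q) ^ s * j x}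

variable {F j p c}

theorem slopeSub_anti : Antitone (slopeSub F j p c) := fun m n h => by
  refine AddSubgroup.closure_mono ?_
  rintro y ⟨s, x, hx, rfl⟩
  exact ⟨s, x, F.anti (by omega) hx, rfl⟩

theorem map_mem_slopeSub {n : ℤ} {x : R} (hx : x ∈ F.sub n) : j x ∈ slopeSub F j p c n :=
  AddSubgroup.subset_closure ⟨0, x, by simpa using hx, by simp⟩

theorem mul_map_mem_slopeSub {n : ℤ} {x : R} (hx : x ∈ F.sub (n - c)) :
    (p : Q) * j x ∈ slopeSub F j p c n :=
  AddSubgroup.subset_closure ⟨1, x, by simpa using hx, by simp⟩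

theorem mul_mem_slopeSub {m n : ℤ} {x y : Q} (hx : x ∈ slopeSub F j p c m)
    (hy : y ∈ slopeSub F j p c n) : x * y ∈ slopeSub F j p c (m + n) := by
  unfold slopeSub at hx
  induction hx using AddSubgroup.closure_induction with
  | mem x hx =>
    obtain ⟨s, x, hx, rfl⟩ := hx
    unfold slopeSub at hy
    induction hy using AddSubgroup.closure_induction with
    | mem y hy =>
      obtain ⟨t, y, hy, rfl⟩ := hy
      refine AddSubgroup.subset_closure ⟨s + t, x * y, ?_, ?_⟩
      · have := F.mul_mem hx hy
        refine F.anti (le_of_eq ?_) this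
        push_cast
        ring
      · rw [map_mul]
        ring
    | zero => rw [mul_zero]; exact zero_mem _
    | add y z _ _ hy hz => rw [mul_add]; exact add_mem hy hz
    | neg y _ hy => rw [mul_neg]; exact neg_mem hy
  | zero => rw [zero_mul]; exact zero_mem _
  | add x z _ _ hx hz => rw [add_mul]; exact add_mem hx hz
  | neg x _ hx => rw [neg_mul]; exact neg_mem hx

theorem one_mem_slopeSub : (1 : Q) ∈ slopeSub F j p c 0 := by
  rw [← map_one j]
  exact map_mem_slopeSub F.one_mem

theorem pow_mem_slopeSub {n : ℤ} {x : Q} (hx : x ∈ slopeSub F j p c n) (a : ℕ) :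
    x ^ a ∈ slopeSub F j p c (a * n) := by
  induction a with
  | zero => simpa using one_mem_slopeSub
  | succ a ih =>
    rw [pow_succ]
    refine slopeSub_anti (le_of_eq ?_) (mul_mem_slopeSub ih hx)
    push_cast
    ring

/-- If `p` is nilpotent on `Q`, then the filtration is equivalent to the image of `F`. -/
theorem exists_of_mem_slopeSub (hc : 0 ≤ c) {N : ℕ} (hN : (p : Q) ^ N = 0) {n : ℤ} {y : Q}
    (hy : y ∈ slopeSub F j p c n) : ∃ x ∈ F.sub (n - N * c), y = j x := by
  unfold slopeSub at hy
  induction hy using AddSubgroup.closure_induction with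
  | mem y hy =>
    obtain ⟨s, x, hx, rfl⟩ := hy
    rcases le_total N s with h | h
    · refine ⟨0, zero_mem _, ?_⟩
      rw [pow_eq_zero_of_le h hN, zero_mul, map_zero]
    · refine ⟨p ^ s • x, nsmul_mem (F.anti ?_ hx) _, ?_⟩
      · have : (s : ℤ) * c ≤ N * c := mul_le_mul_of_nonneg_right (by exact_mod_cast h) hc
        omega
      · rw [nsmul_eq_mul, map_mul, map_natCast, Nat.cast_pow]
  | zero => exact ⟨0, zero_mem _, (map_zero j).symm⟩
  | add y z _ _ hy hz =>
    obtain ⟨a, ha, rfl⟩ := hy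
    obtain ⟨b, hb, rfl⟩ := hz
    exact ⟨a + b, add_mem ha hb, (map_add j a b).symm⟩
  | neg y _ hy =>
    obtain ⟨a, ha, rfl⟩ := hy
    exact ⟨-a, neg_mem ha, (map_neg j a).symm⟩

end Slope

section Phi

open PerfCompletion RingFiltration

variable {p f : ℕ} [Fact p.Prime] {O : Type*} [CommRing O] [IsDomain O]

/-- The inverse of a variable has degree at least `-1` in the localization. -/
theorem exists_T_inv (i : Fin f) : ∃ v ∈ (locFiltration p O f).sub (-1),
    algebraMap _ (LocIwasawa p O f) (T p O f i) * v = 1 := by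
  classical
  obtain ⟨w, hw⟩ := (isUnit_prodT (p := p) (f := f) (O := O)).exists_left_inv
  refine ⟨w * algebraMap _ _ (∏ l ∈ Finset.univ.erase i, T p O f l),
    ⟨1, ∏ l ∈ Finset.univ.erase i, T p O f l, ?_, ?_⟩, ?_⟩
  · have h1 := Ideal.prod_mem_prod (s := Finset.univ.erase i) (I := fun _ : Fin f => idealT p O f)
      (x := fun l => T p O f l) fun l _ => Ideal.subset_span ⟨l, rfl⟩
    rw [Finset.prod_const, Finset.card_erase_of_mem (Finset.mem_univ _), Finset.card_univ,
      Fintype.card_fin] at h1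
    refine Ideal.pow_le_pow_right ?_ h1
    omega
  · rw [pow_one, mul_right_comm, hw, one_mul]
  · rw [mul_left_comm, ← map_mul, Finset.mul_prod_erase _ _ (Finset.mem_univ i)]
    exact hw

variable {κ : Type*} [Field κ] [Fintype κ] [DecidableEq κ] {ρ : O →+* κ}
  (hρ : IsUnramifiedReduction p f ρ) {Q : Type*} [CommRing Q]

include hρ

/-- Since `φ_q(T_i) = T_i ^ q + p y` with `y ∈ 𝔭`, the element `φ_q(T_i)` has degree `q` when a
factor `p` is counted with weight `q - 1`. -/
theorem iwasawaMul_T_mem_slopeSub (j : LocIwasawa p O f →+* Q) (i : Fin f) :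
    j (algebraMap _ _ (iwasawaMul p O (p ^ f) (T p O f i))) ∈
      slopeSub (locFiltration p O f) j p ((p : ℤ) ^ f - 1) ((p : ℤ) ^ f) := by
  obtain ⟨y, hy, h⟩ := hρ.exists_iwasawaMul_T_eq i
  rw [h, map_add, map_add, Nat.cast_smul_eq_nsmul, nsmul_eq_mul, map_mul, map_mul, map_natCast,
    map_natCast]
  refine add_mem (map_mem_slopeSub ?_) (mul_map_mem_slopeSub ?_)
  · have h1 : T p O f i ^ p ^ f ∈ idealT p O f ^ p ^ f :=
      Ideal.pow_mem_pow (show T p O f i ∈ idealT p O f from Ideal.subset_span ⟨i, rfl⟩) _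
    have h2 := algebraMap_mem_locFiltration h1
    rwa [Nat.cast_pow] at h2
  · rw [sub_sub_cancel]
    have h2 := algebraMap_mem_locFiltration (m := 1) (by rwa [pow_one] : y ∈ idealT p O f ^ 1)
    simpa using h2

/-- The weighted degree of `φ_q(x)` is at least `q` times the `𝔭`-adic order of `x`. As `p` is
nilpotent in `Q`, this makes `φ_q` continuous for the filtration on the localization. -/
theorem iwasawaMul_mem_slopeSub (j : LocIwasawa p O f →+* Q) {a : ℕ} {x : Iwasawa p O}
    (hx : x ∈ idealT p O f ^ a) : j (algebraMap _ _ (iwasawaMul p O (p ^ f) x)) ∈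
      slopeSub (locFiltration p O f) j p ((p : ℤ) ^ f - 1) (a * (p : ℤ) ^ f) := by
  have h0 : ∀ x : Iwasawa p O, j (algebraMap _ _ x) ∈
      slopeSub (locFiltration p O f) j p ((p : ℤ) ^ f - 1) 0 := fun x =>
    map_mem_slopeSub (algebraMap_mem_locFiltration (m := 0) (by simp))
  have h1 : ∀ x ∈ idealT p O f, j (algebraMap _ _ (iwasawaMul p O (p ^ f) x)) ∈
      slopeSub (locFiltration p O f) j p ((p : ℤ) ^ f - 1) ((p : ℤ) ^ f) := by
    intro x hx
    induction hx using Submodule.span_induction with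
    | mem x hx =>
      obtain ⟨i, rfl⟩ := hx
      exact iwasawaMul_T_mem_slopeSub hρ j i
    | zero => simp
    | add x y _ _ hx hy =>
      rw [map_add, map_add, map_add]
      exact add_mem hx hy
    | smul a x _ hx =>
      rw [smul_eq_mul, map_mul, map_mul, map_mul]
      have := mul_mem_slopeSub (h0 (iwasawaMul p O (p ^ f) a)) hx
      rwa [zero_add] at this
  induction a generalizing x with
  | zero =>
    rw [Nat.cast_zero, zero_mul]
    exact h0 _
  | succ a ih =>
    rw [pow_succ] at hx
    induction hx using Submodule.mul_induction_on' with
    | mem_mul_mem y hy z hz =>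
      rw [map_mul, map_mul, map_mul]
      refine slopeSub_anti (le_of_eq ?_) (mul_mem_slopeSub (ih hy) (h1 z hz))
      push_cast
      ring
    | add y _ z _ hy hz =>
      rw [map_add, map_add, map_add]
      exact add_mem hy hz

/-- As `φ_q(T_i) = T_i ^ q + p y_i`, the element `φ_q(T_i)` is invertible modulo powers of `p`. -/
theorem exists_iwasawaMul_T_inv (j : LocIwasawa p O f →+* Q) {N : ℕ} (hN : (p : Q) ^ N = 0)
    (i : Fin f) : ∃ v ∈ slopeSub (locFiltration p O f) j p ((p : ℤ) ^ f - 1) (-(p : ℤ) ^ f),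
      j (algebraMap _ _ (iwasawaMul p O (p ^ f) (T p O f i))) * v = 1 := by
  obtain ⟨y, hy, h⟩ := hρ.exists_iwasawaMul_T_eq i
  obtain ⟨v, hv, hTv⟩ := exists_T_inv (p := p) (O := O) i
  have hv' : v ^ p ^ f ∈ (locFiltration p O f).sub (-(p : ℤ) ^ f) := by
    have h1 : ∀ a : ℕ, v ^ a ∈ (locFiltration p O f).sub (-a) := by
      intro a
      induction a with
      | zero => simpa using (locFiltration p O f).one_mem
      | succ a ih =>
        rw [pow_succ]
        exact (locFiltration p O f).anti (by push_cast; omega)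
          ((locFiltration p O f).mul_mem ih hv)
    have h2 := h1 (p ^ f)
    rwa [Nat.cast_pow] at h2
  -- the geometric series for the inverse of `1 + p y T ^ (-q)`
  let u : Q := -((p : Q) * j (algebraMap _ _ y * v ^ p ^ f))
  have hu : u ∈ slopeSub (locFiltration p O f) j p ((p : ℤ) ^ f - 1) 0 := by
    refine neg_mem (mul_map_mem_slopeSub ?_)
    have h2 := algebraMap_mem_locFiltration (m := 1) (by rwa [pow_one] : y ∈ idealT p O f ^ 1)
    exact (locFiltration p O f).anti (by push_cast; omega) ((locFiltration p O f).mul_mem h2 hv')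
  have huN : u ^ N = 0 := by
    rw [neg_pow, mul_pow, hN, zero_mul, mul_zero]
  have h3 : j (algebraMap _ _ (iwasawaMul p O (p ^ f) (T p O f i))) * j (v ^ p ^ f) = 1 - u := by
    rw [h, ← map_mul, map_add, add_mul, map_pow, ← mul_pow, hTv, one_pow, Nat.cast_smul_eq_nsmul,
      map_nsmul, nsmul_eq_mul, map_add, map_one, mul_assoc, map_mul j (p : LocIwasawa p O f),
      map_natCast]
    simp only [u, sub_neg_eq_add]
  refine ⟨j (v ^ p ^ f) * ∑ s ∈ Finset.range N, u ^ s, ?_, ?_⟩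
  · have h4 : ∑ s ∈ Finset.range N, u ^ s ∈
        slopeSub (locFiltration p O f) j p ((p : ℤ) ^ f - 1) 0 := by
      refine sum_mem fun s _ => ?_
      simpa using pow_mem_slopeSub hu s
    have := mul_mem_slopeSub (map_mem_slopeSub hv') h4
    rwa [add_zero] at this
  · rw [← mul_assoc, h3, mul_neg_geom_sum, huN, sub_zero]

/-- The endomorphism of the Iwasawa algebra given by multiplication by `q` extends to the
localization modulo powers of `p`, continuously for the filtration. -/
theorem exists_locMul (j : LocIwasawa p O f →+* Q) {N : ℕ} (hN : (p : Q) ^ N = 0) :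
    ∃ h : LocIwasawa p O f →+* Q,
      (∀ x, h (algebraMap _ _ x) = j (algebraMap _ _ (iwasawaMul p O (p ^ f) x))) ∧
      ∀ n, ∃ m, ∀ x ∈ (locFiltration p O f).sub m, ∃ x' ∈ (locFiltration p O f).sub n,
        h x = j x' := by
  let m : Iwasawa p O →+* Q := (j.comp (algebraMap _ _)).comp (iwasawaMul p O (p ^ f)).toRingHom
  choose v hv hTv using exists_iwasawaMul_T_inv hρ j hN
  have hm : m (prodT p O f) * ∏ i, v i = 1 := by
    rw [prodT, map_prod, ← Finset.prod_mul_distrib]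
    exact Finset.prod_eq_one fun i _ => hTv i
  have hvm : ∏ i, v i ∈ slopeSub (locFiltration p O f) j p ((p : ℤ) ^ f - 1)
      (f * (-(p : ℤ) ^ f)) := by
    have h1 : ∀ s : Finset (Fin f), ∏ i ∈ s, v i ∈
        slopeSub (locFiltration p O f) j p ((p : ℤ) ^ f - 1) (s.card * (-(p : ℤ) ^ f)) := by
      classical
      intro s
      induction s using Finset.induction_on with
      | empty => simpa using one_mem_slopeSub
      | insert i s hi ih =>
        rw [Finset.prod_insert hi, Finset.card_insert_of_notMem hi]
        refine slopeSub_anti (le_of_eq ?_) (mul_mem_slopeSub (hv i) ih)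
        push_cast
        ring
    simpa using h1 Finset.univ
  have hq : 1 ≤ (p : ℤ) ^ f := by
    have := Nat.one_le_pow f p (Fact.out : p.Prime).pos
    exact_mod_cast this
  obtain ⟨h, hh⟩ : ∃ h : LocIwasawa p O f →+* Q, ∀ x, h (algebraMap _ _ x) = m x :=
    ⟨IsLocalization.Away.lift (prodT p O f) (IsUnit.of_mul_eq_one _ hm),
      fun x => IsLocalization.Away.lift_eq _ _ x⟩
  refine ⟨h, hh, fun n => ⟨max 0 (n + N * ((p : ℤ) ^ f - 1)), ?_⟩⟩
  rintro x ⟨l, P, hP, hx⟩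
  set n' := max 0 (n + N * ((p : ℤ) ^ f - 1)) with hn'
  have h1 : h x = m P * (∏ i, v i) ^ l := by
    have h2 := congrArg h hx
    rw [map_mul, map_pow, hh, hh] at h2
    rw [← h2, mul_assoc, ← mul_pow, hm, one_pow, mul_one]
  have h3 : h x ∈ slopeSub (locFiltration p O f) j p ((p : ℤ) ^ f - 1) (n' * (p : ℤ) ^ f) := by
    rw [h1]
    refine slopeSub_anti ?_ (mul_mem_slopeSub (iwasawaMul_mem_slopeSub hρ j hP)
      (pow_mem_slopeSub hvm l))
    have h4 := Int.self_le_toNat (n' + l * f)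
    nlinarith
  obtain ⟨x', hx', h4⟩ := exists_of_mem_slopeSub (by omega) hN h3
  refine ⟨x', (locFiltration p O f).anti ?_ hx', h4⟩
  have h5 : n + N * ((p : ℤ) ^ f - 1) ≤ n' := le_max_right _ _
  have h6 : (0 : ℤ) ≤ n' := le_max_left _ _
  nlinarith

end Phi

namespace Amv

section Exists

open PerfCompletion RingFiltration

variable {p f : ℕ} [Fact p.Prime] {O : Type*} (k : Type*) [CommRing O] [IsDomain O] [Field k]
  [CharP k p]
  (κ : Subfield k) [Fintype κ] [DecidableEq κ] {ρ : O →+* κ} (hρ : IsUnramifiedReduction p f ρ)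

include hρ

/-- Continuous homomorphisms from the completed localization modulo `p ^ n` are determined by
their values on the Iwasawa algebra. -/
theorem hom_quotient_eq {n : ℕ} {g g' : LocCompletion p O f →+*
    LocCompletion p O f ⧸ pIdeal p f O n}
    (hg : Continuous g) (hg' : Continuous g')
    (h : ∀ x : Iwasawa p O, g ((locFiltration p O f).of (algebraMap _ _ x)) =
      g' ((locFiltration p O f).of (algebraMap _ _ x))) : g = g' := by
  have := t2Space_quotient k κ hρ n
  have h2 : g.comp (locFiltration p O f).of = g'.comp (locFiltration p O f).of :=
    IsLocalization.ringHom_ext (Submonoid.powers (prodT p O f)) (RingHom.ext h)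
  exact RingHom.ext (congrFun ((locFiltration p O f).eq_of_eq_of hg hg' fun x => congrArg (· x) h2))

/-- The localization of the Iwasawa algebra is dense in each `B / p ^ n`, so that a continuous
endomorphism is determined by its values on the Iwasawa algebra. -/
theorem isPhiQ_unique {φ φ' : Amv p O f →ₐ[O] Amv p O f} (hφ : IsPhiQ p O f φ)
    (hφ' : IsPhiQ p O f φ') : φ = φ' := by
  ext x
  refine ext_ev fun n => ?_
  have h1 := hom_quotient_eq k κ hρ (n := n)
    (g := ((ev p f O n).comp φ.toRingHom).comp (ofB p f O))
    (g' := ((ev p f O n).comp φ'.toRingHom).comp (ofB p f O))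
    ((continuous_ev n).comp (hφ.continuous.comp continuous_ofB))
    ((continuous_ev n).comp (hφ'.continuous.comp continuous_ofB))
    (fun x => congrArg (ev p f O n) ((hφ.extends_mul x).trans (hφ'.extends_mul x).symm))
  have h2 : ∀ b, ev p f O n (φ (ofB p f O b)) = ev p f O n (φ' (ofB p f O b)) :=
    fun b => congrArg (· b) h1
  obtain ⟨b, z, rfl⟩ := exists_eq_ofB_add n x
  have h3 : ∀ ψ : Amv p O f →ₐ[O] Amv p O f, ev p f O n (ψ (p ^ n * z)) = 0 := fun ψ => by
    rw [map_mul, map_pow, map_natCast, ev_pow_mul]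
  rw [map_add, map_add, map_add, map_add, h2, h3, h3]

/-- The endomorphism `φ_q` modulo `p ^ n`, on the completed localization. -/
theorem exists_phi_level (n : ℕ) : ∃ h : LocCompletion p O f →+*
    LocCompletion p O f ⧸ pIdeal p f O n,
    Continuous h ∧ ∀ x : Iwasawa p O, h ((locFiltration p O f).of (algebraMap _ _ x)) =
      Ideal.Quotient.mk _ ((locFiltration p O f).of (algebraMap _ _ (iwasawaMul p O (p ^ f) x))) :=
        by
  have := t2Space_quotient k κ hρ n
  have hN : ((p : ℕ) : LocCompletion p O f ⧸ pIdeal p f O n) ^ n = 0 := by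
    rw [← map_natCast (Ideal.Quotient.mk _), ← map_pow, Ideal.Quotient.eq_zero_iff_mem]
    exact mem_pIdeal.2 ⟨1, by rw [mul_one]⟩
  obtain ⟨h, hh, hc⟩ := exists_locMul hρ
    ((Ideal.Quotient.mk (pIdeal p f O n)).comp (locFiltration p O f).of) hN
  obtain ⟨g, hg, hgh⟩ := (locFiltration p O f).exists_extension (completeSpace_quotient n) h (by
    intro U hU
    have h1 := (continuous_mk (p := p) (f := f) (O := O) n).tendsto 0
    rw [map_zero] at h1
    obtain ⟨a, -, ha⟩ := (locFiltration p O f).hasBasis_hat.mem_iff.1 (h1 hU)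
    obtain ⟨m, hm⟩ := hc a
    refine ⟨m, fun x hx => ?_⟩
    obtain ⟨x', hx', h2⟩ := hm x hx
    rw [h2]
    exact ha ((locFiltration p O f).of_mem_hat.2 hx'))
  exact ⟨g, hg, fun x => (hgh _).trans (hh x)⟩

/-- The endomorphism `φ_q` of `A_mv` is the limit of the endomorphisms modulo `p ^ n`. -/
theorem exists_isPhiQ : ∃ φ : Amv p O f →ₐ[O] Amv p O f, IsPhiQ p O f φ := by
  choose h hh hx using exists_phi_level (f := f) k κ hρ
  have hpI : ∀ n, ∀ b ∈ pIdeal p f O n, h n b = 0 := by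
    intro n b hb
    obtain ⟨c, rfl⟩ := mem_pIdeal.1 hb
    obtain ⟨d, hd⟩ := Ideal.Quotient.mk_surjective (h n c)
    rw [map_mul, map_pow, map_natCast, ← hd, ← map_natCast (Ideal.Quotient.mk _), ← map_pow,
      ← map_mul, Ideal.Quotient.eq_zero_iff_mem]
    exact mem_pIdeal.2 ⟨d, rfl⟩
  let g : ∀ n, Amv p O f →+* LocCompletion p O f ⧸ pIdeal p f O n := fun n =>
    (Ideal.Quotient.lift (pIdeal p f O n) (h n) (hpI n)).comp (ev p f O n)
  have hg : ∀ n b, g n (ofB p f O b) = h n b := fun _ _ => rfl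
  have hcont : ∀ n, Continuous (g n) := fun n =>
    (continuous_quot_lift _ (hh n)).comp (continuous_ev n)
  obtain ⟨φ, hφ⟩ := exists_hom g (by
    intro m n hmn x
    have hc : Continuous (Ideal.Quotient.factor (pIdeal_anti (p := p) (f := f) (O := O) hmn)) :=
      continuous_quot_lift _ (continuous_mk m)
    have h1 := hom_quotient_eq k κ hρ (g := (Ideal.Quotient.factor (pIdeal_anti hmn)).comp (h n))
      (g' := h m) (hc.comp (hh n)) (hh m) (fun x => by
        rw [RingHom.comp_apply, hx, hx]
        rfl)
    obtain ⟨b, z, rfl⟩ := exists_eq_ofB_add n x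
    have h2 : g n ((p : Amv p O f) ^ n * z) = 0 := by
      change Ideal.Quotient.lift (pIdeal p f O n) (h n) (hpI n) (ev p f O n _) = 0
      rw [ev_pow_mul, map_zero]
    have h3 : g m ((p : Amv p O f) ^ n * z) = 0 := by
      change Ideal.Quotient.lift (pIdeal p f O m) (h m) (hpI m) (ev p f O m _) = 0
      obtain ⟨l, rfl⟩ := Nat.exists_eq_add_of_le hmn
      rw [pow_add, mul_assoc, ev_pow_mul, map_zero]
    rw [map_add, h2, add_zero, map_add, h3, add_zero, hg, hg]
    exact congrArg (· b) h1)
  have hφx : ∀ x, φ (toAmv p O f x) = toAmv p O f (iwasawaMul p O (p ^ f) x) := fun x =>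
    ext_ev fun n => (hφ n _).trans (hx n x)
  refine ⟨⟨φ, fun c => ?_⟩, continuous_iff.2 fun n => ?_, hφx⟩
  · have h1 := hφx (algebraMap O _ c)
    rw [AlgHom.commutes, toAmv_algebraMap] at h1
    exact h1
  · have h1 : (fun x => ev p f O n (φ x)) = g n := funext fun x => hφ n x
    exact h1 ▸ hcont n

omit [CharP k p] in
variable {k κ} in
/-- The endomorphism `φ_q` lifts the `q`-power map. -/
theorem exists_phi_eq [CharP k p] {φ : Amv p O f →ₐ[O] Amv p O f} (hφ : IsPhiQ p O f φ)
    (x : Amv p O f) :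
    ∃ y, φ x = x ^ p ^ f + p * y := by
  obtain ⟨π, hπ⟩ := exists_isRed (k := k) hρ
  have hpow : ∀ x : (perfFiltration p f k).Completion,
      iterateFrobenius _ p f x = x ^ p ^ f := fun x => iterateFrobenius_def p f x
  have h1 : π.comp φ.toRingHom = (iterateFrobenius _ p f).comp π := by
    refine hom_eq hρ (hπ.continuous.comp hφ.continuous) ?_ (fun c => ?_) fun i => ?_
    · change Continuous fun x => iterateFrobenius _ p f (π x)
      simp only [hpow]
      exact hπ.continuous.pow _
    · change π (φ _) = iterateFrobenius _ p f (π _)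
      rw [AlgHom.commutes, hπ.map_algebraMap, hpow, ← map_pow, AddMonoidAlgebra.single_pow,
        smul_zero, ← SubmonoidClass.coe_pow, ← hρ.card, FiniteField.pow_card]
    · change π (φ _) = iterateFrobenius _ p f (π _)
      obtain ⟨y, -, hy⟩ := hρ.exists_iwasawaMul_T_eq i
      rw [hφ.extends_mul, hy, map_add, map_add, map_pow, map_pow, Nat.cast_smul_eq_nsmul,
        map_nsmul, map_nsmul, nsmul_eq_mul, CharP.cast_eq_zero, zero_mul, add_zero, hpow]
  obtain ⟨y, hy⟩ := hπ.exists_of_eq_zero (φ x - x ^ p ^ f) (by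
    have h2 : π (φ x) = iterateFrobenius _ p f (π x) := congrArg (· x) h1
    rw [map_sub, h2, hpow, map_pow, sub_self])
  exact ⟨y, by rw [← hy, add_sub_cancel]⟩

end Exists

end Amv
end MvIwasawa
end

noncomputable section
namespace MvIwasawa

/-! ### Rings of integers as reductions -/

section PowComplete

variable {R : Type*} [CommRing R] {t : R}

theorem IsPowComplete.isAdicComplete (h : IsPowComplete t R) :
    IsAdicComplete (Ideal.span {t}) R := by
  have hm : ∀ (n : ℕ) (x : R), x ∈ (Ideal.span {t} ^ n • ⊤ : Submodule R R) ↔ ∃ z, x = t ^ n • z :=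
    by
    intro n x
    rw [smul_eq_mul, Ideal.mul_top, Ideal.span_singleton_pow, Ideal.mem_span_singleton]
    rfl
  refine @IsAdicComplete.mk _ _ _ _ _ _ ⟨fun x hx => h.haus x fun n => ?_⟩ ⟨fun s hs => ?_⟩
  · exact (hm n x).1 (SModEq.zero.1 (hx n))
  · obtain ⟨l, hl⟩ := h.exists_limit s fun n =>
      (hm n _).1 (SModEq.sub_mem.1 (hs n.le_succ).symm)
    exact ⟨l, fun n => SModEq.sub_mem.2 ((Submodule.neg_mem_iff _).1
      (by rw [neg_sub]; exact (hm n _).2 (hl n)))⟩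

theorem isUnit_one_sub_mul (h : IsPowComplete t R) (a : R) : IsUnit (1 - t * a) := by
  obtain ⟨s, hs⟩ := h.prec fun k => a ^ k
  refine IsUnit.of_mul_eq_one s (sub_eq_zero.1 (h.haus _ fun n => ?_))
  obtain ⟨z, rfl⟩ := hs n
  refine ⟨(1 - t * a) * z - a ^ n, ?_⟩
  have h1 : ∑ k ∈ Finset.range n, t ^ k • a ^ k = ∑ k ∈ Finset.range n, (t * a) ^ k :=
    Finset.sum_congr rfl fun k _ => by rw [smul_eq_mul, mul_pow]
  rw [h1, mul_add, mul_neg_geom_sum, smul_eq_mul, smul_eq_mul, mul_pow]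
  ring

/-- In a `t`-adically complete ring, `1 - t a` is invertible, so that `t` lies in every maximal
ideal. -/
theorem mem_of_isMaximal (h : IsPowComplete t R) (m : Ideal R) [hm : m.IsMaximal] : t ∈ m := by
  by_contra ht
  obtain ⟨a, b, hb, hab⟩ := hm.exists_inv ht
  have h1 : b = 1 - t * a := by rw [← hab]; ring
  exact hm.ne_top (Ideal.eq_top_of_isUnit_mem _ hb (h1 ▸ isUnit_one_sub_mul h a))

end PowComplete

section IntegerRing

variable {p : ℕ} [Fact p.Prime] (L : Type*) [Field L] [Algebra ℚ_[p] L] [FiniteDimensional ℚ_[p] L]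

variable (p) in
/-- The ring of integers is a free `ℤ_p`-module of rank equal to the degree. -/
theorem exists_integerRing_equiv : ∃ e : integerRing p L ≃+ (Fin (Module.finrank ℚ_[p] L) → ℤ_[p]),
    ∀ (n : ℕ) x, e (n * x) = n • e x := by
  let : Algebra ℤ_[p] L := Algebra.compHom L (algebraMap ℤ_[p] ℚ_[p])
  have : IsScalarTower ℤ_[p] ℚ_[p] L := IsScalarTower.of_algebraMap_eq fun _ => rfl
  have : Module.IsTorsionFree ℤ_[p] L := Module.IsTorsionFree.trans_faithfulSMul ℤ_[p] ℚ_[p] L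
  have h1 := IsIntegralClosure.rank ℤ_[p] ℚ_[p] L (integralClosure ℤ_[p] L)
  have h2 := IsIntegralClosure.module_free ℤ_[p] ℚ_[p] L (integralClosure ℤ_[p] L)
  have h3 := IsIntegralClosure.finite ℤ_[p] ℚ_[p] L (integralClosure ℤ_[p] L)
  let e : integralClosure ℤ_[p] L ≃+ (Fin (Module.finrank ℚ_[p] L) → ℤ_[p]) :=
    ((Module.finBasisOfFinrankEq ℤ_[p] (integralClosure ℤ_[p] L) h1).equivFun).toAddEquiv
  refine ⟨e, fun n x => ?_⟩
  rw [← nsmul_eq_mul]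
  exact map_nsmul e n x

variable (p) in
theorem isPowComplete_integerRing :
    IsPowComplete (p : integerRing p L) (integerRing p L) := by
  obtain ⟨e, he⟩ := exists_integerRing_equiv p L
  have h0 : IsAdicComplete (Ideal.span {(p : ℤ_[p])}) ℤ_[p] := by
    rw [← PadicInt.maximalIdeal_eq_span_p]
    infer_instance
  have h1 : IsPowComplete (p : ℤ_[p]) ℤ_[p] := isPowComplete_of_isAdicComplete _ _
  have h2 := h1.pi (Fin (Module.finrank ℚ_[p] L))
  have h3 : ∀ (n : ℕ) x, e ((p : integerRing p L) ^ n • x) = (p : ℤ_[p]) ^ n • e x := by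
    intro n x
    rw [smul_eq_mul, ← Nat.cast_pow, he, ← Nat.cast_pow, Nat.cast_smul_eq_nsmul]
  constructor
  · intro x hx
    have h4 : e x = 0 := h2.haus _ fun n => by
      obtain ⟨z, rfl⟩ := hx n
      exact ⟨e z, h3 n z⟩
    exact (map_eq_zero_iff e e.injective).1 h4
  · intro m
    obtain ⟨s, hs⟩ := h2.prec fun n => e (m n)
    refine ⟨e.symm s, fun n => ?_⟩
    obtain ⟨z, hz⟩ := hs n
    refine ⟨e.symm z, e.injective ?_⟩
    rw [e.apply_symm_apply, hz, map_add, map_sum, h3, e.apply_symm_apply]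
    simp only [h3]

variable (p) in
/-- The quotient of the ring of integers by `p` is isomorphic to `(ℤ/p) ^ [L : ℚ_p]` as an
additive group. -/
theorem exists_integerRing_mod_p :
    ∃ θ : integerRing p L →+ (Fin (Module.finrank ℚ_[p] L) → ZMod p), Function.Surjective θ ∧
      ∀ x, θ x = 0 ↔ ∃ y, x = p * y := by
  obtain ⟨e, he⟩ := exists_integerRing_equiv p L
  let τ : (Fin (Module.finrank ℚ_[p] L) → ℤ_[p]) →+ (Fin (Module.finrank ℚ_[p] L) → ZMod p) :=
    (PadicInt.toZMod (p := p)).toAddMonoidHom.compLeft _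
  have hτ : ∀ v i, τ v i = PadicInt.toZMod (v i) := fun _ _ => rfl
  refine ⟨τ.comp e.toAddMonoidHom, fun v => ?_, fun x => ⟨fun hx => ?_, ?_⟩⟩
  · refine ⟨e.symm fun i => (v i).val, ?_⟩
    ext i
    change τ (e (e.symm _)) i = _
    rw [e.apply_symm_apply, hτ, map_natCast, ZMod.natCast_zmod_val]
  · have h1 : ∀ i, ∃ z, e x i = p * z := by
      intro i
      have h2 : e x i ∈ RingHom.ker (PadicInt.toZMod (p := p)) := congrFun hx i
      rw [PadicInt.ker_toZMod, PadicInt.maximalIdeal_eq_span_p, Ideal.mem_span_singleton] at h2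
      exact h2
    choose z hz using h1
    refine ⟨e.symm z, e.injective ?_⟩
    rw [he, e.apply_symm_apply]
    ext i
    rw [hz, Pi.smul_apply, nsmul_eq_mul]
  · rintro ⟨y, rfl⟩
    ext i
    change τ (e (p * y)) i = 0
    rw [he, hτ, Pi.smul_apply, map_nsmul, nsmul_eq_mul, CharP.cast_eq_zero, zero_mul]

theorem card_of_integerRing {κ : Type*} [AddCommGroup κ] (ρ : integerRing p L →+ κ)
    (hρ : Function.Surjective ρ) (h0 : ∀ x, ρ x = 0 ↔ ∃ y, x = p * y) :
    Nat.card κ = p ^ Module.finrank ℚ_[p] L := by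
  obtain ⟨θ, hθ, hθ0⟩ := exists_integerRing_mod_p p L
  have h1 : θ.ker = ρ.ker := by
    ext x
    rw [AddMonoidHom.mem_ker, AddMonoidHom.mem_ker, h0, hθ0]
  have e1 := QuotientAddGroup.quotientKerEquivOfSurjective θ hθ
  have e2 := QuotientAddGroup.quotientKerEquivOfSurjective ρ hρ
  rw [← Nat.card_congr e2.toEquiv, ← h1, Nat.card_congr e1.toEquiv, Nat.card_eq_fintype_card,
    Fintype.card_fun, ZMod.card, Fintype.card_fin]

theorem natCast_integerRing_ne_zero : (p : integerRing p L) ≠ 0 := by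
  intro h
  have h1 : ((p : integerRing p L) : L) = 0 := by rw [h]; rfl
  have h2 : (p : L) = 0 := h1
  rw [← map_natCast (algebraMap ℚ_[p] L), map_eq_zero_iff _ (algebraMap ℚ_[p] L).injective] at h2
  exact (Fact.out : p.Prime).ne_zero (Nat.cast_eq_zero.1 h2)

theorem natCast_resField_eq_zero : (p : resField p L) = 0 := by
  rw [← map_natCast (IsLocalRing.residue (integerRing p L)), IsLocalRing.residue_eq_zero_iff]
  exact mem_of_isMaximal (isPowComplete_integerRing p L) _

instance charP_resField : CharP (resField p L) p :=
  (CharP.charP_iff_prime_eq_zero Fact.out).2 (natCast_resField_eq_zero L)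

instance finite_resField : Finite (resField p L) := by
  obtain ⟨θ, hθ, hθ0⟩ := exists_integerRing_mod_p p L
  have h1 : ∀ v, ∃ x, θ x = v := hθ
  choose g hg using h1
  refine Finite.of_surjective (fun v => IsLocalRing.residue (integerRing p L) (g v)) fun u => ?_
  obtain ⟨x, rfl⟩ := IsLocalRing.residue_surjective u
  refine ⟨θ x, ?_⟩
  obtain ⟨y, hy⟩ := (hθ0 (g (θ x) - x)).1 (by rw [map_sub, hg, sub_self])
  rw [← sub_eq_zero, ← map_sub, hy, map_mul, map_natCast, natCast_resField_eq_zero, zero_mul]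

/-- If `p` generates a maximal ideal of the ring of integers, then every homomorphism to a field of
characteristic `p` is a reduction map onto a subfield with `p ^ [L : ℚ_p]` elements. -/
theorem exists_isUnramifiedReduction (hL : (Ideal.span {(p : integerRing p L)}).IsMaximal)
    {k : Type*} [Field k] [CharP k p] (r : integerRing p L →+* k) :
    ∃ (κ : Subfield k) (ρ : integerRing p L →+* κ) (_ : Fintype κ),
      IsUnramifiedReduction p (Module.finrank ℚ_[p] L) ρ ∧ ∀ x, (ρ x : k) = r x := by
  let : Field (integerRing p L ⧸ Ideal.span {(p : integerRing p L)}) := Ideal.Quotient.field _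
  have h0 : ∀ a ∈ Ideal.span {(p : integerRing p L)}, r a = 0 := by
    intro a ha
    obtain ⟨b, rfl⟩ := Ideal.mem_span_singleton.1 ha
    rw [map_mul, map_natCast, CharP.cast_eq_zero, zero_mul]
  let r' : integerRing p L ⧸ Ideal.span {(p : integerRing p L)} →+* k := Ideal.Quotient.lift _ r h0
  let ρ : integerRing p L →+* r'.fieldRange := r'.rangeRestrictField.comp (Ideal.Quotient.mk _)
  have hρ : ∀ x, (ρ x : k) = r x := fun x => rfl
  have hsurj : Function.Surjective ρ :=
    r'.rangeRestrictField_bijective.2.comp Ideal.Quotient.mk_surjective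
  have hker : ∀ x, ρ x = 0 ↔ ∃ y, x = p * y := by
    intro x
    change r'.rangeRestrictField _ = 0 ↔ _
    rw [map_eq_zero_iff _ r'.rangeRestrictField_bijective.1, Ideal.Quotient.eq_zero_iff_mem,
      Ideal.mem_span_singleton]
    exact Iff.rfl
  have hcard : Nat.card r'.fieldRange = p ^ Module.finrank ℚ_[p] L :=
    card_of_integerRing L ρ.toAddMonoidHom hsurj hker
  have hfin : Finite r'.fieldRange :=
    Nat.finite_of_card_ne_zero (by rw [hcard]; exact pow_ne_zero _ (Fact.out : p.Prime).ne_zero)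
  have hft : Fintype r'.fieldRange := Fintype.ofFinite _
  refine ⟨r'.fieldRange, ρ, hft, ⟨(isPowComplete_integerRing p L).isAdicComplete,
    natCast_integerRing_ne_zero L, hsurj, fun x hx => (hker x).1 hx, ?_, inferInstance⟩, hρ⟩
  rw [← hcard, Nat.card_eq_fintype_card]

end IntegerRing
end MvIwasawa
end

noncomputable section
namespace MvIwasawa

/-! ### Faithful flatness and base change -/

section BaseChange

attribute [local instance] Algebra.TensorProduct.rightAlgebra in
/-- Faithful flatness of an algebra homomorphism is preserved by extension of scalars. -/
theorem faithfullyFlat_tensorMap {R S S' T : Type*} [CommRing R] [CommRing S] [CommRing S']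
    [CommRing T] [Algebra R S] [Algebra R S'] [Algebra R T] (g : S →ₐ[R] S')
    (hg : g.toRingHom.FaithfullyFlat) :
    (Algebra.TensorProduct.map (AlgHom.id T T) g).toRingHom.FaithfullyFlat := by
  let : Algebra S S' := g.toRingHom.toAlgebra
  let : Algebra (T ⊗[R] S) (T ⊗[R] S') :=
    (Algebra.TensorProduct.map (AlgHom.id T T) g).toRingHom.toAlgebra
  let : Algebra S (T ⊗[R] S') :=
    ((algebraMap S' (T ⊗[R] S')).comp (algebraMap S S')).toAlgebra
  have h1 : IsScalarTower R S S' := .of_algebraMap_eq fun x => (g.commutes x).symm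
  have h2 : IsScalarTower S S' (T ⊗[R] S') := .of_algebraMap_eq fun x => rfl
  have h3 : IsScalarTower S (T ⊗[R] S) (T ⊗[R] S') := .of_algebraMap_eq fun x => by
    change (1 : T) ⊗ₜ[R] g x = Algebra.TensorProduct.map (AlgHom.id T T) g (1 ⊗ₜ x)
    rw [Algebra.TensorProduct.map_tmul]
    rfl
  have h4 : IsScalarTower T (T ⊗[R] S) (T ⊗[R] S') := .of_algebraMap_eq fun x =>
    ((Algebra.TensorProduct.map (AlgHom.id T T) g).commutes x).symm
  have h5 : IsScalarTower R (T ⊗[R] S) (T ⊗[R] S') := .of_algebraMap_eq fun x =>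
    (((Algebra.TensorProduct.map (AlgHom.id T T) g).restrictScalars R).commutes x).symm
  have h6 : Algebra.IsPushout R S T (T ⊗[R] S) := inferInstance
  have h7 : Algebra.IsPushout R S' T (T ⊗[R] S') := inferInstance
  have h8 : Algebra.IsPushout S S' (T ⊗[R] S) (T ⊗[R] S') :=
    (Algebra.IsPushout.comp_iff R S T (T ⊗[R] S)).1 h7
  have h9 : Module.FaithfullyFlat S S' := hg
  exact Module.FaithfullyFlat.of_linearEquiv _ _ h8.symm.out.equiv.symm

end BaseChange

end MvIwasawa
end

noncomputable section
namespace MvIwasawa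

/-! ### The Witt vectors of `A_∞` and the ring `A_{mv,E₀}` -/

section Witt

open PerfCompletion

variable {p f : ℕ} [Fact p.Prime] {k : Type*} [Field k] [CharP k p]

instance charP_aInf : CharP (AInf p f k) p :=
  inferInstanceAs (CharP (perfFiltration p f k).Completion p)

instance perfectRing_aInf [PerfectRing k p] : PerfectRing (AInf p f k) p :=
  inferInstanceAs (PerfectRing (perfFiltration p f k).Completion p)

variable (p f k) in
/-- The reduction `W(A_∞) → A_∞`. -/
def wittRed : WittVector p (AInf p f k) →+* (perfFiltration p f k).Completion :=
  (WittVector.constantCoeff : WittVector p (AInf p f k) →+* AInf p f k)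

theorem surjective_wittRed : Function.Surjective (wittRed p f k) :=
  WittVector.constantCoeff_surjective p

theorem wittRed_map (x : WittVector p (AInf p f k)) :
    wittRed p f k (WittVector.map (phiInf p f k) x) = phi p f k (wittRed p f k x) := rfl

theorem wittRed_algebraMap (c : WittVector p k) :
    wittRed p f k (algebraMap (WittVector p k) (WittVector p (AInf p f k)) c) =
      (perfFiltration p f k).of (AddMonoidAlgebra.single 0 (c.coeff 0)) := rfl

theorem map_phiInf_algebraMap (c : WittVector p k) :
    WittVector.map (phiInf p f k) (algebraMap (WittVector p k) (WittVector p (AInf p f k)) c) =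
      algebraMap (WittVector p k) (WittVector p (AInf p f k)) c := by
  ext n
  change phi p f k ((perfFiltration p f k).of (AddMonoidAlgebra.single 0 (c.coeff n))) =
    (perfFiltration p f k).of (AddMonoidAlgebra.single 0 (c.coeff n))
  rw [phi_of_single, smul_zero]

theorem wittRed_natCast : wittRed p f k p = 0 := by
  rw [map_natCast, CharP.cast_eq_zero]

section Perfect

variable [PerfectRing k p]

theorem wittRed_eq_zero_iff (x : WittVector p (AInf p f k)) :
    wittRed p f k x = 0 ↔ (p : WittVector p (AInf p f k)) ∣ x := by
  rw [← Ideal.mem_span_singleton]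
  exact (WittVector.mem_span_p_iff_coeff_zero_eq_zero x).symm

theorem isPowComplete_witt (F : Type*) [CommRing F] [CharP F p] [PerfectRing F p] :
    IsPowComplete (p : WittVector p F) (WittVector p F) :=
  isPowComplete_of_isAdicComplete _ _

variable (p f k) in
/-- The automorphism of `W(A_∞)` induced by `φ_q`. -/
def wittPhi : WittVector p (AInf p f k) ≃+* WittVector p (AInf p f k) :=
  RingEquiv.ofBijective (WittVector.map (phiInf p f k))
    ⟨WittVector.map_injective _ (bijective_phi (p := p) (f := f) (k := k)).1,
      WittVector.map_surjective _ (bijective_phi (p := p) (f := f) (k := k)).2⟩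

theorem wittPhi_apply (x : WittVector p (AInf p f k)) :
    wittPhi p f k x = WittVector.map (phiInf p f k) x := rfl

end Perfect

theorem tInf_eq (i : Fin f) : tInf p f k i = mon p f k (intExp p f (Pi.single i 1)) := by
  have h : intExp p f (Pi.single i 1) = Pi.single i ⟨1, 0, 1, by simp⟩ := by
    ext j
    by_cases hj : j = i
    · subst hj
      simp [intExp]
    · simp [intExp, hj]
  rw [mon, h]
  rfl

end Witt

/-- If `t` is separated on `M` and `R` is `t`-adically complete, then a finite family which
generates `M` modulo `t` generates `M`. -/
theorem IsPowComplete.exists_sum {R M ι : Type*} [CommRing R] [AddCommGroup M] [Module R M]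
    [Fintype ι] {t : R} (hR : IsPowComplete t R) (hM : IsPowComplete t M) (w : ι → M)
    (h : ∀ x, ∃ (c : ι → R) (y : M), x = ∑ i, c i • w i + t • y) (x : M) :
    ∃ c : ι → R, x = ∑ i, c i • w i := by
  choose c y hxy using h
  let X : ℕ → M := Nat.rec x fun _ x => y x
  have hX : ∀ n, x = ∑ i, (∑ m ∈ Finset.range n, t ^ m • c (X m) i) • w i + t ^ n • X n := by
    intro n
    induction n with
    | zero => simp [X]
    | succ n ih =>
      have h1 : X n = ∑ i, c (X n) i • w i + t • X (n + 1) := hxy (X n)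
      rw [ih]
      rw [h1]
      simp only [Finset.sum_range_succ, add_smul, Finset.sum_add_distrib, smul_add, Finset.smul_sum,
        smul_smul, smul_eq_mul, pow_succ, add_assoc]
  choose s hs using fun i => hR.prec fun n => c (X n) i
  refine ⟨s, sub_eq_zero.1 (hM.haus _ fun n => ?_)⟩
  choose z hz using fun i => hs i n
  refine ⟨X n - ∑ i, z i • w i, ?_⟩
  simp only [hz]
  nth_rewrite 1 [hX n]
  simp only [add_smul, Finset.sum_add_distrib, smul_sub, Finset.smul_sum, smul_smul, smul_eq_mul]
  abel

section Generators

open PerfCompletion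

variable {p f : ℕ} [Fact p.Prime] {O k : Type*} [CommRing O] [IsDomain O] [Field k] [CharP k p]
  [Finite k] {κ : Subfield k} [Fintype κ] [DecidableEq κ] {ρ : O →+* κ}
  (hρ : IsUnramifiedReduction p f ρ) [Algebra O (WittVector p k)]
  (hO : ∀ c : O, (algebraMap O (WittVector p k) c).coeff 0 = (ρ c : k))

include hρ hO

/-- Lifts of a basis of `k` over `κ` generate `W(k)` over `O`. -/
theorem exists_sum_witt {d : ℕ} (b : Module.Basis (Fin d) κ k) (x : WittVector p k) :
    ∃ c : Fin d → O, x = ∑ i, c i • WittVector.teichmuller p (b i) := by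
  have h1 := isPowComplete_witt (p := p) k
  have h2 : IsPowComplete (p : O) (WittVector p k) := by
    have h3 : ∀ (n : ℕ) (z : WittVector p k), (p : O) ^ n • z = (p : WittVector p k) ^ n • z := by
      intro n z
      rw [Algebra.smul_def, map_pow, map_natCast, smul_eq_mul]
    refine ⟨fun x hx => h1.haus x fun n => ?_, fun m => ?_⟩
    · obtain ⟨z, hz⟩ := hx n
      exact ⟨z, by rw [hz, h3]⟩
    · obtain ⟨s, hs⟩ := h1.prec m
      refine ⟨s, fun n => ?_⟩
      simpa only [h3] using hs n
  refine hρ.isPowComplete.exists_sum h2 _ (fun x => ?_) x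
  choose c hc using fun i => hρ.surjective (b.repr (x.coeff 0) i)
  have h4 : (x - ∑ i, c i • WittVector.teichmuller p (b i)).coeff 0 = 0 := by
    have h5 : (WittVector.constantCoeff (x - ∑ i, c i • WittVector.teichmuller p (b i)) : k) =
        x.coeff 0 - ∑ i, b.repr (x.coeff 0) i • b i := by
      rw [map_sub, map_sum]
      congr 1
      refine Finset.sum_congr rfl fun i _ => ?_
      rw [Algebra.smul_def, map_mul, ← hc]
      change (algebraMap O (WittVector p k) (c i)).coeff 0 * _ = _
      rw [hO]
      change _ * (WittVector.teichmuller p (b i)).coeff 0 = _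
      rw [WittVector.teichmuller_coeff_zero]
      rfl
    rw [b.sum_repr, sub_self] at h5
    exact h5
  rw [← WittVector.mem_span_p_iff_coeff_zero_eq_zero, Ideal.mem_span_singleton] at h4
  obtain ⟨y, hy⟩ := h4
  refine ⟨c, y, ?_⟩
  rw [Algebra.smul_def (p : O), map_natCast, ← hy, add_sub_cancel]

/-- The Teichmüller lifts of a basis of the residue field extension generate `A_{mv,E₀}` over
`A_mv`. -/
theorem exists_sum_amvE0 {d : ℕ} (b : Module.Basis (Fin d) κ k) (x : AmvE0 p O f k) :
    ∃ a : Fin d → Amv p O f, x = ∑ i, WittVector.teichmuller p (b i) ⊗ₜ a i := by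
  induction x using TensorProduct.induction_on with
  | zero => exact ⟨0, by simp⟩
  | tmul w a =>
    obtain ⟨c, hc⟩ := exists_sum_witt hρ hO b w
    refine ⟨fun i => c i • a, ?_⟩
    rw [hc, TensorProduct.sum_tmul]
    exact Finset.sum_congr rfl fun i _ => TensorProduct.smul_tmul _ _ _
  | add x y hx hy =>
    obtain ⟨a, rfl⟩ := hx
    obtain ⟨a', rfl⟩ := hy
    refine ⟨a + a', ?_⟩
    rw [← Finset.sum_add_distrib]
    exact Finset.sum_congr rfl fun i _ => (TensorProduct.tmul_add _ _ _).symm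

omit [Finite k] [Algebra O (WittVector p k)] hO in
/-- The ring `A_mv` is `p`-adically complete, and `A_mv / p` is the ring of elements with integral
exponents, which is Noetherian. -/
theorem isNoetherianRing_amv : IsNoetherianRing (Amv p O f) := by
  have : NeZero f := ⟨hρ.ne_zero_f⟩
  obtain ⟨π, hπ⟩ := Amv.exists_isRed (k := k) hρ
  have h1 : RingHom.ker π = Ideal.span {(p : Amv p O f)} := by
    ext x
    rw [RingHom.mem_ker, Ideal.mem_span_singleton]
    refine ⟨hπ.exists_of_eq_zero x, ?_⟩
    rintro ⟨y, rfl⟩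
    rw [map_mul, map_natCast, CharP.cast_eq_zero, zero_mul]
  have h2 : π.range = intSubring p f κ := by
    ext x
    exact ⟨by rintro ⟨y, rfl⟩; exact hπ.mem_intSubring y, hπ.exists_eq x⟩
  have h3 : IsNoetherianRing (intSubring p f κ) := isNoetherianRing_intSubring κ
  rw [← h2] at h3
  have h4 : IsNoetherianRing (Amv p O f ⧸ RingHom.ker π) :=
    isNoetherianRing_of_ringEquiv _ (RingHom.quotientKerEquivRange π).symm
  rw [h1] at h4
  exact Amv.isPowComplete.isNoetherianRing

attribute [local instance] Algebra.TensorProduct.rightAlgebra in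
theorem finite_amvE0 : Module.Finite (Amv p O f) (AmvE0 p O f k) := by
  let b := Module.finBasis κ k
  refine Module.Finite.of_surjective (Fintype.linearCombination (Amv p O f)
    fun i => WittVector.teichmuller p (b i) ⊗ₜ[O] (1 : Amv p O f)) fun x => ?_
  obtain ⟨a, rfl⟩ := exists_sum_amvE0 hρ hO b x
  refine ⟨a, ?_⟩
  rw [Fintype.linearCombination_apply]
  refine Finset.sum_congr rfl fun i _ => ?_
  rw [Algebra.smul_def]
  change ((1 : WittVector p k) ⊗ₜ[O] a i) * _ = _
  rw [Algebra.TensorProduct.tmul_mul_tmul, one_mul, mul_one]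

attribute [local instance] Algebra.TensorProduct.rightAlgebra in
theorem isNoetherianRing_amvE0 : IsNoetherianRing (AmvE0 p O f k) := by
  have := isNoetherianRing_amv (k := k) hρ
  have := finite_amvE0 (f := f) hρ hO
  exact IsNoetherianRing.of_finite (Amv p O f) _

attribute [local instance] Algebra.TensorProduct.rightAlgebra in
theorem natCast_mem_of_isMaximal (m : Ideal (AmvE0 p O f k)) [m.IsMaximal] :
    (p : AmvE0 p O f k) ∈ m := by
  have := finite_amvE0 (f := f) hρ hO
  have h1 : (m.comap (algebraMap (Amv p O f) (AmvE0 p O f k))).IsMaximal :=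
    Ideal.isMaximal_comap_of_isIntegral_of_isMaximal m
  have h2 := mem_of_isMaximal Amv.isPowComplete (m.comap (algebraMap (Amv p O f) (AmvE0 p O f k)))
  rw [Ideal.mem_comap, map_natCast] at h2
  exact h2

end Generators

end MvIwasawa
end

noncomputable section
namespace MvIwasawa

/-! ### The comparison map -/

section Compare

open PerfCompletion

variable {p f : ℕ} [Fact p.Prime] {O k : Type*} [CommRing O] [IsDomain O] [Field k] [CharP k p]
  [Finite k] {κ : Subfield k} [Fintype κ] [DecidableEq κ] {ρ : O →+* κ}
  (hρ : IsUnramifiedReduction p f ρ) [Algebra O (WittVector p k)]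
  (hO : ∀ c : O, (algebraMap O (WittVector p k) c).coeff 0 = (ρ c : k))
  {φ : Amv p O f →ₐ[O] Amv p O f} (hφ : IsPhiQ p O f φ)

include hρ hO hφ

/-- The reduction `A_mv → A_∞` is equivariant, and `φ_q` is bijective on `W(A_∞)`; therefore it
lifts to an equivariant homomorphism, which is linear over `O` because on `O` it is itself an
equivariant lift, and extends to `A_{mv,E₀}` by linearity. -/
theorem exists_isCanonicalMap :
    ∃ ι : AmvE0 p O f k →ₐ[WittVector p k] WittVector p (AInf p f k),
      IsCanonicalMap p O f k φ ι := by
  obtain ⟨π, hπ⟩ := Amv.exists_isRed (k := k) hρ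
  have hpow : ∀ x, π (φ x) = π x ^ p ^ f := by
    intro x
    obtain ⟨y, hy⟩ := Amv.exists_phi_eq (k := k) hρ hφ x
    rw [hy, map_add, map_mul, map_natCast, CharP.cast_eq_zero, zero_mul, add_zero, map_pow]
  have hκ : ∀ u ∈ κ, u ^ p ^ f = u := by
    intro u hu
    have h1 := FiniteField.pow_card (⟨u, hu⟩ : κ)
    rw [hρ.card] at h1
    exact congrArg Subtype.val h1
  obtain ⟨g, hg, hgφ⟩ := exists_equivariant_lift (φ := φ.toRingHom) (Φ := wittPhi p f k)
    hρ.ne_zero_f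
    (isPowComplete_witt (AInf p f k)) (Amv.exists_phi_eq (k := k) hρ hφ)
    (fun x hx => Amv.eq_zero_of_mul_eq_zero (k := k) (κ := κ) hρ hx) (wittRed p f k)
    surjective_wittRed wittRed_eq_zero_iff π (fun x w hw => by
      rw [wittPhi_apply, wittRed_map, hw, phi_eq_pow hκ (hπ.mem_intSubring x)]
      exact (hpow x).symm)
  -- `g` is `O`-linear, since `φ_q` is trivial on `O` and on `W(k)`
  have hgO : g.comp (algebraMap O (Amv p O f)) =
      (algebraMap (WittVector p k) (WittVector p (AInf p f k))).comp
        (algebraMap O (WittVector p k)) := by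
    refine eq_of_equivariant (φ := RingHom.id O) (Φ := wittPhi p f k) hρ.ne_zero_f
      (isPowComplete_witt (AInf p f k)) (fun x => ?_) (fun x => ?_) (fun x => ?_) fun x => ?_
    · obtain ⟨y, hy⟩ := hρ.map_eq_zero (x - x ^ p ^ f) (by
        rw [map_sub, map_pow, ← hρ.card, FiniteField.pow_card, sub_self])
      exact ⟨y, by rw [← hy, add_sub_cancel]; rfl⟩
    · have h1 := hgφ (algebraMap O _ x)
      change g (φ _) = _ at h1
      rwa [AlgHom.commutes] at h1
    · exact (map_phiInf_algebraMap _).symm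
    · rw [← wittRed_eq_zero_iff, map_sub, sub_eq_zero]
      change wittRed p f k (g _) = wittRed p f k (algebraMap (WittVector p k) _ _)
      rw [hg, hπ.map_algebraMap, wittRed_algebraMap, hO]
  let : Algebra O (WittVector p (AInf p f k)) :=
    ((algebraMap (WittVector p k) (WittVector p (AInf p f k))).comp
        (algebraMap O (WittVector p k))).toAlgebra
  have : IsScalarTower O (WittVector p k) (WittVector p (AInf p f k)) :=
    .of_algebraMap_eq fun _ => rfl
  let g' : Amv p O f →ₐ[O] WittVector p (AInf p f k) := ⟨g, fun c => congrArg (· c) hgO⟩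
  let ι : AmvE0 p O f k →ₐ[WittVector p k] WittVector p (AInf p f k) :=
    Algebra.TensorProduct.lift (Algebra.ofId _ _) g' fun _ _ => Commute.all _ _
  have hι : ∀ w a, ι (w ⊗ₜ a) = algebraMap _ _ w * g a := fun w a =>
    Algebra.TensorProduct.lift_tmul _ _ _ _ _
  have hι1 : ∀ a, ι (toAmvE0 p O f k a) = g a := fun a => by
    change ι (1 ⊗ₜ a) = g a
    rw [hι, map_one, one_mul]
  refine ⟨ι, ⟨fun x => ?_, ?_, fun i => ?_⟩⟩
  · induction x using TensorProduct.induction_on with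
    | zero => simp
    | tmul w a =>
      change ι (Algebra.TensorProduct.map _ _ _) = _
      rw [Algebra.TensorProduct.map_tmul, hι, hι, map_mul, map_phiInf_algebraMap]
      exact congrArg _ (hgφ a)
    | add x y hx hy => simp only [map_add, hx, hy]
  · have h1 : (fun x => (ι (toAmvE0 p O f k x)).coeff 0) = π := by
      funext x
      rw [hι1]
      exact hg x
    rw [h1]
    exact hπ.continuous
  · rw [hι1, tInf_eq, ← hπ.map_T]
    exact hg _

omit hφ in
/-- The reduction of a canonical map is determined. -/
theorem wittRed_canonicalMap {π : Amv p O f →+* (perfFiltration p f k).Completion}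
    (hπ : Amv.IsRed ρ π) {ι : AmvE0 p O f k →ₐ[WittVector p k] WittVector p (AInf p f k)}
    (hι : IsCanonicalMap p O f k φ ι) (x : Amv p O f) :
    wittRed p f k (ι (toAmvE0 p O f k x)) = π x := by
  have h1 : ((wittRed p f k).comp ι.toRingHom).comp (toAmvE0 p O f k).toRingHom = π := by
    refine Amv.hom_eq hρ hι.continuous_red hπ.continuous (fun c => ?_) fun i => ?_
    · change wittRed p f k (ι (toAmvE0 p O f k (algebraMap O _ c))) = _
      have h2 : algebraMap O (AmvE0 p O f k) c = algebraMap (WittVector p k) _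
        (algebraMap O (WittVector p k) c) := rfl
      rw [AlgHom.commutes, h2, AlgHom.commutes, hπ.map_algebraMap, wittRed_algebraMap, hO]
    · rw [hπ.map_T, ← tInf_eq]
      exact hι.red_T i
  exact congrArg (· x) h1

/-- Two canonical maps have the same reduction on `A_mv`, by continuity and density, and an
equivariant lift is determined by its reduction. -/
theorem isCanonicalMap_unique {ι ι' : AmvE0 p O f k →ₐ[WittVector p k] WittVector p (AInf p f k)}
    (hι : IsCanonicalMap p O f k φ ι) (hι' : IsCanonicalMap p O f k φ ι') : ι = ι' := by
  obtain ⟨π, hπ⟩ := Amv.exists_isRed (k := k) hρ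
  have hφE : ∀ x, phiE0 p O f k φ (toAmvE0 p O f k x) = toAmvE0 p O f k (φ x) := fun x => by
    change Algebra.TensorProduct.map _ _ (1 ⊗ₜ x) = _
    rw [Algebra.TensorProduct.map_tmul]
    rfl
  have h1 : ι.toRingHom.comp (toAmvE0 p O f k).toRingHom =
      ι'.toRingHom.comp (toAmvE0 p O f k).toRingHom := by
    refine eq_of_equivariant (φ := φ.toRingHom) (Φ := wittPhi p f k) hρ.ne_zero_f
      (isPowComplete_witt (AInf p f k)) (Amv.exists_phi_eq (k := k) hρ hφ) (fun x => ?_)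
      (fun x => ?_) fun x => ?_
    · have := hι.map_phi (toAmvE0 p O f k x)
      rwa [hφE] at this
    · have := hι'.map_phi (toAmvE0 p O f k x)
      rwa [hφE] at this
    · rw [← wittRed_eq_zero_iff, map_sub, sub_eq_zero]
      exact (wittRed_canonicalMap hρ hO hπ hι x).trans (wittRed_canonicalMap hρ hO hπ hι' x).symm
  ext x : 1
  induction x using TensorProduct.induction_on with
  | zero => rw [map_zero, map_zero]
  | tmul w a =>
    have h2 : w ⊗ₜ[O] a = w • toAmvE0 p O f k a := by
      change _ = w • ((1 : WittVector p k) ⊗ₜ[O] a)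
      rw [TensorProduct.smul_tmul', smul_eq_mul, mul_one]
    rw [h2, map_smul, map_smul]
    exact congrArg (w • ·) (congrArg (· a) h1)
  | add x y hx hy => rw [map_add, map_add, hx, hy]

end Compare

section Flat

open PerfCompletion

variable {p f : ℕ} [Fact p.Prime] {O k : Type*} [CommRing O] [IsDomain O] [Field k] [CharP k p]
  [Finite k] {κ : Subfield k} [Fintype κ] [DecidableEq κ] {ρ : O →+* κ}
  (hρ : IsUnramifiedReduction p f ρ) [Algebra O (WittVector p k)]
  (hO : ∀ c : O, (algebraMap O (WittVector p k) c).coeff 0 = (ρ c : k))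
  {φ : Amv p O f →ₐ[O] Amv p O f}
  {ι : AmvE0 p O f k →ₐ[WittVector p k] WittVector p (AInf p f k)}
  (hι : IsCanonicalMap p O f k φ ι)

theorem cf_of_single_zero_mul (u : k) (x : (perfFiltration p f k).Completion)
    (a : Fin f → invPow p) :
    cf ((perfFiltration p f k).of (AddMonoidAlgebra.single 0 u) * x) a = u * cf x a := by
  rw [cf_of_single_mul, sub_zero]

include hρ hO hι

theorem wittRed_sum {π : Amv p O f →+* (perfFiltration p f k).Completion}
    (hπ : Amv.IsRed ρ π) {d : ℕ} (b : Fin d → k) (a : Fin d → Amv p O f) :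
    wittRed p f k (ι (∑ i, WittVector.teichmuller p (b i) ⊗ₜ a i)) =
      ∑ i, (perfFiltration p f k).of (AddMonoidAlgebra.single 0 (b i)) * π (a i) := by
  rw [map_sum, map_sum]
  refine Finset.sum_congr rfl fun i _ => ?_
  have h2 : WittVector.teichmuller p (b i) ⊗ₜ[O] a i =
      algebraMap (WittVector p k) _ (WittVector.teichmuller p (b i)) * toAmvE0 p O f k (a i) := by
    change _ = (WittVector.teichmuller p (b i) ⊗ₜ[O] (1 : Amv p O f)) *
      ((1 : WittVector p k) ⊗ₜ[O] a i)
    rw [Algebra.TensorProduct.tmul_mul_tmul, one_mul, mul_one]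
  rw [h2, map_mul, map_mul, AlgHom.commutes, wittRed_canonicalMap hρ hO hπ hι, wittRed_algebraMap,
    WittVector.teichmuller_coeff_zero]

theorem wittRed_canonicalMap_mem (x : AmvE0 p O f k) :
    wittRed p f k (ι x) ∈ intSubring p f (⊤ : Subfield k) := by
  obtain ⟨π, hπ⟩ := Amv.exists_isRed (k := k) hρ
  obtain ⟨a, rfl⟩ := exists_sum_amvE0 hρ hO (Module.finBasis κ k) x
  rw [wittRed_sum hρ hO hι hπ]
  refine sum_mem fun i _ => mul_mem ?_ ?_
  · rw [mem_intSubring_iff_cf]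
    refine fun c => ⟨trivial, fun h => ?_⟩
    rw [cf_of, AddMonoidAlgebra.coeff_single] at h
    by_cases hc : c = 0
    · exact hc ▸ zero_mem _
    · exact absurd (Finsupp.single_eq_of_ne hc) h
  · rw [mem_intSubring_iff_cf]
    exact fun c => ⟨trivial, (mem_intSubring_iff_cf.1 (hπ.mem_intSubring (a i)) c).2⟩

/-- The kernel of the reduction of the canonical map is generated by `p`. -/
theorem exists_of_wittRed_eq_zero {x : AmvE0 p O f k} (hx : wittRed p f k (ι x) = 0) :
    ∃ y, x = p * y := by
  obtain ⟨π, hπ⟩ := Amv.exists_isRed (k := k) hρ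
  let b := Module.finBasis κ k
  obtain ⟨a, rfl⟩ := exists_sum_amvE0 hρ hO b x
  rw [wittRed_sum hρ hO hι hπ] at hx
  have h1 : ∀ i, π (a i) = 0 := by
    intro i
    refine ext_cf fun c => ?_
    have h2 : ∀ i, cf (π (a i)) c ∈ κ := fun i =>
      (mem_intSubring_iff_cf.1 (hπ.mem_intSubring (a i)) c).1
    have h3 := congrArg (fun y => cf y c) hx
    simp only [cf_sum, cf_of_single_zero_mul, cf_zero] at h3
    have h4 := Fintype.linearIndependent_iff.1 b.linearIndependent
      (fun i => ⟨cf (π (a i)) c, h2 i⟩) (by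
        rw [← h3]
        refine Finset.sum_congr rfl fun i _ => ?_
        rw [Subfield.smul_def, smul_eq_mul, mul_comm])
    rw [cf_zero]
    exact congrArg Subtype.val (h4 i)
  choose y hy using fun i => hπ.exists_of_eq_zero (a i) (h1 i)
  refine ⟨∑ i, WittVector.teichmuller p (b i) ⊗ₜ y i, ?_⟩
  rw [Finset.mul_sum]
  refine Finset.sum_congr rfl fun i _ => ?_
  rw [hy, ← nsmul_eq_mul, ← nsmul_eq_mul, TensorProduct.tmul_smul]

/-- The image of the reduction of the canonical map consists of the series with integral
exponents. -/
theorem exists_wittRed_eq {y : (perfFiltration p f k).Completion}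
    (hy : y ∈ intSubring p f (⊤ : Subfield k)) : ∃ x, wittRed p f k (ι x) = y := by
  obtain ⟨π, hπ⟩ := Amv.exists_isRed (k := k) hρ
  let b := Module.finBasis κ k
  have h1 : ∀ i, ∃ z : (perfFiltration p f k).Completion, ∀ c, cf z c = (b.repr (cf y c) i : k) :=
    by
    intro i
    refine exists_cf_eq _ fun n => (finite_cf y n).subset fun c hc => ⟨hc.1, fun h => hc.2 ?_⟩
    rw [h, map_zero]
    rfl
  choose z hz using h1
  have h2 : ∀ i, z i ∈ intSubring p f κ := by
    intro i
    rw [mem_intSubring_iff_cf]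
    refine fun c => ⟨by rw [hz]; exact Subtype.property _, fun h => ?_⟩
    refine (mem_intSubring_iff_cf.1 hy c).2 fun h' => h ?_
    rw [hz, h', map_zero]
    rfl
  choose a ha using fun i => hπ.exists_eq (z i) (h2 i)
  refine ⟨∑ i, WittVector.teichmuller p (b i) ⊗ₜ a i, ?_⟩
  rw [wittRed_sum hρ hO hι hπ]
  refine ext_cf fun c => ?_
  rw [cf_sum]
  simp only [cf_of_single_zero_mul, ha, hz]
  conv_rhs => rw [← b.sum_repr (cf y c)]
  refine Finset.sum_congr rfl fun i _ => ?_
  rw [Subfield.smul_def, smul_eq_mul, mul_comm]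

/-- The canonical map is faithfully flat: flatness is checked modulo `p`, where it holds since
`A_∞` is free in a completed sense over the subring of series with integral exponents; the
projection onto this subring shows that no maximal ideal generates the unit ideal. -/
theorem faithfullyFlat_canonicalMap : ι.toRingHom.FaithfullyFlat := by
  have hf : NeZero f := ⟨hρ.ne_zero_f⟩
  let : Algebra (AmvE0 p O f k) (WittVector p (AInf p f k)) := ι.toRingHom.toAlgebra
  have hsmul : ∀ (r : AmvE0 p O f k) (x : WittVector p (AInf p f k)), r • x = ι r * x :=
    fun _ _ => rfl
  have hN : IsNoetherianRing (AmvE0 p O f k) := isNoetherianRing_amvE0 hρ hO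
  have hW := isPowComplete_witt (p := p) (AInf p f k)
  have hpow : ∀ (n : ℕ) (z : WittVector p (AInf p f k)), (p : AmvE0 p O f k) ^ n • z =
      (p : WittVector p (AInf p f k)) ^ n • z := by
    intro n z
    rw [hsmul, map_pow, map_natCast, smul_eq_mul]
  have hpsmul : ∀ z : WittVector p (AInf p f k), (p : AmvE0 p O f k) • z = p * z := by
    intro z
    rw [hsmul, map_natCast]
  have hM : IsPowComplete (p : AmvE0 p O f k) (WittVector p (AInf p f k)) := by
    refine ⟨fun x hx => hW.haus x fun n => ?_, fun m => ?_⟩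
    · obtain ⟨z, hz⟩ := hx n
      exact ⟨z, by rw [hz, hpow]⟩
    · obtain ⟨s, hs⟩ := hW.prec m
      refine ⟨s, fun n => ?_⟩
      simpa only [hpow] using hs n
  have hflat : Module.Flat (AmvE0 p O f k) (WittVector p (AInf p f k)) := by
    refine hM.flat_of_relations (fun x hx => ?_) fun l g y z hz => ?_
    · rw [hpsmul, mul_comm] at hx
      exact WittVector.eq_zero_of_p_mul_eq_zero x hx
    · have h1 : ∑ i, wittRed p f k (ι (g i)) * wittRed p f k (y i) = 0 := by
        have h2 := congrArg (wittRed p f k) hz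
        rw [hpsmul, map_mul, wittRed_natCast, zero_mul, map_sum] at h2
        simpa only [hsmul, map_mul] using h2
      obtain ⟨m, a, w, ha, hy, hga⟩ :=
        trivial_relation (fun i => wittRed_canonicalMap_mem hρ hO hι (g i)) h1
      choose a' ha' using fun i j => exists_wittRed_eq hρ hO hι (ha i j)
      choose w' hw' using fun j => surjective_wittRed (w j)
      refine ⟨Fin m, inferInstance, a', w', fun i => ?_, fun j => ?_⟩
      · have h3 : wittRed p f k (y i - ∑ j, a' i j • w' j) = 0 := by
          rw [map_sub, map_sum, hy i, sub_eq_zero]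
          refine Finset.sum_congr rfl fun j _ => ?_
          rw [hsmul, map_mul, ha', hw']
        obtain ⟨y', hy'⟩ := (wittRed_eq_zero_iff _).1 h3
        exact ⟨y', by rw [hpsmul, ← hy', add_sub_cancel]⟩
      · refine exists_of_wittRed_eq_zero hρ hO hι ?_
        rw [map_sum, map_sum, ← hga j]
        refine Finset.sum_congr rfl fun i _ => ?_
        rw [map_mul, map_mul, ha']
  refine @Module.FaithfullyFlat.mk _ _ _ _ _ hflat fun m hm htop => hm.ne_top ?_
  have hmem : ∀ x ∈ (m • ⊤ : Submodule (AmvE0 p O f k) (WittVector p (AInf p f k))),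
      ∃ r ∈ m, proj (wittRed p f k x) = wittRed p f k (ι r) := by
    intro x hx
    induction hx using Submodule.smul_induction_on' with
    | smul r hr y _ =>
      obtain ⟨s, hs⟩ := exists_wittRed_eq hρ hO hι (proj_mem (wittRed p f k y))
      refine ⟨r * s, m.mul_mem_right s hr, ?_⟩
      rw [hsmul, map_mul, proj_mul (wittRed_canonicalMap_mem hρ hO hι r), map_mul, map_mul, hs]
    | add x _ y _ hx hy =>
      obtain ⟨r, hr, hr'⟩ := hx
      obtain ⟨s, hs, hs'⟩ := hy
      exact ⟨r + s, add_mem hr hs, by rw [map_add, proj_add, hr', hs', map_add, map_add]⟩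
  obtain ⟨r, hr, h1⟩ := hmem 1 (by rw [htop]; trivial)
  rw [map_one, proj_eq_self (one_mem (intSubring p f (⊤ : Subfield k)))] at h1
  obtain ⟨s, hs⟩ := exists_of_wittRed_eq_zero hρ hO hι (x := 1 - r) (by
    rw [map_sub, map_one, map_sub, map_one, h1, sub_self])
  have hp := natCast_mem_of_isMaximal hρ hO m
  rw [Ideal.eq_top_iff_one, ← sub_add_cancel (1 : AmvE0 p O f k) r, hs]
  exact add_mem (m.mul_mem_right s hp) hr

end Flat
end MvIwasawa
end

theorem mainTheorem12 (p : ℕ) [Fact p.Prime]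
    (K : Type*) [Field K] [Algebra ℚ_[p] K] [FiniteDimensional ℚ_[p] K]
    (hK : (Ideal.span {(p : MvIwasawa.integerRing p K)}).IsMaximal)
    (E : Type*) [Field E] [Algebra ℚ_[p] E] [FiniteDimensional ℚ_[p] E]
    [Algebra K E] [IsScalarTower ℚ_[p] K E]
    [Algebra (MvIwasawa.integerRing p K) (WittVector p (MvIwasawa.resField p E))]
    [Algebra (WittVector p (MvIwasawa.resField p E)) (MvIwasawa.integerRing p E)]
    (f : ℕ) (hf : f = Module.finrank ℚ_[p] K) :
    (∃! φ : MvIwasawa.Amv p (MvIwasawa.integerRing p K) f →ₐ[MvIwasawa.integerRing p K]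
        MvIwasawa.Amv p (MvIwasawa.integerRing p K) f,
      MvIwasawa.IsPhiQ p (MvIwasawa.integerRing p K) f φ) ∧
    ∀ φ : MvIwasawa.Amv p (MvIwasawa.integerRing p K) f →ₐ[MvIwasawa.integerRing p K]
        MvIwasawa.Amv p (MvIwasawa.integerRing p K) f,
      MvIwasawa.IsPhiQ p (MvIwasawa.integerRing p K) f φ →
      (∃! ι : MvIwasawa.AmvE0 p (MvIwasawa.integerRing p K) f (MvIwasawa.resField p E)
            →ₐ[WittVector p (MvIwasawa.resField p E)]
            WittVector p (MvIwasawa.AInf p f (MvIwasawa.resField p E)),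
        MvIwasawa.IsCanonicalMap p (MvIwasawa.integerRing p K) f (MvIwasawa.resField p E) φ ι) ∧
      ∀ ι : MvIwasawa.AmvE0 p (MvIwasawa.integerRing p K) f (MvIwasawa.resField p E)
            →ₐ[WittVector p (MvIwasawa.resField p E)]
            WittVector p (MvIwasawa.AInf p f (MvIwasawa.resField p E)),
        MvIwasawa.IsCanonicalMap p (MvIwasawa.integerRing p K) f (MvIwasawa.resField p E) φ ι →
        Function.Injective (MvIwasawa.extendScalars (MvIwasawa.integerRing p E) ι) ∧
        (MvIwasawa.extendScalars (MvIwasawa.integerRing p E) ι).toRingHom.FaithfullyFlat := by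
  obtain ⟨κ, ρ, hκ, hρ, hρ'⟩ := MvIwasawa.exists_isUnramifiedReduction K hK
    (WittVector.constantCoeff.comp (algebraMap (MvIwasawa.integerRing p K)
      (WittVector p (MvIwasawa.resField p E))))
  rw [← hf] at hρ
  classical
  have hO : ∀ c, (algebraMap (MvIwasawa.integerRing p K)
      (WittVector p (MvIwasawa.resField p E)) c).coeff 0 = (ρ c : MvIwasawa.resField p E) :=
    fun c => (hρ' c).symm
  obtain ⟨φ, hφ⟩ := MvIwasawa.Amv.exists_isPhiQ (MvIwasawa.resField p E) κ hρ
  refine ⟨⟨φ, hφ, fun φ' hφ' => MvIwasawa.Amv.isPhiQ_unique _ κ hρ hφ' hφ⟩, fun φ hφ => ⟨?_, ?_⟩⟩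
  · obtain ⟨ι, hι⟩ := MvIwasawa.exists_isCanonicalMap hρ hO hφ
    exact ⟨ι, hι, fun ι' hι' => MvIwasawa.isCanonicalMap_unique hρ hO hφ hι' hι⟩
  · intro ι hι
    have h := MvIwasawa.faithfullyFlat_tensorMap (T := MvIwasawa.integerRing p E) ι
      (MvIwasawa.faithfullyFlat_canonicalMap hρ hO hι)
    exact ⟨h.injective, h⟩
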